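/- Let $d,T\ge 1$ be integers. An input stream is $x=(x^1,\dots,x^T)$ with arbitrary $x^t\in\{-1,0,1\}^d$ (general model). Put $f^t(x_i)=1$ if $\sum_{t'\le t}x_i^{t'}>0$ and $f^t(x_i)=0$ otherwise, $\mathrm{CountDistinct}(x)^t=\sum_{i=1}^d f^t(x_i)$, and let $K=K(x)=\sum_{i=1}^d\#\{2\le t\le T: f^t(x_i)\ne f^{t-1}(x_i)\}$ be the total flippancy. Two streams are item-level neighboring if they differ only in the updates of a single item. A randomized online algorithm outputs, at each time $t$, a real number depending only on $x^1,\dots,x^t$ and on its random coins; it is item-level $(\epsilon,\delta)$-differentially private if $\Pr[A(x)\in S]\le e^{\epsilon}\Pr[A(y)\in S]+\delta$ for all item-level neighboring $x,y$ and all measurable sets $S$ of output sequences, and $\epsilon$-differentially private if this holds with $\delta=0$. Its error is the maximum over all $t$ of the distance between its output at time $t$ and $\mathrm{CountDistinct}(x)^t$. Write $\ell_K=\max(1,\ln K)$ (with $\ell_0=1$) and $\ell_\delta=\max(1,\ln(1/\delta))$. Theorem. There is an absolute constant $C>0$ such that for all integers $d,T\ge1$ and all $\beta>0$: 1. For every $\epsilon>0$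 there is an item-level $\epsilon$-differentially private online algorithm, which is not given $K$, such that for every stream $x$, with probability at least $1-\beta$, its error is at most $$C\Big(\min\big(d,\;K,\;\ell_K\sqrt{\epsilon^{-1}K\ln(T/\beta)},\;\epsilon^{-1}T\ln(T/\beta)\big)+\epsilon^{-1}\ell_K^2\ln(\ell_K/\beta)\Big).$$ 2. For every $0<\epsilon<1$ and $0<\delta<1$ there is an item-level $(\epsilon,\delta)$-differentially private online algorithm, which is not given $K$, such that for every stream $x$, with probability at least $1-\beta$, its error is at most $$C\Big(\min\big(d,\;K,\;(\epsilon^{-2}K\,\ell_K^2\,\ell_\delta\ln^2(T/\beta))^{1/3},\;\epsilon^{-1}\sqrt{T\,\ell_\delta\ln(T/\beta)}\big)+\epsilon^{-1}\ell_K^2\ln(\ell_K/\beta)\Big).$$ -/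

import Mathlib

namespace CountDistinct

/-- An input stream: `T` updates, each a vector in `{-1, 0, 1}^d`. There is no further restriction
on the stream (general model). The entry `x s` is the update of time step `s + 1`. -/
abbrev UpdateStream (d T : ℕ) : Type := Fin T → Fin d → SignType

/-- The count of item `i` after the first `t` updates. -/
def itemCount {d T : ℕ} (x : UpdateStream d T) (t : ℕ) (i : Fin d) : ℤ :=
  ∑ s : Fin T with s.val < t, ((x s i : SignType) : ℤ)

/-- Item `i` is present at time `t`, i.e. `f^t(x_i) = 1`: its count is positive. -/
def Present {d T : ℕ} (x : UpdateStream d T) (t : ℕ) (i : Fin d) : Prop :=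
  0 < itemCount x t i

instance {d T : ℕ} (x : UpdateStream d T) (t : ℕ) (i : Fin d) : Decidable (Present x t i) :=
  inferInstanceAs (Decidable (0 < itemCount x t i))

/-- The number of distinct elements present at time `t`. -/
def countDistinct {d T : ℕ} (x : UpdateStream d T) (t : ℕ) : ℕ :=
  (Finset.univ.filter fun i : Fin d => Present x t i).card

/-- The total flippancy: the number of pairs of an item `i` and a time step `t` with `2 ≤ t ≤ T`
such that `f^t(x_i) ≠ f^(t-1)(x_i)`. -/
def totalFlippancy {d T : ℕ} (x : UpdateStream d T) : ℕ :=
  ∑ i : Fin d,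
    ((Finset.Icc 2 T).filter fun t => ¬ (Present x t i ↔ Present x (t - 1) i)).card

/-- Item-level neighboring streams: they agree outside a single item, whose updates may differ
at all time steps. -/
def ItemNeighboring {d T : ℕ} (x y : UpdateStream d T) : Prop :=
  ∃ j : Fin d, ∀ t : Fin T, ∀ i : Fin d, i ≠ j → x t i = y t i

/-- A randomized algorithm in the continual observation model, for streams of `T` updates of `d`
items. `Coins` with `coinLaw` is its source of randomness; `out x ω t` is the output produced
right after update `x t`, and depends only on the coins and on the updates received so far. -/
structure OnlineAlgorithm (d T : ℕ) where
  Coins : Type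
  coinSpace : MeasurableSpace Coins
  coinLaw : MeasureTheory.Measure Coins
  coinLaw_prob : MeasureTheory.IsProbabilityMeasure coinLaw
  out : UpdateStream d T → Coins → Fin T → ℝ
  measurable_out : ∀ x, Measurable (out x)
  causal : ∀ (t : Fin T) (x y : UpdateStream d T), (∀ s, s ≤ t → x s = y s) →
    ∀ ω, out x ω t = out y ω t

attribute [instance] OnlineAlgorithm.coinSpace OnlineAlgorithm.coinLaw_prob

/-- Item-level `(ε, δ)`-differential privacy of the whole output sequence. -/
def OnlineAlgorithm.ItemLevelDP {d T : ℕ} (A : OnlineAlgorithm d T) (ε δ : ℝ) : Prop :=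
  ∀ x y : UpdateStream d T, ItemNeighboring x y → ∀ S : Set (Fin T → ℝ), MeasurableSet S →
    A.coinLaw.real {ω | A.out x ω ∈ S} ≤ Real.exp ε * A.coinLaw.real {ω | A.out y ω ∈ S} + δ

/-- On every stream, with probability at least `1 - β`, the outputs of all time steps are
simultaneously within `err K` of the number of distinct elements, where `K` is the total flippancy
of that stream. The algorithm itself is not given `K`. -/
def OnlineAlgorithm.HasError {d T : ℕ} (A : OnlineAlgorithm d T) (β : ℝ) (err : ℕ → ℝ) : Prop :=
  ∀ x : UpdateStream d T,
    1 - β ≤ A.coinLaw.real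
      {ω | ∀ t : Fin T, |A.out x ω t - countDistinct x (t.val + 1)| ≤ err (totalFlippancy x)}

/-- The logarithm as read inside `O(·)` where its argument may be close to or below `1`. -/
noncomputable def logOne (y : ℝ) : ℝ := max 1 (Real.log y)

/-- The additive term `ε⁻¹ ln² K ln (ln K / β)`. -/
noncomputable def additiveTerm (K : ℕ) (ε β : ℝ) : ℝ :=
  ε⁻¹ * logOne K ^ 2 * Real.log (logOne K / β)

/-- The error bound for `ε`-differential privacy, up to a constant factor. -/
noncomputable def pureBound (d T : ℕ) (ε β : ℝ) (K : ℕ) : ℝ :=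
  min (d : ℝ) (min (K : ℝ)
      (min (logOne K * Real.sqrt (ε⁻¹ * K * Real.log (T / β)))
        (ε⁻¹ * T * Real.log (T / β))))
    + additiveTerm K ε β

/-- The error bound for `(ε, δ)`-differential privacy, up to a constant factor. -/
noncomputable def approxBound (d T : ℕ) (ε δ β : ℝ) (K : ℕ) : ℝ :=
  min (d : ℝ) (min (K : ℝ)
      (min ((ε⁻¹ ^ 2 * K * logOne K ^ 2 * logOne (1 / δ) * Real.log (T / β) ^ 2) ^ (1 / 3 : ℝ))
        (ε⁻¹ * Real.sqrt (T * logOne (1 / δ) * Real.log (T / β)))))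
    + additiveTerm K ε β

end CountDistinct

/-! Item-level neighbours have counts of distinct elements that differ by at most 1 at every time,
and the total variation of the counts is at most `K`. So it suffices to follow an integer sequence
`c`, privately against changing every entry by at most 1, with an error controlled by its variation.

The mechanism holds a noisy value `v` of the count and works in rounds. In round `m` each step has
hazard `exp (γ m * |c - v| - 5 * L)`, and the round survives an accumulated hazard `λ` with
probability `1 / (1 + λ)`. When it ends, the current count is released with fresh noise and round `m
+ 1` begins. Changing the counts by at most 1 multiplies each hazard, hence also `λ`, by a factor
within `exp (± γ m)`. The probability that a round ends at a given step therefore changes by at most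
`exp (3 * γ m)`, however long the round is. With its release a round costs `4 * γ m`, so under pure
privacy a summable sequence `γ`, chosen without knowing `K`, suffices (`likelihood_le_of_near`).

For accuracy, let `s m = L / γ m`. At distance up to `4 * s m` the hazard is negligible, beyond `6 *
s m` it is overwhelming (`failurePotential_step`). So with high probability the error in round `m`
is at most `6 * s m`, and each completed round `j` has seen the count move by more than `2 * s j`.
Hence `∑ j < m, 2 * s j ≤ K`, and also `m ≤ K` (`Accurate.error`). Under pure privacy `1 / γ m` is
of order `min (m log² m) T / ε`. Multiplying `s m ≲ L m ln² K / ε` by `m * s m ≲ K` gives the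
square-root bound, and the `T` part gives the last bound.

Under approximate privacy the loss is measured by a Rényi divergence of order `k + 1`, with `k`
about `8 l / ε` and `l = max 1 (ln (1/δ))`. A round then costs about `((k + 1) * γ m) ^ 2`, so it is
enough that the squares are summable, up to a cap in the early rounds
(`tsum_renyiTerm_likelihood_le`). Now `1 / γ m` is of order `√(l m log² m) / ε`, which leads to the
cube root. As soon as `s m` exceeds the error `√(l T L) / ε` of a Gaussian release at every step,
the mechanism switches to such releases.

The very first release is treated separately in both cases: it costs a pure `ε / 2`, and its error
`8 log (1/β) / ε`, free of `T`, goes into the additive term. For `K = 0` it is the only error. -/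

namespace CountDistinct

open scoped ENNReal NNReal
open MeasureTheory

/-! ### Strategies, transcripts and their likelihoods -/

section Transcript

variable {α : Type}

/-- A strategy chooses the law of the next action from the observations made so far and the actions
taken so far, both listed with the newest first. -/
abbrev Strategy (α : Type) : Type := List ℤ → List α → PMF α

/-- The actions taken on the observations `cs`, when `ω` tabulates the action to take in each
situation. Newest first. -/
def transcript (ω : List ℤ × List α → α) : List ℤ → List α
  | [] => []
  | c :: cs => ω (c :: cs, transcript ω cs) :: transcript ω cs

/-- The probability that a strategy takes the actions `h` on the observations `cs`. -/
noncomputable def likelihood (κ : Strategy α) : List ℤ → List α → ℝ≥0∞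
  | [], [] => 1
  | c :: cs, a :: h => likelihood κ cs h * κ (c :: cs) h a
  | _, _ => 0

theorem length_transcript (ω : List ℤ × List α → α) (cs : List ℤ) :
    (transcript ω cs).length = cs.length := by
  induction cs with
  | nil => rfl
  | cons c cs ih => simp [transcript, ih]

/-- Past actions never depend on later observations. Hence every intermediate output is a function
of the final transcript, and privacy of the final transcript suffices. -/
theorem transcript_drop (ω : List ℤ × List α → α) (cs : List ℤ) (n : ℕ) :
    transcript ω (cs.drop n) = (transcript ω cs).drop n := by
  induction cs generalizing n with
  | nil => simp [transcript]
  | cons c cs ih =>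
    cases n with
    | zero => rfl
    | succ n => simpa [transcript] using ih n

theorem likelihood_eq_zero (κ : Strategy α) :
    ∀ (cs : List ℤ) (h : List α), h.length ≠ cs.length → likelihood κ cs h = 0
  | [], [], hl => by simp at hl
  | [], _ :: _, _ => rfl
  | _ :: _, [], _ => rfl
  | _ :: cs, _ :: h, hl => by
    have : h.length ≠ cs.length := by simpa using hl
    simp [likelihood, likelihood_eq_zero κ cs h this]

theorem likelihood_le_one (κ : Strategy α) :
    ∀ (cs : List ℤ) (h : List α), likelihood κ cs h ≤ 1
  | [], [] => le_rfl
  | [], _ :: _ => zero_le_one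
  | _ :: _, [] => zero_le_one
  | _ :: cs, _ :: h => mul_le_one' (likelihood_le_one κ cs h) (PMF.coe_le_one _ _)

theorem likelihood_ne_top (κ : Strategy α) (cs : List ℤ) (h : List α) :
    likelihood κ cs h ≠ ∞ :=
  ((likelihood_le_one κ cs h).trans_lt ENNReal.one_lt_top).ne

theorem tsum_option' {ι : Type*} (f : Option ι → ℝ≥0∞) :
    ∑' o, f o = f none + ∑' i, f (some i) := by
  classical
  rw [ENNReal.tsum_eq_add_tsum_ite none]
  congr 1
  refine ((Option.some_injective ι).tsum_eq ?_).symm.trans (by simp)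
  rintro (_ | i) hi
  · simp at hi
  · exact ⟨i, rfl⟩

theorem tsum_list (f : List α → ℝ≥0∞) :
    ∑' l, f l = f [] + ∑' h, ∑' a, f (a :: h) := by
  let e : Option (List α × α) ≃ List α :=
    { toFun := fun o => o.elim [] fun p => p.2 :: p.1
      invFun := fun l => match l with
        | [] => none
        | a :: h => some (h, a)
      left_inv := by rintro (_ | ⟨h, a⟩) <;> rfl
      right_inv := by rintro (_ | ⟨a, h⟩) <;> rfl }
  rw [← e.tsum_eq f, tsum_option']
  exact congrArg (f [] + ·) (ENNReal.tsum_prod (f := fun h a => f (a :: h)))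

end Transcript

/-! ### Realizing a strategy by a table of independent coins -/

section Coins

variable {α : Type}

/-- A transcript looks up one table entry for each nonempty prefix of the observations. Those
entries have observation lists of different lengths, so they are distinct and independent under a
product measure. -/
theorem exists_cylinder [DecidableEq α] (κ : Strategy α) :
    ∀ (cs : List ℤ) (h : List α), h.length = cs.length →
      ∃ (I : Finset (List ℤ × List α)) (v : List ℤ × List α → α),
        (∀ i ∈ I, i.1.length ≤ cs.length) ∧
        {ω | transcript ω cs = h} = Set.pi I (fun i => {v i}) ∧
        ∏ i ∈ I, κ i.1 i.2 (v i) = likelihood κ cs h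
  | [], [], _ => ⟨∅, fun _ => (κ [] []).support_nonempty.some, by simp, by
      ext; simp [transcript], by simp [likelihood]⟩
  | [], _ :: _, hl => by simp at hl
  | _ :: _, [], hl => by simp at hl
  | c :: cs, a :: h, hl => by
    obtain ⟨I, v, hI, hset, hprod⟩ := exists_cylinder κ cs h (by simpa using hl)
    have hnot : (c :: cs, h) ∉ I := fun hm => by simpa using hI _ hm
    have hne : ∀ i ∈ I, i ≠ (c :: cs, h) := fun i hi e => hnot (e ▸ hi)
    refine ⟨insert (c :: cs, h) I, Function.update v (c :: cs, h) a, ?_, ?_, ?_⟩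
    · intro i hi
      rcases Finset.mem_insert.1 hi with rfl | hi
      · simp
      · exact (hI i hi).trans (by simp)
    · ext ω
      have key : transcript ω cs = h ↔ ∀ i ∈ I, ω i = v i := by
        have := Set.ext_iff.1 hset ω
        simpa [Set.mem_pi] using this
      simp only [Set.mem_ofPred_eq, transcript, List.cons.injEq, Set.mem_pi, Finset.mem_coe,
        Finset.mem_insert, Set.mem_singleton_iff, forall_eq_or_imp, Function.update_self]
      constructor
      · rintro ⟨h1, h2⟩
        rw [h2] at h1
        refine ⟨h1, fun i hi => ?_⟩
        rw [Function.update_of_ne (hne i hi)]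
        exact key.1 h2 i hi
      · rintro ⟨h1, h2⟩
        have h3 := key.2 fun i hi => by
          have := h2 i hi
          rwa [Function.update_of_ne (hne i hi)] at this
        rw [h3]
        exact ⟨h1, rfl⟩
    · rw [Finset.prod_insert hnot, Function.update_self, likelihood, mul_comm, ← hprod]
      congr 1
      exact Finset.prod_congr rfl fun i hi => by rw [Function.update_of_ne (hne i hi)]

variable [MeasurableSpace α] [DiscreteMeasurableSpace α]

/-- The law of the table of actions: independent entries, each with the law the strategy asks
for. -/
noncomputable def coinMeasure (κ : Strategy α) : Measure (List ℤ × List α → α) :=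
  Measure.infinitePi fun i => (κ i.1 i.2).toMeasure

instance (κ : Strategy α) : IsProbabilityMeasure (coinMeasure κ) := by
  unfold coinMeasure; infer_instance

theorem coinMeasure_transcript_eq (κ : Strategy α) (cs : List ℤ) (h : List α) :
    coinMeasure κ {ω | transcript ω cs = h} = likelihood κ cs h := by
  classical
  by_cases hl : h.length = cs.length
  · obtain ⟨I, v, -, hset, hprod⟩ := exists_cylinder κ cs h hl
    rw [hset, coinMeasure, Measure.infinitePi_pi _ fun i _ => MeasurableSet.of_discrete, ← hprod]
    exact Finset.prod_congr rfl fun i _ => PMF.toMeasure_apply_singleton _ _ (.of_discrete)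
  · rw [likelihood_eq_zero κ cs h hl]
    convert measure_empty (μ := coinMeasure κ)
    ext ω
    simp only [Set.mem_ofPred_eq, Set.mem_empty_iff_false, iff_false]
    rintro rfl
    exact hl (length_transcript ω cs)

theorem measurableSet_transcript_eq (cs : List ℤ) (h : List α) :
    MeasurableSet {ω : List ℤ × List α → α | transcript ω cs = h} := by
  classical
  by_cases hl : h.length = cs.length
  · by_cases hα : Nonempty α
    · obtain ⟨I, v, -, hset, -⟩ := exists_cylinder (fun _ _ => PMF.pure hα.some) cs h hl
      rw [hset]
      exact MeasurableSet.pi I.countable_toSet fun i _ => .of_discrete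
    · have : IsEmpty (List ℤ × List α → α) := ⟨fun ω => hα ⟨ω ([], [])⟩⟩
      exact Subsingleton.measurableSet
  · convert MeasurableSet.empty (α := List ℤ × List α → α)
    ext ω
    simp only [Set.mem_ofPred_eq, Set.mem_empty_iff_false, iff_false]
    rintro rfl
    exact hl (length_transcript ω cs)

theorem measurableSet_transcript_mem [Countable α] (cs : List ℤ) (S : Set (List α)) :
    MeasurableSet {ω : List ℤ × List α → α | transcript ω cs ∈ S} := by
  have : {ω : List ℤ × List α → α | transcript ω cs ∈ S}
      = ⋃ h ∈ S, {ω | transcript ω cs = h} := by ext; simp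
  rw [this]
  exact MeasurableSet.biUnion S.to_countable fun h _ => measurableSet_transcript_eq cs h

theorem coinMeasure_transcript_mem [Countable α] (κ : Strategy α) (cs : List ℤ)
    (S : Set (List α)) :
    coinMeasure κ {ω | transcript ω cs ∈ S} = ∑' h, S.indicator (likelihood κ cs) h := by
  have : {ω : List ℤ × List α → α | transcript ω cs ∈ S}
      = ⋃ h ∈ S, {ω | transcript ω cs = h} := by ext; simp
  rw [this, measure_biUnion S.to_countable, ← tsum_subtype]
  · simp_rw [coinMeasure_transcript_eq]
  · intro h _ h' _ hne
    refine Set.disjoint_left.2 fun ω h1 h2 => hne ?_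
    exact (show transcript ω cs = h from h1).symm.trans h2
  · exact fun h _ => measurableSet_transcript_eq cs h

end Coins

/-! ### Rényi sums and their conversion to event probabilities -/

section Renyi

/-- The summand `a ^ (k + 1) / b ^ k` of the Rényi divergence of order `k + 1`. -/
noncomputable def renyiTerm (k : ℕ) (a b : ℝ≥0∞) : ℝ≥0∞ := a ^ (k + 1) / b ^ k

theorem renyiTerm_zero (k : ℕ) (b : ℝ≥0∞) : renyiTerm k 0 b = 0 := by simp [renyiTerm]

theorem renyiTerm_self (k : ℕ) {a : ℝ≥0∞} (ha : a ≠ ∞) : renyiTerm k a a = a := by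
  by_cases h0 : a = 0
  · simp [h0, renyiTerm_zero]
  · rw [renyiTerm, pow_succ', mul_div_assoc,
      ENNReal.div_self (pow_ne_zero _ h0) (ENNReal.pow_ne_top ha), mul_one]

theorem renyiTerm_mul (k : ℕ) {a b c d : ℝ≥0∞} (hb : b ≠ ∞) (hd : d ≠ ∞) :
    renyiTerm k (a * c) (b * d) = renyiTerm k a b * renyiTerm k c d := by
  rw [renyiTerm, renyiTerm, renyiTerm, mul_pow, mul_pow, div_eq_mul_inv, div_eq_mul_inv,
    div_eq_mul_inv, ENNReal.mul_inv (Or.inr (ENNReal.pow_ne_top hd))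
      (Or.inl (ENNReal.pow_ne_top hb))]
  ring

/-- If `a > e * b`, then multiplying `a` by the `k`-th power of `a / (e * b) > 1` only increases it
and gives the second term. -/
theorem le_add_renyiTerm (k : ℕ) {a b e : ℝ≥0∞} (ha : a ≠ ∞) (hb : b ≠ ∞) (he' : e ≠ ∞) :
    a ≤ e * b + renyiTerm k a b / e ^ k := by
  by_cases h : a ≤ e * b
  · exact h.trans le_self_add
  · push Not at h
    refine le_trans ?_ le_add_self
    have ha0 : a ≠ 0 := (zero_le.trans_lt h).ne'
    rw [renyiTerm, div_eq_mul_inv, div_eq_mul_inv, mul_assoc,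
      ← ENNReal.mul_inv (Or.inr (ENNReal.pow_ne_top he')) (Or.inl (ENNReal.pow_ne_top hb)),
      ← mul_pow, ← div_eq_mul_inv, ENNReal.le_div_iff_mul_le (Or.inr (pow_ne_zero _ ha0))
      (Or.inr (ENNReal.pow_ne_top ha)), pow_succ', mul_comm b]
    gcongr

theorem renyiTerm_eq_ofReal (k : ℕ) {a b : ℝ} (ha : 0 ≤ a) (hb : 0 < b) :
    renyiTerm k (ENNReal.ofReal a) (ENNReal.ofReal b) = ENNReal.ofReal (a ^ (k + 1) / b ^ k) := by
  rw [renyiTerm, ← ENNReal.ofReal_pow ha, ← ENNReal.ofReal_pow hb.le,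
    ← ENNReal.ofReal_div_of_pos (pow_pos hb k)]

/-- A bounded Rényi divergence, followed by a pointwise bounded ratio, bounds the probability of
every event up to a multiplicative and an additive loss. -/
theorem tsum_indicator_le_of_renyi {ι : Type*} (k : ℕ) {P Z Q : ι → ℝ≥0∞} {e₁ e₂ M : ℝ≥0∞}
    (hP : ∀ i, P i ≠ ∞) (hZ : ∀ i, Z i ≠ ∞) (hZQ : ∀ i, Z i ≤ e₁ * Q i)
    (he' : e₂ ≠ ∞) (hM : ∑' i, renyiTerm k (P i) (Z i) ≤ M) (S : Set ι) :
    ∑' i, S.indicator P i ≤ e₁ * e₂ * ∑' i, S.indicator Q i + M / e₂ ^ k := by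
  calc ∑' i, S.indicator P i
      ≤ ∑' i, (e₁ * e₂ * S.indicator Q i + renyiTerm k (P i) (Z i) / e₂ ^ k) := by
        refine ENNReal.tsum_le_tsum fun i => ?_
        by_cases hi : i ∈ S
        · simp only [Set.indicator_of_mem hi]
          refine (le_add_renyiTerm k (hP i) (hZ i) he').trans ?_
          refine add_le_add ?_ le_rfl
          calc e₂ * Z i ≤ e₂ * (e₁ * Q i) := by gcongr; exact hZQ i
            _ = e₁ * e₂ * Q i := by ring
        · simp [Set.indicator_of_notMem hi]
    _ = e₁ * e₂ * ∑' i, S.indicator Q i + (∑' i, renyiTerm k (P i) (Z i)) / e₂ ^ k := by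
        rw [ENNReal.tsum_add, ENNReal.tsum_mul_left]
        simp_rw [div_eq_mul_inv]
        rw [ENNReal.tsum_mul_right]
    _ ≤ _ := by gcongr

end Renyi

/-! ### Step-by-step bounds along a transcript -/

section Chain

variable {α : Type}

/-- A potential that does not increase in expectation bounds the expectation of its final value. -/
theorem tsum_likelihood_mul_le (κ : Strategy α) (Φ : List ℤ → List α → ℝ≥0∞) (cs : List ℤ)
    (hstep : ∀ (c : ℤ) (cs' : List ℤ) (h : List α), cs'.length < cs.length →
      h.length = cs'.length → ∑' a, κ (c :: cs') h a * Φ (c :: cs') (a :: h) ≤ Φ cs' h) :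
    ∑' h, likelihood κ cs h * Φ cs h ≤ Φ [] [] := by
  induction cs with
  | nil => rw [tsum_list]; simp [likelihood]
  | cons c cs ih =>
    refine le_trans ?_ (ih fun c' cs' h hl => hstep c' cs' h (hl.trans (by simp)))
    rw [tsum_list]
    simp only [likelihood, zero_mul, zero_add, mul_assoc, ENNReal.tsum_mul_left]
    refine ENNReal.tsum_le_tsum fun h => ?_
    by_cases hl : h.length = cs.length
    · gcongr
      exact hstep c cs h (by simp) hl
    · simp [likelihood_eq_zero κ cs h hl]

/-- Two nonempty lists of the same length, related by `p` at the oldest entry and by `q` at all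
others. -/
inductive Linked (p q : ℤ → ℤ → Prop) : List ℤ → List ℤ → Prop
  | single {c c' : ℤ} : p c c' → Linked p q [c] [c']
  | cons {c c' : ℤ} {cs cs' : List ℤ} : Linked p q cs cs' → q c c' →
      Linked p q (c :: cs) (c' :: cs')

theorem Linked.length_eq {p q : ℤ → ℤ → Prop} {cs cs' : List ℤ} (h : Linked p q cs cs') :
    cs.length = cs'.length := by
  induction h with
  | single _ => rfl
  | cons _ _ ih => simp [ih]

theorem Linked.ne_nil {p q : ℤ → ℤ → Prop} {cs cs' : List ℤ} (h : Linked p q cs cs') :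
    cs ≠ [] := by
  cases h <;> simp

/-- Change the oldest entry first, and then all others. -/
theorem Linked.exists_between {p q : ℤ → ℤ → Prop} {cs cs' : List ℤ} (h : Linked p q cs cs') :
    ∃ zs, Linked Eq q cs zs ∧ Linked p Eq zs cs' := by
  induction h with
  | @single c c' h => exact ⟨[c], .single rfl, .single h⟩
  | @cons c c' cs cs' _ h ih =>
    obtain ⟨zs, h1, h2⟩ := ih
    exact ⟨c' :: zs, .cons h1 h, .cons h2 rfl⟩

/-- The factor `ζ` bounds the likelihood ratio so far. It may depend on the history, so a ratio can
shrink again later instead of being paid for at every step. -/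
theorem likelihood_le_mul {p q : ℤ → ℤ → Prop} (κ : Strategy α)
    (ζ : List ℤ → List ℤ → List α → ℝ≥0∞)
    (hinit : ∀ c c' a, p c c' → κ [c] [] a ≤ ζ [c] [c'] [a] * κ [c'] [] a)
    (hstep : ∀ c c' cs cs' h a, Linked p q cs cs' → q c c' → h.length = cs.length →
      ζ cs cs' h * κ (c :: cs) h a ≤ ζ (c :: cs) (c' :: cs') (a :: h) * κ (c' :: cs') h a)
    {cs cs' : List ℤ} (hl : Linked p q cs cs') (h : List α) :
    likelihood κ cs h ≤ ζ cs cs' h * likelihood κ cs' h := by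
  induction hl generalizing h with
  | @single c c' hp =>
    match h with
    | [] => simp [likelihood]
    | [a] => simpa [likelihood] using hinit c c' a hp
    | _ :: _ :: _ => simp [likelihood]
  | @cons c c' cs cs' hcs hq ih =>
    match h with
    | [] => simp [likelihood]
    | a :: h =>
      simp only [likelihood]
      by_cases hlen : h.length = cs.length
      · calc likelihood κ cs h * κ (c :: cs) h a
            ≤ ζ cs cs' h * likelihood κ cs' h * κ (c :: cs) h a := by gcongr; exact ih h
          _ = likelihood κ cs' h * (ζ cs cs' h * κ (c :: cs) h a) := by ring
          _ ≤ likelihood κ cs' h * (ζ (c :: cs) (c' :: cs') (a :: h) * κ (c' :: cs') h a) := by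
            exact mul_le_mul' le_rfl (hstep c c' cs cs' h a hcs hq hlen)
          _ = _ := by ring
      · simp [likelihood_eq_zero κ cs h hlen]

/-- Chain rule: Rényi terms are multiplicative over steps, so a potential that pays for each
conditional divergence bounds the total. The oldest counts agree, so the first action costs nothing.
-/
theorem tsum_renyiTerm_likelihood_mul_le {q : ℤ → ℤ → Prop} (κ : Strategy α) (k N : ℕ)
    (Ψ : List ℤ → List ℤ → List α → ℝ≥0∞) {M : ℝ≥0∞}
    (hinit : ∀ c a, κ [c] [] a * Ψ [c] [c] [a] ≤ κ [c] [] a * M)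
    (hstep : ∀ c c' cs cs' h, Linked Eq q cs cs' → q c c' → h.length = cs.length →
      cs.length < N → ∑' a, renyiTerm k (κ (c :: cs) h a) (κ (c' :: cs') h a) *
        Ψ (c :: cs) (c' :: cs') (a :: h) ≤ Ψ cs cs' h)
    {cs cs' : List ℤ} (hl : Linked Eq q cs cs') (hN : cs.length ≤ N) :
    ∑' h, renyiTerm k (likelihood κ cs h) (likelihood κ cs' h) * Ψ cs cs' h ≤ M := by
  induction hl with
  | @single c c' hp =>
    subst hp
    rw [tsum_list, tsum_list]
    simp only [likelihood, renyiTerm_zero, zero_mul, zero_add, one_mul, tsum_zero, add_zero]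
    calc ∑' a, renyiTerm k (κ [c] [] a) (κ [c] [] a) * Ψ [c] [c] [a]
        ≤ ∑' a, κ [c] [] a * M := by
          refine ENNReal.tsum_le_tsum fun a => ?_
          rw [renyiTerm_self _ (PMF.apply_ne_top _ _)]
          exact hinit c a
      _ = M := by rw [ENNReal.tsum_mul_right, PMF.tsum_coe, one_mul]
  | @cons c c' cs cs' hcs hq ih =>
    refine le_trans ?_ (ih ((Nat.le_succ _).trans hN))
    rw [tsum_list]
    simp only [likelihood, renyiTerm_zero, zero_mul, zero_add]
    refine ENNReal.tsum_le_tsum fun h => ?_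
    by_cases hlen : h.length = cs.length
    · calc _ = ∑' a, renyiTerm k (likelihood κ cs h) (likelihood κ cs' h) *
              (renyiTerm k (κ (c :: cs) h a) (κ (c' :: cs') h a) *
                Ψ (c :: cs) (c' :: cs') (a :: h)) := by
            refine tsum_congr fun a => ?_
            rw [renyiTerm_mul k (likelihood_ne_top _ _ _) (PMF.apply_ne_top _ _), mul_assoc]
        _ ≤ _ := by
            rw [ENNReal.tsum_mul_left]
            gcongr
            exact hstep c c' cs cs' h hcs hq hlen hN
    · simp [likelihood_eq_zero κ cs h hlen, renyiTerm_zero]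

end Chain

/-! ### Integer-valued Laplace and Gaussian noise -/

section Noise

/-- The probability that a random integer exceeds `r` in absolute value. -/
noncomputable def tailProb (ν : PMF ℤ) (r : ℝ) : ℝ≥0∞ := ∑' k : ℤ, if r < |(k : ℝ)| then ν k else 0

theorem exp_sub_le_exp_sq (u : ℝ) : Real.exp u - u ≤ Real.exp (u ^ 2) := by
  rcases le_or_gt |u| 1 with h | h
  · have h1 := (abs_le.1 (Real.abs_exp_sub_one_sub_id_le h)).2
    linarith [Real.add_one_le_exp (u ^ 2)]
  · rcases lt_abs.1 h with h | h
    · have : Real.exp u ≤ Real.exp (u ^ 2) := Real.exp_le_exp.2 (by nlinarith)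
      linarith
    · have h1 : Real.exp u ≤ 1 := Real.exp_le_one_iff.2 (by linarith)
      nlinarith [Real.add_one_le_exp (u ^ 2)]

theorem exp_sub_le_exp_abs (u : ℝ) : Real.exp u - u ≤ Real.exp |u| := by
  rcases le_total 0 u with h | h
  · rw [abs_of_nonneg h]
    linarith
  · rw [abs_of_nonpos h]
    linarith [Real.exp_le_one_iff.2 h, Real.add_one_le_exp (-u)]

/-- A power of a ratio close to `1` is bounded by an affine function of that ratio. -/
theorem pow_le_affine (k : ℕ) {g t x : ℝ} (h1 : Real.exp (-g) ≤ t) (h2 : t ≤ Real.exp g)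
    (hx : min (((k + 1) * g) ^ 2) ((k + 1) * g) ≤ x) :
    t ^ (k + 1) ≤ (k + 1) * t - k + (Real.exp x - 1) := by
  have ht : 0 < t := (Real.exp_pos _).trans_le h1
  have hz1 : -g ≤ Real.log t := (Real.le_log_iff_exp_le ht).2 h1
  have hz2 : Real.log t ≤ g := (Real.log_le_iff_le_exp ht).2 h2
  have hpow : t ^ (k + 1) = Real.exp ((k + 1) * Real.log t) := by
    rw [← Real.rpow_natCast, Real.rpow_def_of_pos ht]
    push_cast
    rw [mul_comm]
  have habs : |(k + 1) * Real.log t| ≤ (k + 1) * g := by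
    rw [abs_mul, abs_of_pos (by positivity)]
    gcongr
    exact abs_le.2 ⟨hz1, hz2⟩
  -- With `u = (k + 1) * log t` this is `exp u ≤ u + exp (u ^ 2)` or `exp u ≤ u + exp |u|`;
  -- afterwards `log t ≤ t - 1` makes `u` affine in `t`.
  have h3 : Real.exp ((k + 1) * Real.log t) - (k + 1) * Real.log t ≤ Real.exp x := by
    rcases min_le_iff.1 hx with hx | hx
    · refine (exp_sub_le_exp_sq _).trans (Real.exp_le_exp.2 (le_trans ?_ hx))
      rw [← sq_abs]
      gcongr
    · exact (exp_sub_le_exp_abs _).trans (Real.exp_le_exp.2 (habs.trans hx))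
  have h5 : (k + 1 : ℝ) * Real.log t ≤ (k + 1) * (t - 1) := by
    gcongr
    exact Real.log_le_sub_one_of_pos ht
  rw [hpow]
  linarith

/-- `pow_le_affine` for the ratio `a / b`, weighted by `b` and arranged without subtraction. Summed
over two probability laws, the terms with `k + 1` cancel. -/
theorem renyiTerm_add_le (k : ℕ) {g x : ℝ} {a b : ℝ≥0∞} (ha : a ≠ ∞) (hb : b ≠ ∞)
    (hab : a ≤ ENNReal.ofReal (Real.exp g) * b) (hba : b ≤ ENNReal.ofReal (Real.exp g) * a)
    (hx : min (((k + 1) * g) ^ 2) ((k + 1) * g) ≤ x) :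
    renyiTerm k a b + (k + 1) * b
      ≤ (k + 1) * a + ENNReal.ofReal (Real.exp x) * b := by
  by_cases h0 : b = 0
  · have : a = 0 := by simpa [h0] using hab
    simp [h0, this, renyiTerm_zero]
  lift a to NNReal using ha
  lift b to NNReal using hb
  have hb0 : 0 < (b : ℝ) := by
    rw [NNReal.coe_pos]
    exact pos_iff_ne_zero.2 fun h => h0 (by simp [h])
  have hab' : (a : ℝ) ≤ Real.exp g * b := by
    have := ENNReal.toReal_mono (by finiteness) hab
    simpa [Real.exp_nonneg] using this
  have hba' : (b : ℝ) ≤ Real.exp g * a := by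
    have := ENNReal.toReal_mono (by finiteness) hba
    simpa [Real.exp_nonneg] using this
  have h1 : Real.exp (-g) ≤ a / b := by
    rw [le_div_iff₀ hb0, Real.exp_neg, inv_mul_le_iff₀ (Real.exp_pos g)]
    exact hba'
  have h2 : (a : ℝ) / b ≤ Real.exp g := (div_le_iff₀ hb0).2 hab'
  have key := mul_le_mul_of_nonneg_right (pow_le_affine k h1 h2 hx) hb0.le
  have e1 : ((a : ℝ) / b) ^ (k + 1) * b = a ^ (k + 1) / b ^ k := by
    rw [div_pow, pow_succ (b : ℝ)]
    field_simp
  have e2 : (k + 1 : ℝ) * (a / b) * b = (k + 1) * a := by field_simp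
  have hfin : (a : ℝ) ^ (k + 1) / b ^ k + (k + 1) * b
      ≤ (k + 1) * a + Real.exp x * b := by
    rw [← e1, ← e2]
    linarith
  have hc : ((k : ℝ≥0∞) + 1) = ENNReal.ofReal (k + 1) := by
    rw [ENNReal.ofReal_add (by positivity) zero_le_one]; simp
  rw [← ENNReal.ofReal_coe_nnreal, ← ENNReal.ofReal_coe_nnreal (p := b),
    renyiTerm_eq_ofReal k (NNReal.coe_nonneg a) hb0, hc, ← ENNReal.ofReal_mul (by positivity),
    ← ENNReal.ofReal_mul (by positivity), ← ENNReal.ofReal_mul (by positivity),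
    ← ENNReal.ofReal_add (by positivity) (by positivity),
    ← ENNReal.ofReal_add (by positivity) (by positivity)]
  exact ENNReal.ofReal_le_ofReal hfin

/-- Pointwise close distributions have small Rényi divergence. -/
theorem tsum_renyiTerm_le_of_ratio {ι : Type*} (k : ℕ) {g x : ℝ} (p p' : ι → ℝ≥0∞)
    (hp : ∑' i, p i = 1) (hp' : ∑' i, p' i = 1)
    (h : ∀ i, p i ≤ ENNReal.ofReal (Real.exp g) * p' i)
    (h' : ∀ i, p' i ≤ ENNReal.ofReal (Real.exp g) * p i)
    (hx : min (((k + 1) * g) ^ 2) ((k + 1) * g) ≤ x) :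
    ∑' i, renyiTerm k (p i) (p' i) ≤ ENNReal.ofReal (Real.exp x) := by
  have hfin : ∀ i, p i ≠ ∞ := fun i =>
    ((ENNReal.le_tsum i).trans_lt (hp ▸ ENNReal.one_lt_top)).ne
  have hfin' : ∀ i, p' i ≠ ∞ := fun i =>
    ((ENNReal.le_tsum i).trans_lt (hp' ▸ ENNReal.one_lt_top)).ne
  have key := ENNReal.tsum_le_tsum fun i => renyiTerm_add_le k (hfin i) (hfin' i) (h i) (h' i) hx
  rw [ENNReal.tsum_add, ENNReal.tsum_add, ENNReal.tsum_mul_left, ENNReal.tsum_mul_left,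
    ENNReal.tsum_mul_left, hp, hp', mul_one, mul_one, add_comm] at key
  exact (ENNReal.add_le_add_iff_left (by finiteness)).1 key

theorem tsum_sub_right (f : ℤ → ℝ≥0∞) (c : ℤ) : ∑' v, f (v - c) = ∑' v, f v :=
  (Equiv.subRight c).tsum_eq f

theorem summable_exp_neg_mul_abs {θ : ℝ} (hθ : 0 < θ) :
    Summable fun k : ℤ => Real.exp (-θ * |(k : ℝ)|) := by
  have hs : Summable fun n : ℕ => Real.exp (-θ * n) := by
    simpa [mul_comm] using Real.summable_exp_nat_mul_iff.2 (neg_neg_of_pos hθ)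
  refine Summable.of_nat_of_neg ?_ ?_ <;> simpa using hs

theorem tsum_ofReal_exp_ne_zero (f : ℤ → ℝ) : ∑' k, ENNReal.ofReal (Real.exp (f k)) ≠ 0 := by
  intro h
  have := ENNReal.tsum_eq_zero.1 h 0
  rw [ENNReal.ofReal_eq_zero] at this
  exact absurd this (not_le.2 (Real.exp_pos _))

theorem tsum_laplace_ne_top {θ : ℝ} (hθ : 0 < θ) :
    ∑' k : ℤ, ENNReal.ofReal (Real.exp (-θ * |(k : ℝ)|)) ≠ ∞ := by
  rw [← ENNReal.ofReal_tsum_of_nonneg (fun _ => (Real.exp_pos _).le)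
    (summable_exp_neg_mul_abs hθ)]
  exact ENNReal.ofReal_ne_top

theorem tsum_gaussian_ne_top {τ : ℝ} (hτ : 0 < τ) :
    ∑' k : ℤ, ENNReal.ofReal (Real.exp (-τ * (k : ℝ) ^ 2)) ≠ ∞ := by
  refine ne_top_of_le_ne_top (tsum_laplace_ne_top hτ) (ENNReal.tsum_le_tsum fun k => ?_)
  refine ENNReal.ofReal_le_ofReal (Real.exp_le_exp.2 ?_)
  have : |(k : ℝ)| ≤ (k : ℝ) ^ 2 := by
    rw [← sq_abs]
    by_cases h : k = 0
    · simp [h]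
    · have : (1 : ℝ) ≤ |(k : ℝ)| := by exact_mod_cast Int.one_le_abs h
      nlinarith
  nlinarith

/-- The two-sided geometric distribution, with probabilities proportional to `exp (-θ |k|)`. -/
noncomputable def discreteLaplace (θ : ℝ) (hθ : 0 < θ) : PMF ℤ :=
  PMF.normalize (fun k : ℤ => ENNReal.ofReal (Real.exp (-θ * |(k : ℝ)|)))
    (tsum_ofReal_exp_ne_zero _) (tsum_laplace_ne_top hθ)

/-- The discrete Gaussian distribution, with probabilities proportional to `exp (-τ k²)`. -/
noncomputable def discreteGaussian (τ : ℝ) (hτ : 0 < τ) : PMF ℤ :=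
  PMF.normalize (fun k : ℤ => ENNReal.ofReal (Real.exp (-τ * (k : ℝ) ^ 2)))
    (tsum_ofReal_exp_ne_zero _) (tsum_gaussian_ne_top hτ)

theorem discreteLaplace_le_mul {θ g : ℝ} (hθ : 0 < θ) (hg : θ ≤ g) {v w : ℤ} (h : |v - w| ≤ 1) :
    discreteLaplace θ hθ v ≤ ENNReal.ofReal (Real.exp g) * discreteLaplace θ hθ w := by
  rw [discreteLaplace, PMF.normalize_apply, PMF.normalize_apply, ← mul_assoc,
    ← ENNReal.ofReal_mul (Real.exp_nonneg _), ← Real.exp_add]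
  gcongr
  have h1 : |(v : ℝ) - w| ≤ 1 := by exact_mod_cast h
  have h2 : |(w : ℝ)| ≤ |(v : ℝ)| + 1 := by
    have := abs_sub_abs_le_abs_sub (w : ℝ) v
    rw [abs_sub_comm] at this
    linarith
  nlinarith

theorem tsum_renyiTerm_discreteLaplace_le (k : ℕ) {θ g x : ℝ} (hθ : 0 < θ) (hg : θ ≤ g) {c c' : ℤ}
    (h : |c - c'| ≤ 1) (hx : min (((k + 1) * g) ^ 2) ((k + 1) * g) ≤ x) :
    ∑' v, renyiTerm k (discreteLaplace θ hθ (v - c)) (discreteLaplace θ hθ (v - c'))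
      ≤ ENNReal.ofReal (Real.exp x) := by
  refine tsum_renyiTerm_le_of_ratio k _ _ ?_ ?_ (fun v => ?_) (fun v => ?_) hx
  · rw [tsum_sub_right (discreteLaplace θ hθ), PMF.tsum_coe]
  · rw [tsum_sub_right (discreteLaplace θ hθ), PMF.tsum_coe]
  · refine discreteLaplace_le_mul hθ hg ?_
    rwa [sub_sub_sub_cancel_left, abs_sub_comm]
  · refine discreteLaplace_le_mul hθ hg ?_
    rwa [sub_sub_sub_cancel_left]

theorem tsum_nat_ite_le (u : ℝ≥0∞) (n : ℕ) :
    ∑' i : ℕ, (if n ≤ i then u ^ i else 0) = u ^ n * ∑' i, u ^ i := by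
  rw [← ENNReal.tsum_mul_left]
  refine ((add_right_injective n).tsum_eq ?_).symm.trans (by simp [pow_add])
  intro i hi
  by_cases h : n ≤ i
  · exact ⟨i - n, Nat.add_sub_cancel' h⟩
  · simp [h] at hi

/-- The exact tail is `2 * u ^ (n + 1) / (1 + u)` with `u = exp (-θ)` and `n = ⌊r⌋`. Giving up half
of the exponent absorbs the factor 2. The first release needs a bound without leading constant,
because its error has to vanish as `β → 1`. -/
theorem tailProb_discreteLaplace_le {θ r : ℝ} (hθ : 0 < θ) (hr : 0 ≤ r) :
    tailProb (discreteLaplace θ hθ) r ≤ ENNReal.ofReal (Real.exp (-θ * r / 2)) := by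
  set u : ℝ≥0∞ := ENNReal.ofReal (Real.exp (-θ)) with hu
  set n : ℕ := ⌊r⌋₊ with hn
  have hupow : ∀ i : ℕ, ENNReal.ofReal (Real.exp (-θ * i)) = u ^ i := fun i => by
    rw [hu, ← ENNReal.ofReal_pow (Real.exp_nonneg _), ← Real.exp_nat_mul, mul_comm]
  have hlt : ∀ i : ℕ, r < i ↔ n + 1 ≤ i := fun i => by rw [← Nat.floor_lt hr]; rfl
  have hZ : ∑' k : ℤ, ENNReal.ofReal (Real.exp (-θ * |(k : ℝ)|)) = (1 + u) * ∑' i : ℕ, u ^ i := by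
    rw [tsum_of_nat_of_neg_add_one ENNReal.summable ENNReal.summable]
    have h1 : ∀ i : ℕ, ENNReal.ofReal (Real.exp (-θ * |((i : ℤ) : ℝ)|)) = u ^ i := fun i => by
      rw [← hupow]; simp
    have h2 : ∀ i : ℕ, ENNReal.ofReal (Real.exp (-θ * |((-(i + 1 : ℤ) : ℤ) : ℝ)|)) = u * u ^ i :=
      fun i => by
        rw [← pow_succ', ← hupow]
        push_cast
        rw [abs_neg, abs_of_nonneg (by positivity)]
    simp_rw [h1, h2]
    rw [ENNReal.tsum_mul_left, add_mul, one_mul]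
  have htail : tailProb (discreteLaplace θ hθ) r
      = (2 * u ^ (n + 1) * ∑' i : ℕ, u ^ i) * ((1 + u) * ∑' i : ℕ, u ^ i)⁻¹ := by
    rw [← hZ, tailProb, discreteLaplace]
    simp_rw [PMF.normalize_apply, ← ite_zero_mul]
    rw [ENNReal.tsum_mul_right]
    congr 1
    rw [tsum_of_nat_of_neg_add_one ENNReal.summable ENNReal.summable]
    have h1 : ∀ i : ℕ, (if r < |((i : ℤ) : ℝ)| then
        ENNReal.ofReal (Real.exp (-θ * |((i : ℤ) : ℝ)|)) else 0)
        = if n + 1 ≤ i then u ^ i else 0 := fun i => by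
      rw [← hupow]; simp [← hlt]
    have h2 : ∀ i : ℕ, (if r < |((-(i + 1 : ℤ) : ℤ) : ℝ)| then
        ENNReal.ofReal (Real.exp (-θ * |((-(i + 1 : ℤ) : ℤ) : ℝ)|)) else 0)
        = u * if n ≤ i then u ^ i else 0 := fun i => by
      have : |((-(i + 1 : ℤ) : ℤ) : ℝ)| = ((i + 1 : ℕ) : ℝ) := by
        push_cast
        rw [abs_neg, abs_of_nonneg (by positivity)]
      rw [this, hupow, mul_ite, mul_zero, pow_succ']
      simp only [hlt, add_le_add_iff_right]
    simp_rw [h1, h2]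
    rw [ENNReal.tsum_mul_left, tsum_nat_ite_le, tsum_nat_ite_le, pow_succ]
    ring
  have hg0 : ∑' i : ℕ, u ^ i ≠ 0 := fun h => by simpa using ENNReal.tsum_eq_zero.1 h 0
  have hgt : ∑' i : ℕ, u ^ i ≠ ∞ := by
    intro h
    apply tsum_laplace_ne_top hθ
    rw [hZ, h, ENNReal.mul_top (by simp)]
  rw [htail, ENNReal.mul_inv (Or.inr hgt) (Or.inr hg0)]
  calc _ = 2 * u ^ (n + 1) * (1 + u)⁻¹ * ((∑' i : ℕ, u ^ i) * (∑' i : ℕ, u ^ i)⁻¹) := by ring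
    _ = 2 * u ^ (n + 1) / (1 + u) := by rw [ENNReal.mul_inv_cancel hg0 hgt, mul_one, div_eq_mul_inv]
    _ ≤ _ := by
      refine ENNReal.div_le_of_le_mul ?_
      rw [← hupow, hu, show (2 : ℝ≥0∞) = ENNReal.ofReal 2 by simp,
        show (1 : ℝ≥0∞) = ENNReal.ofReal 1 by simp, ← ENNReal.ofReal_mul (by positivity),
        ← ENNReal.ofReal_add (by positivity) (by positivity),
        ← ENNReal.ofReal_mul (by positivity)]
      refine ENNReal.ofReal_le_ofReal ?_
      have hnr : r ≤ n + 1 := (Nat.lt_floor_add_one r).le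
      have e1 : Real.exp (-θ * (n + 1 : ℕ))
          = Real.exp (-θ * (n + 1) / 2) * Real.exp (-θ * (n + 1) / 2) := by
        rw [← Real.exp_add]; push_cast; ring_nf
      have e2 : Real.exp (-θ) = Real.exp (-θ / 2) ^ 2 := by
        rw [← Real.exp_nat_mul]; push_cast; ring_nf
      have e3 : Real.exp (-θ * (n + 1) / 2) ≤ Real.exp (-θ / 2) :=
        Real.exp_le_exp.2 (by nlinarith [mul_nonneg hθ.le (Nat.cast_nonneg (α := ℝ) n)])
      have e4 : Real.exp (-θ * (n + 1) / 2) ≤ Real.exp (-θ * r / 2) :=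
        Real.exp_le_exp.2 (by nlinarith)
      have e5 : 2 * Real.exp (-θ * (n + 1) / 2) ≤ 1 + Real.exp (-θ) := by
        rw [e2]; nlinarith [sq_nonneg (1 - Real.exp (-θ / 2))]
      rw [e1]
      nlinarith [Real.exp_pos (-θ * (n + 1) / 2), Real.exp_pos (-θ)]

/-- Complete the square: each term is at most a constant times the Gaussian centred at `(k + 1) * c
- k * c'`. This centre is an integer, so the shifted weights still sum to 1. -/
theorem tsum_renyiTerm_discreteGaussian_le (k : ℕ) {τ : ℝ} (hτ : 0 < τ) {c c' : ℤ}
    (h : |c - c'| ≤ 1) :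
    ∑' v, renyiTerm k (discreteGaussian τ hτ (v - c)) (discreteGaussian τ hτ (v - c'))
      ≤ ENNReal.ofReal (Real.exp (τ * (k * (k + 1)))) := by
  set Z : ℝ≥0∞ := ∑' k : ℤ, ENNReal.ofReal (Real.exp (-τ * (k : ℝ) ^ 2)) with hZ
  have hZ0 : Z ≠ 0 := tsum_ofReal_exp_ne_zero _
  have hZt : Z ≠ ∞ := tsum_gaussian_ne_top hτ
  set μ : ℤ := (k + 1) * c - k * c' with hμ
  have hterm : ∀ v : ℤ,
      renyiTerm k (discreteGaussian τ hτ (v - c)) (discreteGaussian τ hτ (v - c'))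
        ≤ ENNReal.ofReal (Real.exp (τ * (k * (k + 1)))) * discreteGaussian τ hτ (v - μ) := by
    intro v
    rw [discreteGaussian, PMF.normalize_apply, PMF.normalize_apply, PMF.normalize_apply, ← hZ,
      renyiTerm_mul k ENNReal.ofReal_ne_top (ENNReal.inv_ne_top.2 hZ0),
      renyiTerm_self k (ENNReal.inv_ne_top.2 hZ0),
      renyiTerm_eq_ofReal k (Real.exp_nonneg _) (Real.exp_pos _), ← mul_assoc,
      ← ENNReal.ofReal_mul (Real.exp_nonneg _), ← Real.exp_nat_mul, ← Real.exp_nat_mul,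
      ← Real.exp_sub, ← Real.exp_add]
    gcongr
    have h1 : |(c : ℝ) - c'| ≤ 1 := by exact_mod_cast h
    have h2 : ((c : ℝ) - c') ^ 2 ≤ 1 := by rw [← sq_abs]; nlinarith [abs_nonneg ((c : ℝ) - c')]
    have h3 : 0 ≤ τ * (k * (k + 1)) := by positivity
    rw [hμ]
    push_cast
    nlinarith [mul_le_mul_of_nonneg_left h2 h3]
  refine (ENNReal.tsum_le_tsum hterm).trans ?_
  rw [ENNReal.tsum_mul_left, tsum_sub_right (discreteGaussian τ hτ), PMF.tsum_coe, mul_one]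

/-- For `k ≥ n ≥ r ≥ 0` one has `k ^ 2 ≥ r ^ 2 + (k - n) ^ 2`, so each side of the tail is dominated
by `exp (-τ * r ^ 2)` times a shifted copy of the whole law. -/
theorem tailProb_discreteGaussian_le {τ r : ℝ} (hτ : 0 < τ) (hr : 0 ≤ r) :
    tailProb (discreteGaussian τ hτ) r ≤ ENNReal.ofReal (2 * Real.exp (-τ * r ^ 2)) := by
  set n : ℤ := ⌊r⌋ + 1 with hn
  have hrn : r ≤ n := by rw [hn]; push_cast; exact (Int.lt_floor_add_one r).le
  have hn0 : (0 : ℝ) ≤ n := hr.trans hrn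
  set E : ℝ≥0∞ := ENNReal.ofReal (Real.exp (-τ * r ^ 2)) with hE
  have hterm : ∀ k : ℤ, (if r < |(k : ℝ)| then discreteGaussian τ hτ k else 0)
      ≤ E * discreteGaussian τ hτ (k - n) + E * discreteGaussian τ hτ (k - -n) := by
    intro k
    split_ifs with hk
    swap
    · exact zero_le
    rcases lt_abs.1 hk with hk | hk
    · refine le_trans ?_ le_self_add
      have hnk : (n : ℝ) ≤ k := by exact_mod_cast Int.add_one_le_iff.2 (Int.floor_lt.2 hk)
      rw [discreteGaussian, PMF.normalize_apply, PMF.normalize_apply, ← mul_assoc, hE,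
        ← ENNReal.ofReal_mul (Real.exp_nonneg _), ← Real.exp_add]
      gcongr
      push_cast
      have : r ^ 2 + (k - n : ℝ) ^ 2 ≤ (k : ℝ) ^ 2 := by nlinarith
      nlinarith
    · refine le_trans ?_ le_add_self
      have hnk : (n : ℝ) ≤ -k := by
        have : n ≤ -k := Int.add_one_le_iff.2 (Int.floor_lt.2 (by push_cast; exact hk))
        exact_mod_cast this
      rw [discreteGaussian, PMF.normalize_apply, PMF.normalize_apply, ← mul_assoc, hE,
        ← ENNReal.ofReal_mul (Real.exp_nonneg _), ← Real.exp_add]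
      gcongr
      push_cast
      have : r ^ 2 + (k - -n : ℝ) ^ 2 ≤ (k : ℝ) ^ 2 := by nlinarith
      nlinarith
  refine (ENNReal.tsum_le_tsum hterm).trans ?_
  rw [ENNReal.tsum_add, ENNReal.tsum_mul_left, ENNReal.tsum_mul_left,
    tsum_sub_right (discreteGaussian τ hτ), tsum_sub_right (discreteGaussian τ hτ), PMF.tsum_coe,
    mul_one, ← two_mul, ENNReal.ofReal_mul zero_le_two, ENNReal.ofReal_ofNat]

end Noise

/-! ### The tracking mechanism and its pointwise privacy loss -/

instance : MeasurableSpace (Option ℤ) := ⊤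

instance : DiscreteMeasurableSpace (Option ℤ) := ⟨fun _ => trivial⟩

/-- Parameters of the tracking mechanism. In round `m`, the mechanism keeps its output until a test
of slope `γ m` finds that it is far from the current count; it then releases the count with noise
`ν (m + 1)` and enters round `m + 1`. In a round of `direct`, which is never left, it releases the
count with fresh noise at each step. -/
structure Tracker where
  γ : ℕ → ℝ
  L : ℝ
  ν : ℕ → PMF ℤ
  direct : Set ℕ

namespace Tracker

variable (P : Tracker)

open Classical in
/-- The round and the current output value after the actions `h`. -/
noncomputable def pub : List (Option ℤ) → ℕ × ℤ
  | [] => (0, 0)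
  | none :: h => pub h
  | some v :: h => (if h = [] ∨ (pub h).1 ∈ P.direct then (pub h).1 else (pub h).1 + 1, v)

/-- The hazard of ending round `m` when the count is at signed distance `e` from the output. -/
noncomputable def hazard (m : ℕ) (e : ℤ) : ℝ≥0 :=
  ⟨Real.exp (P.γ m * |(e : ℝ)| - 5 * P.L), Real.exp_nonneg _⟩

theorem coe_hazard (m : ℕ) (e : ℤ) :
    (P.hazard m e : ℝ) = Real.exp (P.γ m * |(e : ℝ)| - 5 * P.L) := rfl

open Classical in
/-- The hazard accumulated so far in the current round. -/
noncomputable def lam : List ℤ → List (Option ℤ) → ℝ≥0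
  | c :: cs, none :: h =>
    if h = [] ∨ (P.pub h).1 ∈ P.direct then 0
    else lam cs h + P.hazard (P.pub h).1 (c - (P.pub h).2)
  | _, _ => 0

/-- Release `c` with additive noise `ν`. -/
noncomputable def release (ν : PMF ℤ) (c : ℤ) : PMF (Option ℤ) :=
  ⟨fun o => o.elim 0 fun v => ν (v - c), by
    rw [ENNReal.summable.hasSum_iff, tsum_option']
    simp only [Option.elim_none, Option.elim_some, zero_add]
    rw [tsum_sub_right ν, PMF.tsum_coe]⟩

/-- A round with accumulated hazard `l` ends with conditional probability `w / (1 + l + w)`, where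
`w` is the hazard of the current step, and then `c` is released. -/
noncomputable def race (m : ℕ) (l w : ℝ≥0) (c : ℤ) : PMF (Option ℤ) :=
  ⟨fun o => o.elim (ENNReal.ofReal ((1 + l) / (1 + l + w)))
      fun v => ENNReal.ofReal (w / (1 + l + w)) * P.ν (m + 1) (v - c), by
    rw [ENNReal.summable.hasSum_iff, tsum_option']
    simp only [Option.elim_none, Option.elim_some]
    rw [ENNReal.tsum_mul_left, tsum_sub_right (P.ν (m + 1)), PMF.tsum_coe, mul_one,
      ← ENNReal.ofReal_add (by positivity) (by positivity), ← add_div, div_self (by positivity),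
      ENNReal.ofReal_one]⟩

open Classical in
/-- The law of the next action of the mechanism. -/
noncomputable def strategy : Strategy (Option ℤ)
  | [], _ => PMF.pure none
  | c :: cs, h =>
    if h = [] then release (P.ν 0) c
    else if (P.pub h).1 ∈ P.direct then release (P.ν (P.pub h).1) c
    else P.race (P.pub h).1 (P.lam cs h) (P.hazard (P.pub h).1 (c - (P.pub h).2)) c

variable {P}

theorem strategy_nil (c : ℤ) (cs : List ℤ) : P.strategy (c :: cs) [] = release (P.ν 0) c := by
  simp [strategy]

theorem strategy_direct {h : List (Option ℤ)} (hne : h ≠ []) (hs : (P.pub h).1 ∈ P.direct) (c : ℤ)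
    (cs : List ℤ) : P.strategy (c :: cs) h = release (P.ν (P.pub h).1) c := by
  simp [strategy, hne, hs]

theorem strategy_race {h : List (Option ℤ)} (hne : h ≠ []) (hs : (P.pub h).1 ∉ P.direct) (c : ℤ)
    (cs : List ℤ) : P.strategy (c :: cs) h
      = P.race (P.pub h).1 (P.lam cs h) (P.hazard (P.pub h).1 (c - (P.pub h).2)) c := by
  simp [strategy, hne, hs]

@[simp] theorem release_none (ν : PMF ℤ) (c : ℤ) : release ν c none = 0 := rfl

@[simp] theorem release_some (ν : PMF ℤ) (c v : ℤ) : release ν c (some v) = ν (v - c) := rfl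

theorem race_none (m : ℕ) (l w : ℝ≥0) (c : ℤ) :
    P.race m l w c none = ENNReal.ofReal ((1 + l) / (1 + l + w)) := rfl

theorem race_some (m : ℕ) (l w : ℝ≥0) (c v : ℤ) :
    P.race m l w c (some v) = ENNReal.ofReal (w / (1 + l + w)) * P.ν (m + 1) (v - c) := rfl

theorem pub_none (h : List (Option ℤ)) : P.pub (none :: h) = P.pub h := rfl

theorem pub_direct {h : List (Option ℤ)} (hs : (P.pub h).1 ∈ P.direct) (v : ℤ) :
    P.pub (some v :: h) = ((P.pub h).1, v) := by
  simp [pub, hs]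

theorem pub_single (v : ℤ) : P.pub [some v] = (0, v) := by simp [pub]

theorem pub_race {h : List (Option ℤ)} (hne : h ≠ []) (hs : (P.pub h).1 ∉ P.direct) (v : ℤ) :
    P.pub (some v :: h) = ((P.pub h).1 + 1, v) := by
  simp [pub, hs, hne]

theorem lam_some (cs : List ℤ) (v : ℤ) (h : List (Option ℤ)) : P.lam cs (some v :: h) = 0 := by
  cases cs <;> rfl

theorem lam_none {h : List (Option ℤ)} (hne : h ≠ []) (hs : (P.pub h).1 ∉ P.direct) (c : ℤ)
    (cs : List ℤ) : P.lam (c :: cs) (none :: h)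
      = P.lam cs h + P.hazard (P.pub h).1 (c - (P.pub h).2) := by
  simp [lam, hs, hne]

theorem lam_direct {h : List (Option ℤ)} (hs : (P.pub h).1 ∈ P.direct) (cs : List ℤ) :
    P.lam cs h = 0 := by
  match cs, h with
  | [], [] => rfl
  | [], none :: _ => rfl
  | _ :: _, [] => rfl
  | _, some v :: h => exact lam_some _ _ _
  | c :: cs, none :: h =>
    rw [pub_none] at hs
    simp [lam, hs]

/-- Counts that differ by at most `1`. -/
def Near (c c' : ℤ) : Prop := |c - c'| ≤ 1

theorem Near.symm {c c' : ℤ} (h : Near c c') : Near c' c := by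
  unfold Near at *; rwa [abs_sub_comm]

theorem hazard_le (m : ℕ) (hγ : 0 ≤ P.γ m) {c c' : ℤ} (h : Near c c') (v : ℤ) :
    (P.hazard m (c - v) : ℝ) ≤ Real.exp (P.γ m) * P.hazard m (c' - v) := by
  rw [coe_hazard, coe_hazard, ← Real.exp_add]
  refine Real.exp_le_exp.2 ?_
  have h1 : |(c : ℝ) - c'| ≤ 1 := by exact_mod_cast h
  have h2 : |((c - v : ℤ) : ℝ)| ≤ |((c' - v : ℤ) : ℝ)| + 1 := by
    push_cast
    have := abs_add_le ((c : ℝ) - c') (c' - v)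
    rw [sub_add_sub_cancel] at this
    linarith
  nlinarith

theorem lam_le (hγ : ∀ m, 0 ≤ P.γ m) {p : ℤ → ℤ → Prop} {cs cs' : List ℤ}
    (hl : Linked p Near cs cs') (h : List (Option ℤ)) (hlen : h.length = cs.length) :
    (P.lam cs h : ℝ) ≤ Real.exp (P.γ (P.pub h).1) * P.lam cs' h := by
  induction hl generalizing h with
  | @single c c' _ =>
    match h with
    | [a] => cases a <;> simp [lam]
  | @cons c c' cs cs' hcs hq ih =>
    match h with
    | some v :: h => simp [lam_some]
    | none :: h =>
      have hlen' : h.length = cs.length := by simpa using hlen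
      have hne : h ≠ [] := fun e => hcs.ne_nil (List.length_eq_zero_iff.1 (by simpa [e] using hlen'.symm))
      by_cases hs : (P.pub h).1 ∈ P.direct
      · simp [lam, hs]
      · rw [lam_none hne hs, lam_none hne hs, pub_none, NNReal.coe_add, NNReal.coe_add, mul_add]
        exact add_le_add (ih h hlen') (hazard_le _ (hγ _) hq _)

theorem lam_eq_of_linked_eq {p : ℤ → ℤ → Prop} {cs cs' : List ℤ}
    (hl : Linked p Eq cs cs') (h : List (Option ℤ)) (hlen : h.length = cs.length) :
    P.lam cs h = P.lam cs' h := by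
  induction hl generalizing h with
  | @single c c' _ =>
    match h with
    | [a] => cases a <;> simp [lam]
  | @cons c c' cs cs' hcs hq ih =>
    subst hq
    match h with
    | some v :: h => simp [lam_some]
    | none :: h => simp only [lam]; rw [ih h (by simpa using hlen)]

theorem _root_.CountDistinct.Linked.symm' {p q : ℤ → ℤ → Prop} {cs cs' : List ℤ}
    (hl : Linked p q cs cs') (hp : ∀ c c', p c c' → p c' c) (hq : ∀ c c', q c c' → q c' c) :
    Linked p q cs' cs := by
  induction hl with
  | single h => exact .single (hp _ _ h)
  | cons _ h ih => exact .cons ih (hq _ _ h)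

/-- The relative hazards `1 + lam` on two linked inputs. -/
noncomputable def relHazard (P : Tracker) (cs cs' : List ℤ) (h : List (Option ℤ)) : ℝ :=
  (1 + P.lam cs' h) / (1 + P.lam cs h)

theorem relHazard_some (cs cs' : List ℤ) (v : ℤ) (h : List (Option ℤ)) :
    P.relHazard cs cs' (some v :: h) = 1 := by
  simp [relHazard, lam_some]

theorem one_add_lam_le (hγ : ∀ m, 0 ≤ P.γ m) {p : ℤ → ℤ → Prop} {cs cs' : List ℤ}
    (hl : Linked p Near cs cs') (h : List (Option ℤ)) (hlen : h.length = cs.length) :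
    (1 + P.lam cs h : ℝ) ≤ Real.exp (P.γ (P.pub h).1) * (1 + P.lam cs' h) := by
  have h1 := lam_le hγ hl h hlen
  have h2 := Real.one_le_exp (hγ (P.pub h).1)
  linarith

theorem relHazard_le (hγ : ∀ m, 0 ≤ P.γ m) {p : ℤ → ℤ → Prop} {cs cs' : List ℤ}
    (hp : ∀ c c', p c c' → p c' c)
    (hl : Linked p Near cs cs') (h : List (Option ℤ)) (hlen : h.length = cs.length) :
    P.relHazard cs cs' h ≤ Real.exp (P.γ (P.pub h).1) := by
  rw [relHazard, div_le_iff₀ (by positivity)]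
  exact one_add_lam_le hγ (hl.symm' hp fun _ _ => Near.symm) h (hlen.trans hl.length_eq)

theorem le_relHazard (hγ : ∀ m, 0 ≤ P.γ m) {p : ℤ → ℤ → Prop} {cs cs' : List ℤ}
    (hl : Linked p Near cs cs') (h : List (Option ℤ)) (hlen : h.length = cs.length) :
    Real.exp (-P.γ (P.pub h).1) ≤ P.relHazard cs cs' h := by
  rw [relHazard, le_div_iff₀ (by positivity), Real.exp_neg, inv_mul_le_iff₀ (Real.exp_pos _)]
  exact one_add_lam_le hγ hl h hlen

/-- With `a = 1 + λ`, a round survives the hazard `λ` and then ends at a step of hazard `w` with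
probability `1 / a * (w / (a + w))`. Each of its three factors changes by at most `e`. -/
theorem fire_ratio_le {a a' w w' e : ℝ} (ha : 0 < a) (ha' : 0 < a') (hw : 0 ≤ w) (hw' : 0 ≤ w')
    (he : 1 ≤ e) (h1 : a' ≤ e * a) (h2 : w' ≤ e * w) (h3 : w ≤ e * w') :
    a' / a * (w / (a + w)) ≤ e ^ 3 * (w' / (a' + w')) := by
  have h4 : a' + w' ≤ e * (a + w) := by linarith
  rw [div_mul_div_comm, ← mul_div_assoc, div_le_div_iff₀ (by positivity) (by positivity)]
  have h5 : a' * (a' + w') ≤ (e * a) * (e * (a + w)) :=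
    mul_le_mul h1 h4 (by positivity) (by positivity)
  calc a' * w * (a' + w') = w * (a' * (a' + w')) := by ring
    _ ≤ (e * w') * ((e * a) * (e * (a + w))) := mul_le_mul h3 h5 (by positivity) (by positivity)
    _ = e ^ 3 * w' * (a * (a + w)) := by ring

/-- Probability ratios of the mechanism when there are no direct rounds. -/
theorem likelihood_le_of_near (hγ : ∀ m, 0 ≤ P.γ m) (hdir : P.direct = ∅) {θ : ℝ}
    (h0 : ∀ c c' v, Near c c' → P.ν 0 (v - c) ≤ ENNReal.ofReal (Real.exp θ) * P.ν 0 (v - c'))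
    (hν : ∀ m c c' v, Near c c' →
      P.ν (m + 1) (v - c) ≤ ENNReal.ofReal (Real.exp (P.γ m)) * P.ν (m + 1) (v - c'))
    {A : ℝ} (hA : ∀ m, ∑ j ∈ Finset.range m, P.γ j ≤ A)
    {cs cs' : List ℤ} (hl : Linked Near Near cs cs') (h : List (Option ℤ)) :
    likelihood P.strategy cs h
      ≤ ENNReal.ofReal (Real.exp (θ + 4 * A)) * likelihood P.strategy cs' h := by
  -- Each completed round is charged `4 * γ j`; the current round contributes only its survival
  -- ratio, which never leaves `exp (± γ)`.
  have key := likelihood_le_mul P.strategy (p := Near) (q := Near)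
    (fun cs cs' h => ENNReal.ofReal (Real.exp (θ + 4 * ∑ j ∈ Finset.range (P.pub h).1, P.γ j)
      * P.relHazard cs cs' h)) ?_ ?_ hl h
  · by_cases hlen : h.length = cs.length
    · refine key.trans ?_
      gcongr
      have h1 := relHazard_le hγ (fun _ _ => Near.symm) hl h hlen
      have h3 := hA ((P.pub h).1 + 1)
      rw [Finset.sum_range_succ] at h3
      calc _ ≤ Real.exp (θ + 4 * ∑ j ∈ Finset.range (P.pub h).1, P.γ j)
            * Real.exp (P.γ (P.pub h).1) := by gcongr
        _ ≤ _ := by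
          rw [← Real.exp_add]
          exact Real.exp_le_exp.2 (by linarith [hγ (P.pub h).1])
    · rw [likelihood_eq_zero _ _ _ hlen]
      exact zero_le
  · intro c c' a hc
    rw [strategy_nil, strategy_nil]
    cases a with
    | none => simp
    | some v =>
      rw [release_some, release_some, relHazard_some, pub_single]
      simpa using h0 c c' v hc
  · intro c c' cs cs' h a hcs hc hlen
    have hne : h ≠ [] := fun e => hcs.ne_nil (List.length_eq_zero_iff.1 (by simpa [e] using hlen.symm))
    have hs : (P.pub h).1 ∉ P.direct := by simp [hdir]
    rw [strategy_race hne hs, strategy_race hne hs]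
    set X := Real.exp (θ + 4 * ∑ j ∈ Finset.range (P.pub h).1, P.γ j) with hX
    set w := P.hazard (P.pub h).1 (c - (P.pub h).2) with hw
    set w' := P.hazard (P.pub h).1 (c' - (P.pub h).2) with hw'
    cases a with
    | none =>
      rw [race_none, race_none, pub_none, ← ENNReal.ofReal_mul (by unfold relHazard; positivity),
        ← ENNReal.ofReal_mul (by unfold relHazard; positivity)]
      -- Survival probabilities telescope to `1 / (1 + lam)`, so this step is an equality.
      refine le_of_eq (congrArg _ ?_)
      rw [relHazard, relHazard, lam_none hne hs, lam_none hne hs, ← hw, ← hw', ← hX]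
      push_cast
      field_simp
      ring
    | some v =>
      rw [race_some, race_some, relHazard_some, pub_race hne hs, ← mul_assoc, ← mul_assoc,
        ← ENNReal.ofReal_mul (by unfold relHazard; positivity),
        ← ENNReal.ofReal_mul (by positivity)]
      calc _ ≤ ENNReal.ofReal (X * P.relHazard cs cs' h * (w / (1 + P.lam cs h + w))) *
            (ENNReal.ofReal (Real.exp (P.γ (P.pub h).1)) * P.ν ((P.pub h).1 + 1) (v - c')) :=
            mul_le_mul' le_rfl (hν _ _ _ _ hc)
        _ ≤ _ := by
          rw [← mul_assoc, ← ENNReal.ofReal_mul (by unfold relHazard; positivity)]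
          refine mul_le_mul' (ENNReal.ofReal_le_ofReal ?_) le_rfl
          have := fire_ratio_le (a := 1 + P.lam cs h) (a' := 1 + P.lam cs' h)
            (w := w) (w' := w') (e := Real.exp (P.γ (P.pub h).1)) (by positivity) (by positivity)
            (by positivity) (by positivity) (Real.one_le_exp (hγ _))
            (one_add_lam_le hγ (hcs.symm' (fun _ _ => Near.symm) fun _ _ => Near.symm) h
              (hlen.trans hcs.length_eq))
            (hazard_le _ (hγ _) hc.symm _) (hazard_le _ (hγ _) hc _)
          -- Three factors for the end of the round and one for the noise of the release.
          have e1 : Real.exp (θ + 4 * ∑ j ∈ Finset.range ((P.pub h).1 + 1), P.γ j)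
              = X * Real.exp (P.γ (P.pub h).1) ^ 3 * Real.exp (P.γ (P.pub h).1) := by
            rw [hX, ← Real.exp_nat_mul, ← Real.exp_add, ← Real.exp_add, Finset.sum_range_succ]
            push_cast
            ring_nf
          rw [e1, relHazard]
          calc _ = X * Real.exp (P.γ (P.pub h).1) * ((1 + P.lam cs' h) / (1 + P.lam cs h)
                * (w / (1 + P.lam cs h + w))) := by ring
            _ ≤ X * Real.exp (P.γ (P.pub h).1) * (Real.exp (P.γ (P.pub h).1) ^ 3
                * (w' / (1 + P.lam cs' h + w'))) := by gcongr
            _ = _ := by ring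

/-- Changing the first count only affects the first release. -/
theorem likelihood_le_of_linked_eq {θ : ℝ}
    (h0 : ∀ c c' v, Near c c' → P.ν 0 (v - c) ≤ ENNReal.ofReal (Real.exp θ) * P.ν 0 (v - c'))
    {cs cs' : List ℤ} (hl : Linked Near Eq cs cs') (h : List (Option ℤ)) :
    likelihood P.strategy cs h
      ≤ ENNReal.ofReal (Real.exp θ) * likelihood P.strategy cs' h := by
  refine likelihood_le_mul P.strategy (p := Near) (q := Eq)
    (fun _ _ _ => ENNReal.ofReal (Real.exp θ)) ?_ ?_ hl h
  · intro c c' a hc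
    rw [strategy_nil, strategy_nil]
    cases a with
    | none => simp
    | some v => exact h0 c c' v hc
  · rintro c _ cs cs' h a hcs rfl hlen
    simp only [strategy, lam_eq_of_linked_eq hcs h hlen]
    rfl

end Tracker

/-! ### Rényi divergence of the mechanism -/

namespace Tracker
variable {P : Tracker}

/-- What remains of the divergence `exp ρ` of a round, at a moment when the relative hazard
is `r`. -/
noncomputable def roundPotential (k : ℕ) (ρ r : ℝ) : ℝ :=
  Real.exp (-ρ) * (((k + 1) * r - k + (Real.exp ρ - 1)) / r ^ (k + 1))

theorem roundPotential_one (k : ℕ) (ρ : ℝ) : roundPotential k ρ 1 = 1 := by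
  rw [roundPotential, one_pow, div_one, Real.exp_neg]
  field_simp
  ring

/-- Needed where the stream stops inside a round: the unspent budget `x` of that round then brings
the total potential up to at least 1. -/
theorem exp_neg_le_roundPotential (k : ℕ) {g r x : ℝ} (h1 : Real.exp (-g) ≤ r)
    (h2 : r ≤ Real.exp g) (hx : min (((k + 1) * g) ^ 2) ((k + 1) * g) ≤ x) :
    Real.exp (-x) ≤ roundPotential k x r := by
  have hr : 0 < r := (Real.exp_pos _).trans_le h1
  rw [roundPotential]
  refine le_mul_of_one_le_right (Real.exp_pos _).le ?_
  rw [one_le_div (by positivity)]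
  exact pow_le_affine k h1 h2 hx

/-- The divergence potential does not increase over one step of a round. -/
theorem roundPotential_step (k : ℕ) {D p p' f f' r r₁ : ℝ} (hp' : 0 < p')
    (hf' : 0 < f') (hr : 0 < r) (hr₁ : 0 < r₁) (hpr : p * r = p' * r₁) (h1 : p + f = 1)
    (h1' : p' + f' = 1)
    (ht : (r * f / f') ^ (k + 1) ≤ (k + 1) * (r * f / f') - k + D) :
    p ^ (k + 1) / p' ^ k * (((k + 1) * r₁ - k + D) / r₁ ^ (k + 1)) + f ^ (k + 1) / f' ^ k
      ≤ ((k + 1) * r - k + D) / r ^ (k + 1) := by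
  have e1 : p ^ (k + 1) / p' ^ k * (((k + 1) * r₁ - k + D) / r₁ ^ (k + 1))
      = p' * ((k + 1) * r₁ - k + D) / r ^ (k + 1) := by
    have : p = p' * r₁ / r := by rw [← hpr]; field_simp
    rw [this, div_pow, mul_pow, pow_succ p']
    field_simp
  have e2 : f ^ (k + 1) / f' ^ k = f' * (r * f / f') ^ (k + 1) / r ^ (k + 1) := by
    rw [div_pow, mul_pow, pow_succ f']
    field_simp
  -- `r` is the likelihood ratio accumulated in the round. Multiplied by `r ^ (k + 1)`, the
  -- potential is affine in this ratio, whose mean under the second law is preserved: `p' * r₁ + f'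
  -- * (r * f / f') = r`. At the end of the round the power lies below the affine function by `ht`.
  rw [e1, e2, ← add_div]
  refine div_le_div_of_nonneg_right ?_ (by positivity)
  have h2 := mul_le_mul_of_nonneg_left ht hf'.le
  have h3 : f' * ((k + 1) * (r * f / f') - k + D) = (k + 1) * (r * f) - f' * (k - D) := by
    field_simp
    ring
  have h4 : p' * ((k + 1) * r₁ - k + D) = (k + 1) * (p * r) - p' * (k - D) := by rw [hpr]; ring
  rw [h3] at h2
  rw [h4]
  have h5 : f = 1 - p := by linarith
  have h6 : f' = 1 - p' := by linarith
  subst h5 h6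
  linarith

/-- An upper bound for the divergence that the mechanism still accumulates after the actions
`h`, when round `j` costs `x j` and the release that ends it costs `y j`. -/
noncomputable def divergencePotential (P : Tracker) (k N : ℕ) (x y : ℕ → ℝ) (A B : ℝ) (cs cs' : List ℤ)
    (h : List (Option ℤ)) : ℝ :=
  Real.exp (B * (N - h.length))
    * Real.exp (A - ∑ j ∈ Finset.range (P.pub h).1, (x j + y j))
    * roundPotential k (x (P.pub h).1) (P.relHazard cs cs' h)

/-- The whole of round `m` costs `x m`, regardless of its length, since the ratio at its end lies
within `exp (± 3 * γ m)`; the release that ends it costs `y m`. Each step also has a budget `B` for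
a direct release, which `hν` allows too because the release entering a direct round may have the
same noise. -/
theorem tsum_renyiTerm_likelihood_le (hγ : ∀ m, 0 ≤ P.γ m) (k N : ℕ) {A B : ℝ} (hB : 0 ≤ B)
    {x y : ℕ → ℝ} (hx : ∀ m, min (((k + 1) * (3 * P.γ m)) ^ 2) ((k + 1) * (3 * P.γ m)) ≤ x m)
    (hy0 : ∀ m, 0 ≤ y m)
    (hdir : ∀ m ∈ P.direct, ∀ c c', Near c c' →
      ∑' v, renyiTerm k (P.ν m (v - c)) (P.ν m (v - c')) ≤ ENNReal.ofReal (Real.exp B))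
    (hν : ∀ m c c', Near c c' →
      ∑' v, renyiTerm k (P.ν (m + 1) (v - c)) (P.ν (m + 1) (v - c'))
        ≤ ENNReal.ofReal (Real.exp (y m + B)))
    (hA : ∀ m, ∑ j ∈ Finset.range m, (x j + y j) ≤ A)
    {cs cs' : List ℤ} (hl : Linked Eq Near cs cs') (hN : cs.length = N) :
    ∑' h, renyiTerm k (likelihood P.strategy cs h) (likelihood P.strategy cs' h)
      ≤ ENNReal.ofReal (Real.exp (A + B * N)) := by
  have hlow : ∀ {cs cs' : List ℤ} {h : List (Option ℤ)}, Linked Eq Near cs cs' →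
      h.length = cs.length → Real.exp (-(x (P.pub h).1))
        ≤ roundPotential k (x (P.pub h).1) (P.relHazard cs cs' h) := by
    intro cs cs' h hl hlen
    refine exp_neg_le_roundPotential k (g := 3 * P.γ (P.pub h).1) ?_ ?_ (hx _)
    · exact (Real.exp_le_exp.2 (by linarith [hγ (P.pub h).1])).trans (le_relHazard hγ hl h hlen)
    · exact (relHazard_le hγ (fun _ _ => Eq.symm) hl h hlen).trans
        (Real.exp_le_exp.2 (by linarith [hγ (P.pub h).1]))
  refine le_trans (ENNReal.tsum_le_tsum fun h => ?_)
    (tsum_renyiTerm_likelihood_mul_le (q := Near) P.strategy k N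
      (fun cs cs' h => ENNReal.ofReal (P.divergencePotential k N x y A B cs cs' h)) ?_ ?_ hl hN.le)
  · by_cases hlen : h.length = cs.length
    · refine le_mul_of_one_le_right' ?_
      rw [ENNReal.one_le_ofReal, divergencePotential, hlen, hN, sub_self, mul_zero, Real.exp_zero,
        one_mul]
      have h1 := hA ((P.pub h).1 + 1)
      rw [Finset.sum_range_succ] at h1
      have h2 := hy0 (P.pub h).1
      calc (1 : ℝ) ≤ Real.exp (A - ∑ j ∈ Finset.range (P.pub h).1, (x j + y j))
            * Real.exp (-(x (P.pub h).1)) := by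
            rw [← Real.exp_add]
            exact Real.one_le_exp (by linarith)
        _ ≤ _ := by
            gcongr
            exact hlow hl hlen
    · simp [likelihood_eq_zero _ _ _ hlen, renyiTerm_zero]
  · intro c a
    rw [strategy_nil]
    cases a with
    | none => simp
    | some v =>
      gcongr
      rw [divergencePotential, relHazard_some, roundPotential_one, pub_single, mul_one,
        Finset.range_zero, Finset.sum_empty, sub_zero, ← Real.exp_add]
      refine Real.exp_le_exp.2 ?_
      simp only [List.length_singleton]
      push_cast
      linarith
  · intro c c' cs cs' h hcs hc hlen hlt
    have hne : h ≠ [] := fun e => hcs.ne_nil (List.length_eq_zero_iff.1 (by simpa [e] using hlen.symm))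
    rw [tsum_option']
    by_cases hs : (P.pub h).1 ∈ P.direct
    · rw [strategy_direct hne hs, strategy_direct hne hs]
      simp only [release_none, renyiTerm_zero, zero_mul, zero_add, release_some]
      simp only [divergencePotential, relHazard_some, roundPotential_one, pub_direct hs, mul_one,
        List.length_cons]
      have hr : P.relHazard cs cs' h = 1 := by
        simp [relHazard, lam_direct hs]
      rw [hr, roundPotential_one, mul_one, ENNReal.tsum_mul_right]
      refine (mul_le_mul' (hdir _ hs _ _ hc) le_rfl).trans (le_of_eq ?_)
      rw [← ENNReal.ofReal_mul (Real.exp_nonneg _), ← mul_assoc, ← Real.exp_add]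
      congr 3
      push_cast
      ring
    · rw [strategy_race hne hs, strategy_race hne hs]
      set m := (P.pub h).1 with hm
      set w := P.hazard m (c - (P.pub h).2) with hw
      set w' := P.hazard m (c' - (P.pub h).2) with hw'
      have hwpos : 0 < (w : ℝ) := by rw [hw, coe_hazard]; positivity
      have hwpos' : 0 < (w' : ℝ) := by rw [hw', coe_hazard]; positivity
      set a : ℝ := 1 + P.lam cs h with ha
      set a' : ℝ := 1 + P.lam cs' h with ha'
      have hapos : 0 < a := by positivity
      have hapos' : 0 < a' := by positivity
      set ρ : ℝ := x m with hρ
      set Y : ℝ := Real.exp (B * (N - (h.length + 1)))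
        * Real.exp (A - ∑ j ∈ Finset.range m, (x j + y j)) with hY
      have hYpos : 0 < Y := by positivity
      have hrel : P.relHazard (c :: cs) (c' :: cs') (none :: h) = (a' + w') / (a + w) := by
        rw [relHazard, lam_none hne hs, lam_none hne hs, ← hm, ← hw, ← hw', NNReal.coe_add,
          NNReal.coe_add, ← add_assoc, ← add_assoc]
      have hrel0 : P.relHazard cs cs' h = a' / a := rfl
      have hnone : P.divergencePotential k N x y A B (c :: cs) (c' :: cs') (none :: h)
          = Y * roundPotential k ρ ((a' + w') / (a + w)) := by
        rw [divergencePotential, pub_none, hrel, ← hm, ← hρ, List.length_cons]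
        push_cast
        rfl
      have hsome : ∀ v, P.divergencePotential k N x y A B (c :: cs) (c' :: cs') (some v :: h)
          = Y * Real.exp (-ρ - y m) := by
        intro v
        rw [divergencePotential, relHazard_some, roundPotential_one, pub_race hne hs, ← hm,
          Finset.sum_range_succ, List.length_cons, hY, mul_one, ← Real.exp_add, ← Real.exp_add,
          ← Real.exp_add]
        refine congrArg _ ?_
        push_cast
        rw [hρ]
        ring
      have hhere : P.divergencePotential k N x y A B cs cs' h
          = Real.exp B * Y * roundPotential k ρ (a' / a) := by
        rw [divergencePotential, ← hm, ← hρ, hrel0, hY, ← Real.exp_add, ← Real.exp_add, ← Real.exp_add]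
        refine congrArg (· * _) (congrArg _ ?_)
        ring
      simp only [hnone, hsome, hhere, race_none, race_some]
      rw [renyiTerm_eq_ofReal k (by positivity) (by positivity),
        ← ENNReal.ofReal_mul (by positivity)]
      have hsum : ∑' v, renyiTerm k (ENNReal.ofReal (w / (a + w)) * P.ν (m + 1) (v - c))
            (ENNReal.ofReal (w' / (a' + w')) * P.ν (m + 1) (v - c')) *
            ENNReal.ofReal (Y * Real.exp (-ρ - y m))
          ≤ ENNReal.ofReal ((w / (a + w)) ^ (k + 1) / (w' / (a' + w')) ^ k
            * (Real.exp B * Y * Real.exp (-ρ))) := by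
        rw [ENNReal.tsum_mul_right]
        simp_rw [renyiTerm_mul k ENNReal.ofReal_ne_top (PMF.apply_ne_top _ _)]
        rw [ENNReal.tsum_mul_left,
          renyiTerm_eq_ofReal k (by positivity) (by positivity)]
        refine (mul_le_mul' (mul_le_mul' le_rfl (hν m c c' hc)) le_rfl).trans (le_of_eq ?_)
        rw [← ENNReal.ofReal_mul (by positivity), ← ENNReal.ofReal_mul (by positivity), mul_assoc]
        congr 2
        calc Real.exp (y m + B)
              * (Y * Real.exp (-ρ - y m))
            = Y * (Real.exp (y m + B)
              * Real.exp (-ρ - y m)) := by ring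
          _ = Y * (Real.exp B * Real.exp (-ρ)) := by
              rw [← Real.exp_add, ← Real.exp_add]
              ring_nf
          _ = _ := by ring
      refine (add_le_add le_rfl hsum).trans ?_
      have hpot1 : 0 ≤ roundPotential k ρ ((a' + w') / (a + w)) := by
        have := hlow (.cons hcs hc : Linked Eq Near (c :: cs) (c' :: cs'))
          (h := none :: h) (by simp [hlen])
        rw [hrel, pub_none, ← hm, ← hρ] at this
        exact (Real.exp_pos _).le.trans this
      rw [← ENNReal.ofReal_add (by positivity) (by positivity)]
      refine ENNReal.ofReal_le_ofReal ?_
      have hγm := hγ m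
      have h1 : a' ≤ Real.exp (P.γ m) * a :=
        one_add_lam_le hγ (hcs.symm' (fun _ _ => Eq.symm) fun _ _ => Near.symm) h
          (hlen.trans hcs.length_eq)
      have h1' : a ≤ Real.exp (P.γ m) * a' := one_add_lam_le hγ hcs h hlen
      have h2 : (w' : ℝ) ≤ Real.exp (P.γ m) * w := hazard_le m hγm hc.symm _
      have h2' : (w : ℝ) ≤ Real.exp (P.γ m) * w' := hazard_le m hγm hc _
      have hu := fire_ratio_le hapos hapos' hwpos.le hwpos'.le (Real.one_le_exp hγm) h1 h2 h2'
      have hu' := fire_ratio_le hapos' hapos hwpos'.le hwpos.le (Real.one_le_exp hγm) h1' h2' h2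
      have e3 : Real.exp (P.γ m) ^ 3 = Real.exp (3 * P.γ m) := by
        rw [← Real.exp_nat_mul]; norm_num
      rw [e3] at hu hu'
      have hstep := roundPotential_step k (D := Real.exp ρ - 1) (p := a / (a + w))
        (p' := a' / (a' + w')) (f := w / (a + w)) (f' := w' / (a' + w')) (r := a' / a)
        (r₁ := (a' + w') / (a + w)) (by positivity) (by positivity) (by positivity)
        (by positivity) (by field_simp) (by field_simp) (by field_simp) (by
          refine pow_le_affine k (g := 3 * P.γ m) ?_ ?_ (hx m)
          · rw [Real.exp_neg, inv_le_iff_one_le_mul₀ (Real.exp_pos _), ← mul_div_right_comm,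
              one_le_div (by positivity)]
            have : a / a' * (a' / a * (w' / (a' + w'))) = w' / (a' + w') := by field_simp
            calc (w' : ℝ) / (a' + w') = a' / a * (a / a' * (w' / (a' + w'))) := by field_simp
              _ ≤ a' / a * (Real.exp (3 * P.γ m) * (w / (a + w))) := by gcongr
              _ = _ := by ring
          · rw [div_le_iff₀ (by positivity)]
            exact hu)
      -- A surviving step releases nothing; its budget `B` is simply given up.
      have hB1 : 1 ≤ Real.exp B := Real.one_le_exp hB
      have hX : 0 ≤ (a / (a + w)) ^ (k + 1) / (a' / (a' + w')) ^ k := by positivity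
      calc _ ≤ (a / (a + w)) ^ (k + 1) / (a' / (a' + w')) ^ k
              * (Real.exp B * Y * roundPotential k ρ ((a' + w') / (a + w)))
            + (w / (a + w)) ^ (k + 1) / (w' / (a' + w')) ^ k
              * (Real.exp B * Y * Real.exp (-ρ)) := by
            refine add_le_add ?_ le_rfl
            refine mul_le_mul_of_nonneg_left ?_ hX
            refine mul_le_mul_of_nonneg_right ?_ hpot1
            exact le_mul_of_one_le_left hYpos.le hB1
        _ = Real.exp B * Y * Real.exp (-ρ) * ((a / (a + w)) ^ (k + 1) / (a' / (a' + w')) ^ k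
              * (((k + 1) * ((a' + w') / (a + w)) - k + (Real.exp ρ - 1))
                / ((a' + w') / (a + w)) ^ (k + 1))
              + (w / (a + w)) ^ (k + 1) / (w' / (a' + w')) ^ k) := by
            rw [roundPotential]; ring
        _ ≤ Real.exp B * Y * Real.exp (-ρ)
              * (((k + 1) * (a' / a) - k + (Real.exp ρ - 1)) / (a' / a) ^ (k + 1)) := by
            refine mul_le_mul_of_nonneg_left hstep (by positivity)
        _ = _ := by rw [roundPotential]; ring

end Tracker

/-- The total variation of a sequence of counts. -/
def variation : List ℤ → ℤ
  | c :: c' :: cs => |c - c'| + variation (c' :: cs)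
  | _ => 0

/-! ### Accuracy of the mechanism -/

namespace Tracker
variable (P : Tracker)

/-- The error scale of round `m`. -/
noncomputable def scale (m : ℕ) : ℝ := P.L / P.γ m

/-- After the actions `h`, the output is close to the current count `c`, and the number of rounds is
accounted for by the total variation `V` of the counts so far. -/
def Accurate (R : ℕ → ℝ) (c V : ℤ) (h : List (Option ℤ)) : Prop :=
  (P.pub h).1 < h.length ∧
  ∑ j ∈ Finset.range (P.pub h).1, 2 * P.scale j ≤ V ∧ ((P.pub h).1 : ℤ) ≤ V ∧
  ((P.pub h).1 ∈ P.direct → |((c - (P.pub h).2 : ℤ) : ℝ)| ≤ R (P.pub h).1) ∧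
  ((P.pub h).1 ∉ P.direct → |((c - (P.pub h).2 : ℤ) : ℝ)| ≤ 6 * P.scale (P.pub h).1 ∧
    ∃ c₀ : ℤ, |(((P.pub h).2 - c₀ : ℤ) : ℝ)| ≤ R (P.pub h).1 ∧
      |((c - c₀ : ℤ) : ℝ)| + ∑ j ∈ Finset.range (P.pub h).1, 2 * P.scale j ≤ V ∧
      |c - c₀| + (P.pub h).1 ≤ V)

/-- The mechanism has been accurate at all steps. -/
def Tracks (R : ℕ → ℝ) : List ℤ → List (Option ℤ) → Prop
  | [], [] => True
  | c :: cs, a :: h => Tracks R cs h ∧ P.Accurate R c (variation (c :: cs)) (a :: h)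
  | _, _ => False

variable {P}

theorem Tracks.accurate {R : ℕ → ℝ} {cs : List ℤ} {h : List (Option ℤ)} (ht : P.Tracks R cs h)
    (hne : h ≠ []) : ∃ c cs', cs = c :: cs' ∧ P.Accurate R c (variation cs) h := by
  match cs, h with
  | [], _ :: _ => exact ht.elim
  | c :: cs, a :: h => exact ⟨c, cs, rfl, ht.2⟩

theorem accurate_none {R : ℕ → ℝ} {c c' : ℤ} {V : ℤ} {h : List (Option ℤ)}
    (hs : (P.pub h).1 ∉ P.direct)
    (ha : P.Accurate R c' V h) (hc : |((c - (P.pub h).2 : ℤ) : ℝ)| ≤ 6 * P.scale (P.pub h).1) :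
    P.Accurate R c (|c - c'| + V) (none :: h) := by
  obtain ⟨h1, h2, h3, -, h5⟩ := ha
  obtain ⟨-, c₀, h6, h7, h8⟩ := h5 hs
  have hV : (V : ℝ) ≤ ((|c - c'| + V : ℤ) : ℝ) := by exact_mod_cast le_add_of_nonneg_left (abs_nonneg _)
  refine ⟨by rw [pub_none, List.length_cons]; omega, h2.trans hV,
    h3.trans (le_add_of_nonneg_left (abs_nonneg _)), fun h => absurd h hs,
    fun _ => ⟨hc, c₀, h6, ?_, ?_⟩⟩
  · rw [pub_none]
    push_cast at h7 ⊢
    linarith [abs_sub_le (c : ℝ) c' c₀]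
  · rw [pub_none]
    linarith [abs_sub_le c c' c₀]

/-- The output was within `2 * scale` of the count `c₀` at its release and is now more than `4 *
scale` away from the count. So the count has moved by more than `2 * scale` in this round, and by at
least 1 as it is an integer; the variation within the round pays for both sums. -/
theorem accurate_fire {R : ℕ → ℝ} {c c' v : ℤ} {V : ℤ} {h : List (Option ℤ)} (hne : h ≠ [])
    (hs : (P.pub h).1 ∉ P.direct) (hpos : ∀ m, 0 < P.scale m)
    (hR : ∀ m, m ∉ P.direct → R m ≤ 2 * P.scale m)
    (ha : P.Accurate R c' V h) (hc : 4 * P.scale (P.pub h).1 < |((c - (P.pub h).2 : ℤ) : ℝ)|)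
    (hv : |((v - c : ℤ) : ℝ)| ≤ R ((P.pub h).1 + 1)) :
    P.Accurate R c (|c - c'| + V) (some v :: h) := by
  obtain ⟨h1, h2, h3, -, h5⟩ := ha
  obtain ⟨-, c₀, h6, h7, h8⟩ := h5 hs
  have h9 := hR _ hs
  have hp := hpos (P.pub h).1
  have hcc : 2 * P.scale (P.pub h).1 < |((c - c₀ : ℤ) : ℝ)| := by
    push_cast at *
    linarith [abs_sub_le (c : ℝ) c₀ (P.pub h).2, abs_sub_comm (c₀ : ℝ) (P.pub h).2]
  have hcc' : 1 ≤ |c - c₀| := by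
    have : 0 < |((c - c₀ : ℤ) : ℝ)| := lt_trans (by linarith) hcc
    rw [abs_pos] at this
    exact Int.one_le_abs (by exact_mod_cast this)
  have hv' : |((c - v : ℤ) : ℝ)| ≤ R ((P.pub h).1 + 1) := by
    push_cast at *
    rwa [abs_sub_comm]
  have hsum : ∑ j ∈ Finset.range ((P.pub h).1 + 1), 2 * P.scale j
      ≤ ((|c - c'| + V : ℤ) : ℝ) := by
    rw [Finset.sum_range_succ]
    push_cast at *
    linarith [abs_sub_le (c : ℝ) c' c₀]
  have hnum : (((P.pub h).1 + 1 : ℕ) : ℤ) ≤ |c - c'| + V := by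
    push_cast
    linarith [abs_sub_le c c' c₀]
  rw [Accurate, pub_race hne hs]
  refine ⟨by rw [List.length_cons]; omega, hsum, hnum, fun _ => hv', fun hs' => ⟨?_, c, ?_, ?_, ?_⟩⟩
  · exact hv'.trans ((hR _ hs').trans (by linarith [hpos ((P.pub h).1 + 1)]))
  · exact hv
  · simpa using hsum
  · simpa using hnum

theorem accurate_direct {R : ℕ → ℝ} {c c' v : ℤ} {V : ℤ} {h : List (Option ℤ)}
    (hs : (P.pub h).1 ∈ P.direct) (ha : P.Accurate R c' V h)
    (hv : |((v - c : ℤ) : ℝ)| ≤ R (P.pub h).1) :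
    P.Accurate R c (|c - c'| + V) (some v :: h) := by
  obtain ⟨h1, h2, h3, -, -⟩ := ha
  have hV : (V : ℝ) ≤ ((|c - c'| + V : ℤ) : ℝ) := by exact_mod_cast le_add_of_nonneg_left (abs_nonneg _)
  rw [Accurate, pub_direct hs]
  refine ⟨by rw [List.length_cons]; omega, h2.trans hV,
    h3.trans (le_add_of_nonneg_left (abs_nonneg _)), fun _ => ?_, fun h => absurd hs h⟩
  push_cast at *
  rwa [abs_sub_comm]

theorem accurate_init {R : ℕ → ℝ} {c v : ℤ} (hpos : 0 < P.scale 0) (h0 : 0 ∉ P.direct)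
    (hR : R 0 ≤ 2 * P.scale 0) (hv : |((v - c : ℤ) : ℝ)| ≤ R 0) :
    P.Accurate R c 0 [some v] := by
  rw [Accurate, pub_single]
  refine ⟨by simp, by simp, by simp, fun h => absurd h h0, fun _ => ⟨?_, c, hv, by simp, by simp⟩⟩
  push_cast at *
  rw [abs_sub_comm]
  linarith

theorem tsum_mul_le_of_tail (ν : PMF ℤ) (c : ℤ) {r : ℝ} {y z : ℝ≥0∞} {X : ℤ → ℝ≥0∞}
    (hX : ∀ v, X v ≤ y + if r < |((v - c : ℤ) : ℝ)| then z else 0) :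
    ∑' v, ν (v - c) * X v ≤ y + z * tailProb ν r := by
  calc ∑' v, ν (v - c) * X v
      ≤ ∑' v, (ν (v - c) * y + z * if r < |((v - c : ℤ) : ℝ)| then ν (v - c) else 0) := by
        refine ENNReal.tsum_le_tsum fun v => ?_
        refine (mul_le_mul' le_rfl (hX v)).trans (le_of_eq ?_)
        rw [mul_add]
        split_ifs <;> ring
    _ = _ := by
        rw [ENNReal.tsum_add, ENNReal.tsum_mul_right, ENNReal.tsum_mul_left,
          tsum_sub_right ν, PMF.tsum_coe, one_mul,
          tsum_sub_right (fun v => if r < |(v : ℝ)| then ν v else 0), tailProb]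

open Classical in
/-- A bound for the probability that the mechanism loses track, given the actions so far. -/
noncomputable def failurePotential (P : Tracker) (R : ℕ → ℝ) (η : ℝ) (N : ℕ) (s : ℝ≥0∞)
    (cs : List ℤ) (h : List (Option ℤ)) : ℝ≥0∞ :=
  if P.Tracks R cs h then
    if h = [] then s else ENNReal.ofReal (η * (1 + P.lam cs h) + 2 * η * (N - h.length))
  else 1

theorem failurePotential_of_not {R : ℕ → ℝ} {η : ℝ} {N : ℕ} {s : ℝ≥0∞} {cs : List ℤ}
    {h : List (Option ℤ)} (ht : ¬ P.Tracks R cs h) : P.failurePotential R η N s cs h = 1 := by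
  simp [failurePotential, ht]

theorem failurePotential_of_tracks {R : ℕ → ℝ} {η : ℝ} {N : ℕ} {s : ℝ≥0∞} {cs : List ℤ}
    {h : List (Option ℤ)} (ht : P.Tracks R cs h) (hne : h ≠ []) :
    P.failurePotential R η N s cs h
      = ENNReal.ofReal (η * (1 + P.lam cs h) + 2 * η * (N - h.length)) := by
  simp [failurePotential, ht, hne]

theorem failurePotential_some_le {R : ℕ → ℝ} {η : ℝ} {N : ℕ} {s : ℝ≥0∞} (cs : List ℤ)
    (h : List (Option ℤ)) (v : ℤ) (p : Prop) [Decidable p]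
    (hp : ¬ p → P.Tracks R cs (some v :: h)) :
    P.failurePotential R η N s cs (some v :: h)
      ≤ ENNReal.ofReal (η + 2 * η * (N - (h.length + 1))) + if p then 1 else 0 := by
  by_cases ht : P.Tracks R cs (some v :: h)
  · rw [failurePotential_of_tracks ht (by simp), lam_some]
    simp
  · have : p := not_not.1 fun h => ht (hp h)
    rw [failurePotential_of_not ht, if_pos this]
    exact le_add_self

/-- One step of a round does not increase the failure potential. -/
theorem failurePotential_race_step {η l w f t Y : ℝ} (hη : 0 ≤ η) (hl : 0 ≤ l) (hw : 0 < w)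
    (hf : f = w / (1 + l + w)) (hft : f * t ≤ η) :
    (1 + l) / (1 + l + w) * (η * (1 + (l + w)) + Y) + f * (η + Y + t)
      ≤ η * (1 + l) + (Y + 2 * η) := by
  have e1 : (1 + l) / (1 + l + w) * (η * (1 + (l + w)) + Y)
      = η * (1 + l) + (1 - f) * Y := by
    rw [hf]; field_simp; ring
  have hf1 : f ≤ 1 := by rw [hf, div_le_one (by positivity)]; linarith
  rw [e1]
  nlinarith

/-- Survival divides `1 + lam` by its own probability, so the surviving branch carries `η * (1 +
lam)` over exactly, and this quantity exceeds 1 if the count gets beyond `6 * scale`. The other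
branch costs at most `2 * η`: one `η` to restart the potential, one for ending the round too early
or releasing a bad value. -/
theorem failurePotential_step {R : ℕ → ℝ} {η : ℝ} {N : ℕ} {s b : ℝ≥0∞} (hL : 0 < P.L)
    (hγ : ∀ m, 0 < P.γ m) (hη : 0 < η) (hLη : Real.exp (-P.L) ≤ η) (h0 : 0 ∉ P.direct)
    (hR : ∀ m, m ∉ P.direct → R m ≤ 2 * P.scale m)
    (htail : ∀ m, tailProb (P.ν (m + 1)) (R (m + 1)) ≤ ENNReal.ofReal η)
    (htail0 : tailProb (P.ν 0) (R 0) ≤ b) (hN : 2 * η * N ≤ 1)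
    (hs : s = ENNReal.ofReal (2 * η * N) + (1 - ENNReal.ofReal (2 * η * N)) * b)
    (c : ℤ) (cs : List ℤ) (h : List (Option ℤ)) (hlt : cs.length < N)
    (hlen : h.length = cs.length) :
    ∑' a, P.strategy (c :: cs) h a * P.failurePotential R η N s (c :: cs) (a :: h)
      ≤ P.failurePotential R η N s cs h := by
  have hpos : ∀ m, 0 < P.scale m := fun m => div_pos hL (hγ m)
  by_cases ht : P.Tracks R cs h
  swap
  · have h1 : ∀ a, ¬ P.Tracks R (c :: cs) (a :: h) := fun a h => ht h.1
    simp_rw [failurePotential_of_not (h1 _), failurePotential_of_not ht, mul_one]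
    rw [PMF.tsum_coe]
  have hltR : (cs.length : ℝ) + 1 ≤ N := by exact_mod_cast hlt
  rw [tsum_option']
  by_cases hne : h = []
  · subst hne
    obtain rfl : cs = [] := List.length_eq_zero_iff.1 hlen.symm
    rw [strategy_nil]
    simp only [release_none, zero_mul, zero_add, release_some]
    -- With `q = 2 * η * N`, the first release is combined with the rest as `q + (1 - q) * b`. The
    -- union bound `q + b` would be too lossy for `β` near 1, where `b = β ^ 2`.
    refine (tsum_mul_le_of_tail (P.ν 0) c (r := R 0) (y := ENNReal.ofReal (2 * η * N))
      (z := 1 - ENNReal.ofReal (2 * η * N)) fun v => ?_).trans ?_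
    · have hle : ENNReal.ofReal (η * (1 + P.lam [c] [some v])
          + 2 * η * (N - ([some v] : List (Option ℤ)).length)) ≤ ENNReal.ofReal (2 * η * N) := by
        refine ENNReal.ofReal_le_ofReal ?_
        rw [lam_some]
        simp
        nlinarith
      have h1 : ENNReal.ofReal (2 * η * N) ≤ 1 := ENNReal.ofReal_le_one.2 hN
      split_ifs with hv
      · rw [add_tsub_cancel_of_le h1]
        by_cases ht' : P.Tracks R [c] [some v]
        · rw [failurePotential_of_tracks ht' (by simp)]
          exact hle.trans h1
        · rw [failurePotential_of_not ht']
      · have ht' : P.Tracks R [c] [some v] :=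
          ⟨trivial, accurate_init (hpos 0) h0 (hR 0 h0) (not_lt.1 hv)⟩
        rw [failurePotential_of_tracks ht' (by simp), add_zero]
        exact hle
    · rw [failurePotential, if_pos (show P.Tracks R [] [] from trivial), if_pos rfl, hs]
      gcongr
  obtain ⟨c', cs', rfl, hacc⟩ := ht.accurate hne
  rw [failurePotential_of_tracks ht hne]
  have hYpos : 0 ≤ 2 * η * (N - ((h.length : ℝ) + 1)) := by
    rw [hlen]
    exact mul_nonneg (by positivity) (by linarith)
  by_cases hd : (P.pub h).1 ∈ P.direct
  · rw [strategy_direct hne hd]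
    simp only [release_none, zero_mul, zero_add, release_some]
    have ht' : ∀ v : ℤ, ¬ R (P.pub h).1 < |((v - c : ℤ) : ℝ)| →
        P.Tracks R (c :: c' :: cs') (some v :: h) :=
      fun v hv => ⟨ht, accurate_direct hd hacc (not_lt.1 hv)⟩
    refine (tsum_mul_le_of_tail (P.ν _) c (r := R (P.pub h).1) (z := 1) fun v =>
      failurePotential_some_le _ _ _ _ (ht' v)).trans ?_
    obtain ⟨m, hm⟩ : ∃ m, (P.pub h).1 = m + 1 :=
      Nat.exists_eq_succ_of_ne_zero fun e => h0 (e ▸ hd)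
    have := htail m
    rw [← hm] at this
    rw [one_mul]
    refine (add_le_add le_rfl this).trans ?_
    rw [← ENNReal.ofReal_add (by positivity) hη.le, lam_direct hd]
    refine ENNReal.ofReal_le_ofReal ?_
    simp only [NNReal.coe_zero]
    linarith
  · rw [strategy_race hne hd]
    set m := (P.pub h).1 with hm
    set e : ℝ := |((c - (P.pub h).2 : ℤ) : ℝ)| with he
    set w := P.hazard m (c - (P.pub h).2) with hw
    have hwe : (w : ℝ) = Real.exp (P.γ m * e - 5 * P.L) := P.coe_hazard _ _
    have hwpos : 0 < (w : ℝ) := by rw [hwe]; positivity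
    set l := P.lam (c' :: cs') h with hl
    set Y := 2 * η * (N - ((h.length : ℝ) + 1)) with hY
    set f : ℝ := w / (1 + l + w) with hf
    have hf0 : 0 ≤ f := by positivity
    have hscale : P.γ m * P.scale m = P.L := mul_div_cancel₀ _ (hγ m).ne'
    have hnone : P.failurePotential R η N s (c :: c' :: cs') (none :: h)
        ≤ ENNReal.ofReal (η * (1 + (l + w)) + Y) := by
      by_cases ht' : P.Tracks R (c :: c' :: cs') (none :: h)
      · rw [failurePotential_of_tracks ht' (by simp), lam_none hne hd, ← hl, ← hm, ← hw,
          List.length_cons, hY]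
        push_cast
        rfl
      · rw [failurePotential_of_not ht', ENNReal.one_le_ofReal]
        have hfar : 6 * P.scale m < e := by
          by_contra hle
          exact ht' ⟨ht, accurate_none hd hacc (not_lt.1 hle)⟩
        -- The exponent of the hazard exceeds `6 * L - 5 * L`.
        have h1 : Real.exp P.L ≤ w := by
          rw [hwe]
          refine Real.exp_le_exp.2 ?_
          nlinarith [mul_lt_mul_of_pos_left hfar (hγ m)]
        have h2 : 1 ≤ η * Real.exp P.L := by
          rw [Real.exp_neg, inv_le_iff_one_le_mul₀ (Real.exp_pos _)] at hLη
          exact hLη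
        have h3 : (0 : ℝ) ≤ l := l.coe_nonneg
        nlinarith
    obtain ⟨t, ht0, hft, hsome⟩ : ∃ t : ℝ, 0 ≤ t ∧ f * t ≤ η ∧
        ∑' v, P.ν (m + 1) (v - c) * P.failurePotential R η N s (c :: c' :: cs') (some v :: h)
          ≤ ENNReal.ofReal (η + Y + t) := by
      -- `t` bounds the probability that ending the round now is a failure. Near the output it is
      -- taken to be 1, but then the round ends with probability at most `exp (-L) ≤ η`; far from it
      -- only a bad release fails.
      rcases le_or_gt e (4 * P.scale m) with hnear | hfar
      · refine ⟨1, zero_le_one, ?_, ?_⟩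
        · have h1 : (w : ℝ) ≤ Real.exp (-P.L) := by
            rw [hwe]
            refine Real.exp_le_exp.2 ?_
            nlinarith [mul_le_mul_of_nonneg_left hnear (hγ m).le]
          have h2 : f ≤ w := div_le_self hwpos.le (by
            have : (0 : ℝ) ≤ l := l.coe_nonneg
            linarith)
          linarith
        · refine (ENNReal.tsum_le_tsum fun v => mul_le_mul' le_rfl
            (failurePotential_some_le _ _ _ True fun h => absurd trivial h)).trans ?_
          rw [if_pos trivial, ENNReal.tsum_mul_right, tsum_sub_right (P.ν (m + 1)), PMF.tsum_coe,
            one_mul, ← ENNReal.ofReal_one, ← ENNReal.ofReal_add (by positivity) zero_le_one]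
      · refine ⟨η, hη.le, ?_, ?_⟩
        · have : f ≤ 1 := by
            rw [hf, div_le_one (by positivity)]
            have : (0 : ℝ) ≤ l := l.coe_nonneg
            linarith
          exact mul_le_of_le_one_left hη.le this
        · have ht' : ∀ v : ℤ, ¬ R (m + 1) < |((v - c : ℤ) : ℝ)| →
              P.Tracks R (c :: c' :: cs') (some v :: h) :=
            fun v hv => ⟨ht, accurate_fire hne hd hpos hR hacc hfar (not_lt.1 hv)⟩
          refine (tsum_mul_le_of_tail (P.ν (m + 1)) c (r := R (m + 1)) (z := 1) fun v =>
            failurePotential_some_le _ _ _ _ (ht' v)).trans ?_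
          rw [one_mul]
          refine (add_le_add le_rfl (htail m)).trans (le_of_eq ?_)
          rw [← ENNReal.ofReal_add (by positivity) hη.le]
    simp only [race_none, race_some, mul_assoc]
    rw [ENNReal.tsum_mul_left]
    refine (add_le_add (mul_le_mul' le_rfl hnone) (mul_le_mul' le_rfl hsome)).trans ?_
    rw [← ENNReal.ofReal_mul (by positivity), ← ENNReal.ofReal_mul (by positivity),
      ← ENNReal.ofReal_add (by positivity) (by positivity)]
    refine ENNReal.ofReal_le_ofReal ((failurePotential_race_step hη.le l.coe_nonneg hwpos hf
      hft).trans (le_of_eq ?_))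
    rw [hY]
    ring

/-- The mechanism is accurate at all steps, except with small probability. -/
theorem tsum_indicator_not_tracks_le {R : ℕ → ℝ} {η : ℝ} {N : ℕ} {b : ℝ≥0∞} (hL : 0 < P.L)
    (hγ : ∀ m, 0 < P.γ m) (hη : 0 < η) (hLη : Real.exp (-P.L) ≤ η) (h0 : 0 ∉ P.direct)
    (hR : ∀ m, m ∉ P.direct → R m ≤ 2 * P.scale m)
    (htail : ∀ m, tailProb (P.ν (m + 1)) (R (m + 1)) ≤ ENNReal.ofReal η)
    (htail0 : tailProb (P.ν 0) (R 0) ≤ b) (hN : 2 * η * N ≤ 1)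
    (cs : List ℤ) (hcs : cs.length = N) :
    ∑' h, {h | ¬ P.Tracks R cs h}.indicator (likelihood P.strategy cs) h
      ≤ ENNReal.ofReal (2 * η * N) + (1 - ENNReal.ofReal (2 * η * N)) * b := by
  refine le_trans (ENNReal.tsum_le_tsum fun h => ?_)
    ((tsum_likelihood_mul_le P.strategy (P.failurePotential R η N _) cs fun c cs' h hlt hlen =>
      failurePotential_step hL hγ hη hLη h0 hR htail htail0 hN rfl c cs' h (hcs ▸ hlt) hlen).trans
      (le_of_eq (by
        rw [failurePotential, if_pos (show P.Tracks R [] [] from trivial), if_pos rfl])))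
  by_cases ht : P.Tracks R cs h
  · rw [Set.indicator_of_notMem (by simpa using ht)]
    exact zero_le
  · rw [Set.indicator_of_mem (by simpa using ht), failurePotential_of_not ht, mul_one]

end Tracker

/-! ### Counts of neighbouring streams, and flippancy as a bound for variation -/

section Counts

variable {d T : ℕ}

/-- The first `n` counts of distinct elements, newest first. -/
def counts (x : UpdateStream d T) : ℕ → List ℤ
  | 0 => []
  | n + 1 => (countDistinct x (n + 1) : ℤ) :: counts x n

theorem length_counts (x : UpdateStream d T) (n : ℕ) : (counts x n).length = n := by
  induction n with
  | zero => rfl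
  | succ n ih => simp [counts, ih]

theorem drop_counts (x : UpdateStream d T) (n k : ℕ) :
    (counts x (n + k)).drop k = counts x n := by
  induction k with
  | zero => rfl
  | succ k ih => simpa [counts, ← add_assoc] using ih

theorem itemCount_congr {x y : UpdateStream d T} {n : ℕ} {i : Fin d}
    (h : ∀ s : Fin T, s.val < n → x s i = y s i) : itemCount x n i = itemCount y n i :=
  Finset.sum_congr rfl fun s hs => by rw [h s (Finset.mem_filter.1 hs).2]

theorem present_congr {x y : UpdateStream d T} {n : ℕ} {i : Fin d}
    (h : ∀ s : Fin T, s.val < n → x s i = y s i) : Present x n i ↔ Present y n i := by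
  unfold Present
  rw [itemCount_congr h]

theorem counts_congr {x y : UpdateStream d T} {n : ℕ}
    (h : ∀ s : Fin T, s.val < n → x s = y s) : counts x n = counts y n := by
  induction n with
  | zero => rfl
  | succ n ih =>
    rw [counts, counts, ih fun s hs => h s (hs.trans n.lt_succ_self)]
    congr 2
    simp only [countDistinct]
    congr 1
    ext i
    simp only [Finset.mem_filter, Finset.mem_univ, true_and]
    exact present_congr fun s hs => by rw [h s hs]

theorem countDistinct_le (x : UpdateStream d T) (n : ℕ) : countDistinct x n ≤ d := by
  simpa [countDistinct] using Finset.card_filter_le (Finset.univ : Finset (Fin d)) (Present x n ·)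

theorem ItemNeighboring.symm {x y : UpdateStream d T} (h : ItemNeighboring x y) :
    ItemNeighboring y x :=
  let ⟨j, hj⟩ := h
  ⟨j, fun t i hi => (hj t i hi).symm⟩

theorem ItemNeighboring.countDistinct_le {x y : UpdateStream d T} (h : ItemNeighboring x y)
    (n : ℕ) : countDistinct x n ≤ countDistinct y n + 1 := by
  obtain ⟨j, hj⟩ := h
  have hsub : (Finset.univ.filter fun i : Fin d => Present x n i)
      ⊆ insert j (Finset.univ.filter fun i : Fin d => Present y n i) := by
    intro i hi
    by_cases hij : i = j
    · simp [hij]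
    · refine Finset.mem_insert_of_mem ?_
      simp only [Finset.mem_filter, Finset.mem_univ, true_and] at hi ⊢
      exact (present_congr fun s _ => hj s i hij).1 hi
  exact (Finset.card_le_card hsub).trans (Finset.card_insert_le _ _)

theorem ItemNeighboring.linked {x y : UpdateStream d T} (h : ItemNeighboring x y) (n : ℕ) :
    Linked Tracker.Near Tracker.Near (counts x (n + 1)) (counts y (n + 1)) := by
  have hnear : ∀ k, Tracker.Near (countDistinct x k) (countDistinct y k) := by
    intro k
    have h1 := h.countDistinct_le k
    have h2 := h.symm.countDistinct_le k
    rw [Tracker.Near, abs_le]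
    omega
  induction n with
  | zero => exact .single (hnear 1)
  | succ n ih => exact .cons ih (hnear _)

/-- The items whose presence changes at time `t`. -/
def flips (x : UpdateStream d T) (t : ℕ) : Finset (Fin d) :=
  Finset.univ.filter fun i => ¬ (Present x t i ↔ Present x (t - 1) i)

theorem abs_countDistinct_sub_le (x : UpdateStream d T) (t : ℕ) :
    |(countDistinct x t : ℤ) - countDistinct x (t - 1)| ≤ (flips x t).card := by
  have h1 : countDistinct x t ≤ countDistinct x (t - 1) + (flips x t).card := by
    refine (Finset.card_le_card fun i hi => ?_).trans (Finset.card_union_le _ _)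
    simp only [flips, Finset.mem_union, Finset.mem_filter, Finset.mem_univ, true_and] at hi ⊢
    tauto
  have h2 : countDistinct x (t - 1) ≤ countDistinct x t + (flips x t).card := by
    refine (Finset.card_le_card fun i hi => ?_).trans (Finset.card_union_le _ _)
    simp only [flips, Finset.mem_union, Finset.mem_filter, Finset.mem_univ, true_and] at hi ⊢
    tauto
  rw [abs_le]
  omega

theorem totalFlippancy_eq (x : UpdateStream d T) :
    totalFlippancy x = ∑ t ∈ Finset.Icc 2 T, (flips x t).card := by
  simp only [totalFlippancy, flips, Finset.card_filter]
  exact Finset.sum_comm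

/-- For `T = 1` the quantity `log (T / β)` can be arbitrarily close to 0. Bounds of the test level
by a multiple of it are needed only for `K ≠ 0`, where `log (T / β) ≥ log 2`. -/
theorem two_le_of_totalFlippancy_ne_zero (x : UpdateStream d T) (h : totalFlippancy x ≠ 0) :
    2 ≤ T := by
  by_contra hT
  exact h (by rw [totalFlippancy_eq, Finset.Icc_eq_empty hT, Finset.sum_empty])

theorem variation_counts_le (x : UpdateStream d T) (n : ℕ) :
    variation (counts x n) ≤ ∑ t ∈ Finset.Icc 2 n, ((flips x t).card : ℤ) := by
  match n with
  | 0 => simp [counts, variation]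
  | 1 => simp [counts, variation]
  | n + 2 =>
    have ih := variation_counts_le x (n + 1)
    rw [Finset.sum_Icc_succ_top (by omega)]
    have h := abs_countDistinct_sub_le x (n + 2)
    simp only [counts, variation] at ih ⊢
    simp only [Nat.add_succ_sub_one] at h
    linarith

theorem variation_counts_le_totalFlippancy (x : UpdateStream d T) {n : ℕ} (hn : n ≤ T) :
    variation (counts x n) ≤ totalFlippancy x := by
  refine (variation_counts_le x n).trans ?_
  rw [totalFlippancy_eq]
  push_cast
  exact Finset.sum_le_sum_of_subset_of_nonneg (Finset.Icc_subset_Icc_right hn)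
    fun _ _ _ => by positivity

end Counts

/-! ### From strategies to online algorithms -/

section Algorithm

variable {d T : ℕ}

/-- The online algorithm that follows a strategy on the counts of distinct elements and publishes
`dec h` after the actions `h`. -/
noncomputable def onlineAlgorithm (d T : ℕ) (κ : Strategy (Option ℤ))
    (dec : List (Option ℤ) → ℝ) : OnlineAlgorithm d T where
  Coins := List ℤ × List (Option ℤ) → Option ℤ
  coinSpace := inferInstance
  coinLaw := coinMeasure κ
  coinLaw_prob := inferInstance
  out x ω t := dec (transcript ω (counts x (t + 1)))
  measurable_out x := measurable_pi_lambda _ fun t S _ =>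
    measurableSet_transcript_mem (counts x (t + 1)) (dec ⁻¹' S)
  causal t x y h ω := by
    rw [counts_congr fun s hs => h s (Fin.le_def.2 (Nat.lt_succ_iff.1 hs))]

theorem transcript_counts (ω : List ℤ × List (Option ℤ) → Option ℤ) (x : UpdateStream d T)
    (t : Fin T) :
    transcript ω (counts x (t + 1)) = (transcript ω (counts x T)).drop (T - (t + 1)) := by
  rw [← transcript_drop]
  congr 1
  conv_rhs => rw [show counts x T = counts x ((t + 1) + (T - (t + 1))) by
    congr 1; have := t.isLt; omega]
  rw [drop_counts]

/-- Post-processing: the output sequence is one function of the final transcript, and the stream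
enters only through its counts. -/
theorem itemLevelDP_onlineAlgorithm (hT : 0 < T) (κ : Strategy (Option ℤ))
    (dec : List (Option ℤ) → ℝ) {ε δ : ℝ} (hδ : 0 ≤ δ)
    (h : ∀ cs cs', Linked Tracker.Near Tracker.Near cs cs' → cs.length = T →
      ∀ S : Set (List (Option ℤ)), ∑' h, S.indicator (likelihood κ cs) h
        ≤ ENNReal.ofReal (Real.exp ε) * ∑' h, S.indicator (likelihood κ cs') h
          + ENNReal.ofReal δ) :
    (onlineAlgorithm d T κ dec).ItemLevelDP ε δ := by
  intro x y hxy S _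
  set S' : Set (List (Option ℤ)) := {h | (fun t : Fin T => dec (h.drop (T - (t + 1)))) ∈ S}
    with hS'
  have hset : ∀ z : UpdateStream d T, {ω | (onlineAlgorithm d T κ dec).out z ω ∈ S}
      = {ω | transcript ω (counts z T) ∈ S'} := by
    intro z
    refine Set.ext fun (ω : List ℤ × List (Option ℤ) → Option ℤ) => ?_
    have : (onlineAlgorithm d T κ dec).out z ω
        = fun t : Fin T => dec ((transcript ω (counts z T)).drop (T - (t + 1))) :=
      funext fun t => congrArg dec (transcript_counts ω z t)
    change (onlineAlgorithm d T κ dec).out z ω ∈ S ↔ _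
    rw [this]
    rfl
  have hlink : Linked Tracker.Near Tracker.Near (counts x T) (counts y T) := by
    obtain ⟨n, rfl⟩ := Nat.exists_eq_succ_of_ne_zero hT.ne'
    exact hxy.linked n
  have key := h _ _ hlink (length_counts x T) S'
  rw [← coinMeasure_transcript_mem, ← coinMeasure_transcript_mem] at key
  rw [hset, hset]
  change (coinMeasure κ).real _ ≤ _ * (coinMeasure κ).real _ + δ
  have := ENNReal.toReal_mono (by finiteness) key
  rwa [ENNReal.toReal_add (by finiteness) (by finiteness), ENNReal.toReal_mul,
    ENNReal.toReal_ofReal (Real.exp_nonneg _), ENNReal.toReal_ofReal hδ] at this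

theorem le_coinMeasure_real_of_tsum_le {α : Type} [MeasurableSpace α] [DiscreteMeasurableSpace α]
    [Countable α] (κ : Strategy α) (cs : List ℤ) {β : ℝ} (hβ : 0 ≤ β) (G : Set (List α))
    (h : ∑' h, {h | h ∉ G}.indicator (likelihood κ cs) h ≤ ENNReal.ofReal β) :
    1 - β ≤ (coinMeasure κ).real {ω | transcript ω cs ∈ G} := by
  rw [← coinMeasure_transcript_mem] at h
  have hc : {ω : List ℤ × List α → α | transcript ω cs ∈ {h | h ∉ G}}
      = {ω | transcript ω cs ∈ G}ᶜ := rfl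
  rw [hc] at h
  have h1 := probReal_compl_eq_one_sub (μ := coinMeasure κ) (measurableSet_transcript_mem cs G)
  have h2 : (coinMeasure κ).real {ω | transcript ω cs ∈ G}ᶜ ≤ β :=
    ENNReal.toReal_le_of_le_ofReal hβ h
  linarith

end Algorithm

/-! ### Error in terms of the number of rounds -/

namespace Tracker

variable {P : Tracker}

theorem Tracks.length_eq {R : ℕ → ℝ} : ∀ {cs : List ℤ} {h : List (Option ℤ)},
    P.Tracks R cs h → h.length = cs.length
  | [], [], _ => rfl
  | [], _ :: _, ht => ht.elim
  | _ :: _, [], ht => ht.elim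
  | _ :: _, _ :: _, ht => by simpa using Tracks.length_eq ht.1

theorem Tracks.drop {R : ℕ → ℝ} {cs : List ℤ} {h : List (Option ℤ)} (ht : P.Tracks R cs h)
    (k : ℕ) : P.Tracks R (cs.drop k) (h.drop k) := by
  induction k generalizing cs h with
  | zero => exact ht
  | succ k ih =>
    match cs, h with
    | [], [] => simpa using ht
    | [], _ :: _ => exact ht.elim
    | _ :: _, [] => exact ht.elim
    | _ :: _, _ :: _ => exact ih ht.1

/-- Round `0` is kept apart: there the count has moved by at most `K` since the first release, and
`R 0` can be chosen independent of `T`. This covers `K = 0`. -/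
theorem Accurate.error {R : ℕ → ℝ} {c V : ℤ} {h : List (Option ℤ)} (h0 : 0 ∉ P.direct)
    (ha : P.Accurate R c V h) {K T : ℕ} (hV : V ≤ K) (hT : h.length ≤ T) :
    (|((P.pub h).2 : ℝ) - c| ≤ K + R 0 ∧ |((P.pub h).2 : ℝ) - c| ≤ 6 * P.scale 0) ∨
    ∃ m : ℕ, 1 ≤ m ∧ m < T ∧ m ≤ K ∧ ∑ j ∈ Finset.range m, 2 * P.scale j ≤ K ∧
      (m ∈ P.direct → |((P.pub h).2 : ℝ) - c| ≤ R m) ∧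
      (m ∉ P.direct → |((P.pub h).2 : ℝ) - c| ≤ 6 * P.scale m) := by
  obtain ⟨h1, h2, h3, h4, h5⟩ := ha
  have hV' : (V : ℝ) ≤ K := by exact_mod_cast hV
  by_cases hm : (P.pub h).1 = 0
  · left
    obtain ⟨h8, c₀, h6, h7, -⟩ := h5 (hm ▸ h0)
    rw [hm] at h6 h7 h8
    rw [Finset.range_zero, Finset.sum_empty, add_zero] at h7
    push_cast at h6 h7 h8
    refine ⟨?_, by rwa [abs_sub_comm]⟩
    linarith [abs_sub_le ((P.pub h).2 : ℝ) c₀ c, abs_sub_comm (c₀ : ℝ) c]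
  · right
    rw [abs_sub_comm]
    push_cast at h4 h5
    exact ⟨(P.pub h).1, Nat.one_le_iff_ne_zero.2 hm, h1.trans_le hT, by omega, h2.trans hV', h4,
      fun hs => (h5 hs).1⟩

/-- The published value: the current output, clamped to the range of possible counts. -/
noncomputable def publish (P : Tracker) (d : ℕ) (h : List (Option ℤ)) : ℝ :=
  max 0 (min d ((P.pub h).2 : ℝ))

theorem abs_publish_sub_le {d : ℕ} {h : List (Option ℤ)} {c : ℝ} (hc : 0 ≤ c) (hcd : c ≤ d) :
    |P.publish d h - c| ≤ min (d : ℝ) |((P.pub h).2 : ℝ) - c| := by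
  unfold publish
  refine le_min ?_ ?_
  · rw [abs_le]
    have h1 : max 0 (min (d : ℝ) ((P.pub h).2 : ℝ)) ≤ d :=
      max_le (Nat.cast_nonneg d) (min_le_left _ _)
    constructor <;> linarith [le_max_left (0 : ℝ) (min (d : ℝ) ((P.pub h).2 : ℝ))]
  · have e : c = max 0 (min (d : ℝ) c) := by rw [min_eq_right hcd, max_eq_right hc]
    calc _ = |max 0 (min (d : ℝ) ((P.pub h).2 : ℝ)) - max 0 (min (d : ℝ) c)| := by rw [← e]
      _ ≤ |min (d : ℝ) ((P.pub h).2 : ℝ) - min (d : ℝ) c| := by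
        simpa using abs_max_sub_max_le_max (0 : ℝ) (min (d : ℝ) ((P.pub h).2 : ℝ)) 0 (min (d : ℝ) c)
      _ ≤ _ := by
        simpa using abs_min_sub_min_le_max (d : ℝ) ((P.pub h).2 : ℝ) d c

/-- The error of the mechanism, in terms of the number of rounds. -/
theorem hasError_onlineAlgorithm {d T : ℕ} {R : ℕ → ℝ} {η β b : ℝ}
    (hL : 0 < P.L) (hγ : ∀ m, 0 < P.γ m) (hη : 0 < η) (hLη : Real.exp (-P.L) ≤ η)
    (h0 : 0 ∉ P.direct) (hR : ∀ m, m ∉ P.direct → R m ≤ 2 * P.scale m)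
    (htail : ∀ m, tailProb (P.ν (m + 1)) (R (m + 1)) ≤ ENNReal.ofReal η)
    (hb : 0 ≤ b) (htail0 : tailProb (P.ν 0) (R 0) ≤ ENNReal.ofReal b) (hN : 2 * η * T ≤ 1)
    (hβ : 2 * η * T + (1 - 2 * η * T) * b ≤ β) {err : ℕ → ℝ}
    (hd : ∀ K : ℕ, (K ≠ 0 → 2 ≤ T) → ∀ e : ℝ, e ≤ d →
      ((e ≤ K + R 0 ∧ e ≤ 6 * P.scale 0) ∨ ∃ m : ℕ, 1 ≤ m ∧ m < T ∧ m ≤ K ∧ ∑ j ∈ Finset.range m, 2 * P.scale j ≤ K ∧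
        (m ∈ P.direct → e ≤ R m) ∧ (m ∉ P.direct → e ≤ 6 * P.scale m)) → e ≤ err K) :
    (onlineAlgorithm d T P.strategy (P.publish d)).HasError β err := by
  intro x
  set G : Set (List (Option ℤ)) := {h | P.Tracks R (counts x T) h} with hG
  have hβ0 : 0 ≤ β := le_trans (add_nonneg (by positivity) (mul_nonneg (by linarith) hb)) hβ
  have hprob := le_coinMeasure_real_of_tsum_le P.strategy (counts x T) hβ0 G (by
    refine (tsum_indicator_not_tracks_le hL hγ hη hLη h0 hR htail htail0 hN (counts x T)
      (length_counts x T)).trans ?_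
    rw [← ENNReal.ofReal_one, ← ENNReal.ofReal_sub _ (by positivity),
      ← ENNReal.ofReal_mul (by linarith),
      ← ENNReal.ofReal_add (by positivity) (mul_nonneg (by linarith) hb)]
    exact ENNReal.ofReal_le_ofReal hβ)
  refine hprob.trans (measureReal_mono ?_)
  intro ω hω t
  have ht := (show P.Tracks R (counts x T) (transcript ω (counts x T)) from hω).drop (T - (t + 1))
  rw [← transcript_counts, show (counts x T).drop (T - (t + 1)) = counts x (t + 1) by
    conv_lhs => rw [show counts x T = counts x ((t + 1) + (T - (t + 1))) by
      congr 1; have := t.isLt; omega]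
    rw [drop_counts]] at ht
  have hlen := ht.length_eq
  rw [length_counts] at hlen
  change |P.publish d (transcript ω (counts x (t + 1))) - _| ≤ _
  have habs := abs_publish_sub_le (P := P) (d := d) (h := transcript ω (counts x (t + 1)))
    (c := countDistinct x (t + 1)) (Nat.cast_nonneg _) (by exact_mod_cast countDistinct_le x _)
  refine hd _ (two_le_of_totalFlippancy_ne_zero x) _ (habs.trans (min_le_left _ _)) ?_
  have hvar := variation_counts_le_totalFlippancy x (n := t + 1) t.isLt
  have hacc := ht.2.error h0 hvar (hlen.le.trans t.isLt)
  have habs' := habs.trans (min_le_right _ _)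
  push_cast at hacc
  rcases hacc with hacc | ⟨m, h1, h2, h3, h4, h5, h6⟩
  · exact Or.inl ⟨habs'.trans hacc.1, habs'.trans hacc.2⟩
  · exact Or.inr ⟨m, h1, h2, h3, h4, fun h => habs'.trans (h5 h), fun h => habs'.trans (h6 h)⟩

end Tracker

/-! ### A growth rate with summable inverses -/

section Growth

/-- The growth rate of the error scale with the number of rounds. Its inverses are summable. -/
noncomputable def growth (m : ℕ) : ℝ := (m + 1) * (1 + Real.log (m + 1)) ^ 2

theorem log_succ_nonneg (m : ℕ) : 0 ≤ Real.log ((m : ℝ) + 1) :=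
  Real.log_nonneg (by linarith [Nat.cast_nonneg (α := ℝ) m])

theorem growth_pos (m : ℕ) : 0 < growth m := by
  have := log_succ_nonneg m
  unfold growth; positivity

theorem growth_zero : growth 0 = 1 := by simp [growth]

theorem growth_mono : Monotone growth := by
  intro m n h
  have h1 : (m : ℝ) ≤ n := by exact_mod_cast h
  have h2 := log_succ_nonneg m
  unfold growth
  gcongr

/-- Telescoping against `1 / (1 + log x)`, whose derivative is `-1 / (x * (1 + log x) ^ 2)`. -/
theorem sum_inv_growth_le (m : ℕ) : ∑ j ∈ Finset.range m, (growth j)⁻¹ ≤ 2 := by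
  have key : ∀ m : ℕ, ∑ j ∈ Finset.range (m + 1), (growth j)⁻¹
      ≤ 2 - (1 + Real.log (m + 1))⁻¹ := by
    intro m
    induction m with
    | zero => norm_num [growth_zero]
    | succ m ih =>
      rw [Finset.sum_range_succ]
      have h0 := log_succ_nonneg m
      have h1 : 1 / ((m : ℝ) + 2) ≤ Real.log (m + 2) - Real.log (m + 1) := by
        have := Real.log_le_sub_one_of_pos (x := ((m : ℝ) + 1) / (m + 2)) (by positivity)
        rw [Real.log_div (by positivity) (by positivity)] at this
        have e : ((m : ℝ) + 1) / (m + 2) - 1 = -(1 / (m + 2)) := by field_simp; ring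
        linarith
      have h2 : 0 < 1 / ((m : ℝ) + 2) := by positivity
      have e3 : ((m + 1 : ℕ) : ℝ) + 1 = m + 2 := by push_cast; ring
      have hb : 0 < 1 + Real.log ((m : ℝ) + 2) := by linarith
      have ha : 0 < 1 + Real.log ((m : ℝ) + 1) := by linarith
      have h3 : (growth (m + 1))⁻¹
          ≤ (1 + Real.log ((m : ℝ) + 1))⁻¹ - (1 + Real.log ((m : ℝ) + 2))⁻¹ := by
        rw [growth, e3, inv_sub_inv ha.ne' hb.ne']
        calc (((m : ℝ) + 2) * (1 + Real.log (m + 2)) ^ 2)⁻¹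
            = 1 / ((m : ℝ) + 2) / (1 + Real.log (m + 2)) ^ 2 := by field_simp
          _ ≤ (Real.log (m + 2) - Real.log (m + 1)) / (1 + Real.log (m + 2)) ^ 2 := by gcongr
          _ ≤ (Real.log (m + 2) - Real.log (m + 1))
              / ((1 + Real.log (m + 1)) * (1 + Real.log (m + 2))) := by
            refine div_le_div_of_nonneg_left (by linarith) (by positivity) ?_
            nlinarith
          _ = _ := by ring
      rw [e3]
      linarith
  cases m with
  | zero => simp
  | succ m =>
    have := log_succ_nonneg m
    have h : 0 ≤ (1 + Real.log ((m : ℝ) + 1))⁻¹ := by positivity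
    linarith [key m]

/-- Doubling property: `mul_half_le_of_sum_le` controls the scale at `m / 2`, while the error is
governed by the scale at `m`. -/
theorem growth_le_half (m : ℕ) : growth m ≤ 8 * growth (m / 2) := by
  have h1 : (m : ℝ) + 1 ≤ 2 * (((m / 2 : ℕ) : ℝ) + 1) := by
    have : m + 1 ≤ 2 * (m / 2 + 1) := by omega
    exact_mod_cast this
  have h2 := log_succ_nonneg (m / 2)
  have h3 : Real.log ((m : ℝ) + 1) ≤ Real.log 2 + Real.log (((m / 2 : ℕ) : ℝ) + 1) := by
    rw [← Real.log_mul two_ne_zero (by positivity)]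
    exact Real.log_le_log (by positivity) h1
  have h4 := Real.log_two_lt_d9
  have h5 := log_succ_nonneg m
  calc growth m ≤ 2 * (((m / 2 : ℕ) : ℝ) + 1) * (2 * (1 + Real.log (((m / 2 : ℕ) : ℝ) + 1))) ^ 2 := by
        unfold growth
        gcongr
        linarith
    _ = 8 * growth (m / 2) := by unfold growth; ring

theorem growth_le_sq (m : ℕ) : growth m ≤ 4 * (m + 1) ^ 2 := by
  have h0 : (0 : ℝ) < m + 1 := by positivity
  have h1 : Real.log ((m : ℝ) + 1) = 2 * Real.log (Real.sqrt (m + 1)) := by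
    rw [Real.log_sqrt h0.le]; ring
  have h2 := Real.log_le_sub_one_of_pos (Real.sqrt_pos.2 h0)
  have h3 : 1 + Real.log ((m : ℝ) + 1) ≤ 2 * Real.sqrt (m + 1) := by linarith
  have h4 := log_succ_nonneg m
  calc growth m ≤ (m + 1) * (2 * Real.sqrt (m + 1)) ^ 2 := by unfold growth; gcongr
    _ = 4 * (m + 1) ^ 2 := by rw [mul_pow, Real.sq_sqrt h0.le]; ring

theorem one_le_logOne (y : ℝ) : 1 ≤ logOne y := le_max_left _ _

theorem log_le_logOne (y : ℝ) : Real.log y ≤ logOne y := le_max_right _ _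

theorem growth_le_logOne {m K : ℕ} (hm : 1 ≤ m) (hK : m ≤ K) :
    growth m ≤ 18 * m * logOne K ^ 2 := by
  have h0 := log_succ_nonneg m
  have hm' : (1 : ℝ) ≤ m := by exact_mod_cast hm
  have hK' : (m : ℝ) ≤ K := by exact_mod_cast hK
  have h1 : Real.log ((m : ℝ) + 1) ≤ Real.log 2 + Real.log K := by
    rw [← Real.log_mul two_ne_zero (by linarith)]
    exact Real.log_le_log (by positivity) (by linarith)
  have h2 : 1 + Real.log ((m : ℝ) + 1) ≤ 3 * logOne K := by
    linarith [Real.log_two_lt_d9, one_le_logOne K, log_le_logOne K]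
  calc growth m ≤ (2 * m) * (3 * logOne K) ^ 2 := by
        unfold growth
        gcongr
        linarith
    _ = _ := by ring

/-- The bulk of a sum of a nondecreasing sequence comes from its later half. -/
theorem mul_half_le_of_sum_le {s : ℕ → ℝ} (hs : Monotone s) (h0 : ∀ m, 0 ≤ s m) {m : ℕ} {K : ℝ}
    (h : ∑ j ∈ Finset.range m, 2 * s j ≤ K) : m * s (m / 2) ≤ K := by
  have h1 : ∑ _j ∈ Finset.Ico (m / 2) m, 2 * s (m / 2) ≤ ∑ j ∈ Finset.range m, 2 * s j := by
    rw [Finset.range_eq_Ico]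
    refine (Finset.sum_le_sum fun j hj => ?_).trans
      (Finset.sum_le_sum_of_subset_of_nonneg (Finset.Ico_subset_Ico_left (Nat.zero_le _))
        fun j _ _ => mul_nonneg zero_le_two (h0 j))
    have := hs (Finset.mem_Ico.1 hj).1
    linarith
  rw [Finset.sum_const, Nat.card_Ico, nsmul_eq_mul] at h1
  have h2 : (m : ℝ) ≤ 2 * ((m - m / 2 : ℕ) : ℝ) := by
    have : m ≤ 2 * (m - m / 2) := by omega
    exact_mod_cast this
  nlinarith [h0 (m / 2), mul_le_mul_of_nonneg_right h2 (h0 (m / 2))]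

end Growth

/-! ### Logarithmic factors and the failure budget -/

section Bounds

/-- The logarithmic factor of the tests: every one of the `T` steps may fail with probability of
order `β / T`. -/
noncomputable def testLevel (T : ℕ) (β : ℝ) : ℝ := 1 + Real.log (64 * T / β)

variable {T : ℕ} {β : ℝ}

theorem log_div_nonneg (hT : 0 < T) (hβ : 0 < β) (hβ1 : β < 1) : 0 ≤ Real.log (T / β) := by
  have : (1 : ℝ) ≤ T := by exact_mod_cast hT
  exact Real.log_nonneg ((one_le_div hβ).2 (by linarith))

theorem testLevel_eq (hT : 0 < T) (hβ : 0 < β) :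
    testLevel T β = 1 + 6 * Real.log 2 + Real.log (T / β) := by
  have : (0 : ℝ) < T := by exact_mod_cast hT
  rw [testLevel, mul_div_assoc, Real.log_mul (by norm_num) (by positivity),
    show (64 : ℝ) = 2 ^ 6 by norm_num, Real.log_pow]
  push_cast
  ring

theorem one_le_testLevel (hT : 0 < T) (hβ : 0 < β) (hβ1 : β < 1) : 1 ≤ testLevel T β := by
  rw [testLevel_eq hT hβ]
  linarith [log_div_nonneg hT hβ hβ1, Real.log_two_gt_d9]

theorem log_inv_le_testLevel (hT : 0 < T) (hβ : 0 < β) : Real.log (1 / β) ≤ testLevel T β := by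
  have : (1 : ℝ) ≤ T := by exact_mod_cast hT
  rw [testLevel_eq hT hβ]
  have : Real.log (1 / β) ≤ Real.log (T / β) :=
    Real.log_le_log (by positivity) (by gcongr)
  linarith [Real.log_two_gt_d9]

theorem testLevel_le (hT : 2 ≤ T) (hβ : 0 < β) (hβ1 : β < 1) :
    testLevel T β ≤ 9 * Real.log (T / β) := by
  have hT' : (2 : ℝ) ≤ T := by exact_mod_cast hT
  rw [testLevel_eq (by omega) hβ]
  have : Real.log 2 ≤ Real.log (T / β) := by
    refine Real.log_le_log two_pos ?_
    rw [le_div_iff₀ hβ]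
    nlinarith
  linarith [Real.log_two_gt_d9]

theorem exp_neg_testLevel_le (hT : 0 < T) (hβ : 0 < β) :
    2 * Real.exp (-testLevel T β) ≤ β / (8 * T) := by
  have hT' : (0 : ℝ) < T := by exact_mod_cast hT
  rw [testLevel, neg_add, Real.exp_add, ← Real.log_inv, Real.exp_log (by positivity), inv_div]
  have h1 : Real.exp (-1) ≤ 1 := Real.exp_le_one_iff.2 (by norm_num)
  calc 2 * (Real.exp (-1) * (β / (64 * T))) ≤ 2 * (1 * (β / (64 * T))) := by gcongr
    _ = β / (32 * T) := by field_simp; norm_num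
    _ ≤ β / (8 * T) := by gcongr; norm_num

/-- The slack in the second inequality is `β * (1 - β) * (3 - β) / 4`, which vanishes at `β = 1`. -/
theorem failure_le (hT : 0 < T) (hβ : 0 < β) (hβ1 : β < 1) :
    2 * (β / (8 * T)) * T ≤ 1 ∧
      2 * (β / (8 * T)) * T + (1 - 2 * (β / (8 * T)) * T) * β ^ 2 ≤ β := by
  have hT' : (0 : ℝ) < T := by exact_mod_cast hT
  have e : 2 * (β / (8 * T)) * T = β / 4 := by field_simp; norm_num
  rw [e]
  constructor
  · linarith
  · nlinarith [mul_pos hβ (sub_pos.2 hβ1), mul_pos hβ (mul_pos hβ (sub_pos.2 hβ1))]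

/-- Only this part of the additive term is needed. It pays for the first release and, under
approximate privacy, for round `0` when `log (T / β) > 4 * T`. -/
theorem additiveTerm_ge {K : ℕ} {ε : ℝ} (hε : 0 < ε) (hβ : 0 < β) (hβ1 : β < 1) :
    Real.log (1 / β) / ε ≤ additiveTerm K ε β := by
  have h1 := one_le_logOne K
  have h2 : 0 ≤ Real.log (1 / β) := Real.log_nonneg ((one_le_div hβ).2 hβ1.le)
  have h3 : Real.log (1 / β) ≤ Real.log (logOne K / β) :=
    Real.log_le_log (by positivity) (by gcongr)
  have h4 : 1 ≤ logOne K ^ 2 := one_le_pow₀ h1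
  rw [additiveTerm, mul_assoc, div_eq_inv_mul]
  gcongr
  nlinarith

/-- Collect bounds for all terms of a minimum. -/
theorem le_mul_min_add {C e e' r r' x₁ x₂ x₃ x₄ : ℝ} (hC : 1 ≤ C) (hx₁ : 0 ≤ x₁) (h1 : e ≤ x₁)
    (h : e ≤ e' + r) (hr0 : 0 ≤ r) (hr : r ≤ C * r') (h2 : e' ≤ C * x₂) (h3 : e' ≤ C * x₃)
    (h4 : e' ≤ C * x₄) : e ≤ C * (min x₁ (min x₂ (min x₃ x₄)) + r') := by
  have hC0 : 0 < C := by linarith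
  have key : (e - r) / C ≤ min x₁ (min x₂ (min x₃ x₄)) := by
    refine le_min ?_ (le_min ?_ (le_min ?_ ?_)) <;> rw [div_le_iff₀ hC0] <;> nlinarith
  rw [div_le_iff₀ hC0] at key
  linarith

theorem exp_tail_init {ε : ℝ} (hε : 0 < ε) (hβ : 0 < β) :
    Real.exp (-(ε / 2) * (8 * Real.log (1 / β) / ε) / 2) = β ^ 2 := by
  have e : -(ε / 2) * (8 * Real.log (1 / β) / ε) / 2 = (2 : ℕ) * Real.log β := by
    rw [one_div, Real.log_inv]
    push_cast
    field_simp
    norm_num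
  rw [e, Real.exp_nat_mul, Real.exp_log hβ]

end Bounds

/-! ### Pure differential privacy -/

section Pure

/-- The slopes of the tests under pure differential privacy. -/
noncomputable def pureSlope (T : ℕ) (ε : ℝ) (m : ℕ) : ℝ :=
  ε / 24 * ((growth m)⁻¹ + if m < T then (T : ℝ)⁻¹ else 0)

variable {T : ℕ} {ε : ℝ}

theorem pureSlope_pos (hε : 0 < ε) (m : ℕ) : 0 < pureSlope T ε m := by
  have := growth_pos m
  unfold pureSlope
  split_ifs <;> positivity

theorem pureSlope_anti (hε : 0 < ε) : Antitone (pureSlope T ε) := by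
  intro m n h
  unfold pureSlope
  have h1 := inv_anti₀ (growth_pos m) (growth_mono h)
  have h2 : (if n < T then (T : ℝ)⁻¹ else 0) ≤ if m < T then (T : ℝ)⁻¹ else 0 := by
    split_ifs with hn hm hm
    · exact le_rfl
    · omega
    · positivity
    · exact le_rfl
  gcongr

/-- The bound is `ε / 24 * (2 + 1)`: the inverse growth sums to at most 2, and `T⁻¹` is spent in at
most `T` rounds. -/
theorem sum_pureSlope_le (hε : 0 < ε) (m : ℕ) :
    ∑ j ∈ Finset.range m, pureSlope T ε j ≤ ε / 8 := by
  have h1 : ∑ j ∈ Finset.range m, (if j < T then (T : ℝ)⁻¹ else 0) ≤ 1 := by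
    rw [← Finset.sum_filter, Finset.sum_const, nsmul_eq_mul]
    have hsub : (Finset.range m).filter (· < T) ⊆ Finset.range T := fun j hj => by
      simp only [Finset.mem_filter, Finset.mem_range] at hj ⊢
      exact hj.2
    have hcard : (((Finset.range m).filter (· < T)).card : ℝ) ≤ T := by
      exact_mod_cast (Finset.card_le_card hsub).trans (Finset.card_range T).le
    rcases Nat.eq_zero_or_pos T with rfl | hT
    · simp
    · have hT' : (0 : ℝ) < T := by exact_mod_cast hT
      rw [← div_eq_mul_inv, div_le_one hT']
      exact hcard
  simp only [pureSlope]
  rw [← Finset.mul_sum, Finset.sum_add_distrib]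
  have h2 := sum_inv_growth_le m
  nlinarith

/-- The mechanism with pure differential privacy. -/
noncomputable def pureTracker (T : ℕ) (ε : ℝ) (hε : 0 < ε) (L : ℝ) : Tracker where
  γ := pureSlope T ε
  L := L
  ν
    | 0 => discreteLaplace (ε / 2) (half_pos hε)
    | m + 1 => discreteLaplace (pureSlope T ε (m + 1)) (pureSlope_pos hε _)
  direct := ∅

theorem itemLevelDP_pureTracker {d : ℕ} (hT : 0 < T) (hε : 0 < ε) (L : ℝ)
    (dec : List (Option ℤ) → ℝ) :
    (onlineAlgorithm d T (pureTracker T ε hε L).strategy dec).ItemLevelDP ε 0 := by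
  refine itemLevelDP_onlineAlgorithm hT _ dec le_rfl fun cs cs' hl _ S => ?_
  rw [ENNReal.ofReal_zero, add_zero, ← ENNReal.tsum_mul_left]
  refine ENNReal.tsum_le_tsum fun h => ?_
  by_cases hS : h ∈ S
  · rw [Set.indicator_of_mem hS, Set.indicator_of_mem hS]
    -- `ε / 2` pays for the first release and `4 * (ε / 8)` for all rounds.
    have key := Tracker.likelihood_le_of_near (P := pureTracker T ε hε L) (θ := ε / 2)
      (A := ε / 8) (fun m => (pureSlope_pos hε m).le) rfl ?_ ?_ (sum_pureSlope_le hε) hl h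
    · rwa [show ε / 2 + 4 * (ε / 8) = ε by ring] at key
    · intro c c' v hc
      refine discreteLaplace_le_mul (half_pos hε) le_rfl ?_
      rw [sub_sub_sub_cancel_left]
      exact hc.symm
    · intro m c c' v hc
      -- The noise has the slope of the round that it opens, and is charged to the round that it
      -- ends, whose slope is no smaller.
      refine discreteLaplace_le_mul (pureSlope_pos hε (m + 1))
        (pureSlope_anti hε (Nat.le_succ m)) ?_
      rw [sub_sub_sub_cancel_left]
      exact hc.symm
  · rw [Set.indicator_of_notMem hS]
    exact zero_le

theorem pureSlope_le_half (hε : 0 < ε) {m : ℕ} (hm : m < T) :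
    pureSlope T ε (m / 2) ≤ 8 * pureSlope T ε m := by
  have h1 : (growth (m / 2))⁻¹ ≤ 8 * (growth m)⁻¹ := by
    rw [← div_eq_mul_inv, inv_le_comm₀ (growth_pos _) (by have := growth_pos m; positivity),
      inv_div, div_le_iff₀ (by norm_num)]
    linarith [growth_le_half m]
  have hT : (0 : ℝ) < (T : ℝ)⁻¹ := by
    have : (0 : ℝ) < T := by exact_mod_cast (Nat.zero_le m).trans_lt hm
    positivity
  unfold pureSlope
  rw [if_pos hm, if_pos ((Nat.div_le_self m 2).trans_lt hm)]
  nlinarith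

/-- In a round `m ≥ 1`, `m * scale m ≤ 8 * K` gives the bound by `K`; its product with `scale m ≲ L
* m * logOne K ^ 2 / ε` bounds `scale m ^ 2`; and `m < T` gives `scale m ≤ 24 * L * T / ε`. In round
`0` the square of `min K (6 * scale 0)` is at most the product of the two. -/
theorem exists_pure {d : ℕ} {β : ℝ} (hT : 0 < T) (hβ : 0 < β) (hβ1 : β < 1) (hε : 0 < ε) :
    ∃ A : OnlineAlgorithm d T, A.ItemLevelDP ε 0 ∧
      A.HasError β (fun K => 10000 * pureBound d T ε β K) := by
  have hT' : (0 : ℝ) < T := by exact_mod_cast hT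
  set L := testLevel T β with hL
  have hL1 : 1 ≤ L := one_le_testLevel hT hβ hβ1
  set P := pureTracker T ε hε L with hP
  have hγ : ∀ m, 0 < P.γ m := pureSlope_pos hε
  have hscale : ∀ m, P.scale m = L / pureSlope T ε m := fun m => rfl
  have hpos : ∀ m, 0 < P.scale m := fun m => by
    rw [hscale]
    exact div_pos (by linarith) (hγ m)
  have hmono : Monotone P.scale := fun m n h => by
    rw [hscale, hscale]
    exact div_le_div_of_nonneg_left (by linarith) (pureSlope_pos hε n) (pureSlope_anti hε h)
  have hlog : 0 ≤ Real.log (1 / β) := Real.log_nonneg ((one_le_div hβ).2 hβ1.le)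
  -- The tail bound is `β ^ 2` for the first radius and `exp (-L)` for the others.
  set R : ℕ → ℝ := fun m => if m = 0 then 8 * Real.log (1 / β) / ε else 2 * P.scale m with hR
  have hR0 : R 0 = 8 * Real.log (1 / β) / ε := by simp [hR]
  have hscaleT : ∀ m, m < T → P.scale m ≤ 24 * L * T / ε := by
    intro m hm
    have hg := growth_pos m
    rw [hscale, pureSlope, if_pos hm]
    calc L / (ε / 24 * ((growth m)⁻¹ + (T : ℝ)⁻¹)) ≤ L / (ε / 24 * (0 + (T : ℝ)⁻¹)) := by
          gcongr
          positivity
      _ = _ := by field_simp; ring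
  have hscaleG : ∀ m, P.scale m ≤ 24 * L * growth m / ε := by
    intro m
    have hg := growth_pos m
    rw [hscale, pureSlope]
    calc _ ≤ L / (ε / 24 * ((growth m)⁻¹ + 0)) := by
          gcongr
          split_ifs <;> positivity
      _ = _ := by field_simp; ring
  have hscale0 : 12 * L / ε ≤ P.scale 0 := by
    have : pureSlope T ε 0 ≤ ε / 12 := by
      rw [pureSlope, growth_zero, if_pos hT]
      have : (T : ℝ)⁻¹ ≤ 1 := inv_le_one_of_one_le₀ (by exact_mod_cast hT)
      nlinarith
    rw [hscale]
    calc 12 * L / ε = L / (ε / 12) := by field_simp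
      _ ≤ _ := by gcongr; exact pureSlope_pos hε 0
  have hexp := exp_neg_testLevel_le hT hβ
  rw [← hL] at hexp
  have hexp' : Real.exp (-L) ≤ β / (8 * T) := by linarith [Real.exp_pos (-L)]
  refine ⟨onlineAlgorithm d T P.strategy (P.publish d), itemLevelDP_pureTracker hT hε L _, ?_⟩
  refine Tracker.hasError_onlineAlgorithm (R := R) (η := β / (8 * T)) (b := β ^ 2)
    (show 0 < L by linarith) hγ (by positivity) hexp' (Set.notMem_empty _) ?_ ?_ (by positivity) ?_
    (failure_le hT hβ hβ1).1 (failure_le hT hβ hβ1).2 ?_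
  · intro m _
    by_cases hm : m = 0
    · subst hm
      rw [hR0]
      have h1 := log_inv_le_testLevel hT hβ
      rw [← hL] at h1
      have : 8 * Real.log (1 / β) / ε ≤ 2 * (12 * L / ε) := by
        rw [← mul_div_assoc]
        exact div_le_div_of_nonneg_right (by linarith) hε.le
      linarith
    · simp [hR, hm]
  · intro m
    refine (tailProb_discreteLaplace_le (pureSlope_pos hε (m + 1)) ?_).trans
      (ENNReal.ofReal_le_ofReal (le_trans (le_of_eq ?_) hexp'))
    · simp only [hR, Nat.add_eq_zero_iff, one_ne_zero, and_false, if_false]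
      exact mul_nonneg zero_le_two (hpos _).le
    · simp only [hR, Nat.add_eq_zero_iff, one_ne_zero, and_false, if_false]
      rw [hscale]
      have := pureSlope_pos (T := T) hε (m + 1)
      congr 1
      field_simp
  · rw [hR0]
    refine (tailProb_discreteLaplace_le (half_pos hε) (by positivity)).trans
      (ENNReal.ofReal_le_ofReal (le_of_eq ?_))
    exact exp_tail_init hε hβ
  · intro K hKT e hed hcases
    have hadd := additiveTerm_ge (K := K) hε hβ hβ1
    have hlogT := log_div_nonneg hT hβ hβ1
    have hℓ := one_le_logOne K
    set lam := Real.log (T / β) with hlam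
    have hX3 : 0 ≤ logOne K * Real.sqrt (ε⁻¹ * K * lam) := by positivity
    have hX4 : 0 ≤ ε⁻¹ * T * lam := by positivity
    have hR0' : R 0 ≤ 10000 * additiveTerm K ε β := by
      rw [hR0, mul_div_assoc]
      have : 0 ≤ Real.log (1 / β) / ε := by positivity
      linarith
    have hR0n : 0 ≤ R 0 := by rw [hR0]; positivity
    rw [pureBound]
    have hthird : ∀ y : ℝ, y ^ 2 ≤ 10000 ^ 2 * (logOne K ^ 2 * (ε⁻¹ * K * lam)) →
        y ≤ 10000 * (logOne K * Real.sqrt (ε⁻¹ * K * lam)) := by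
      intro y hy
      refine le_of_sq_le_sq (hy.trans (le_of_eq ?_)) (by positivity)
      rw [mul_pow, mul_pow, Real.sq_sqrt (by positivity)]
    rcases Nat.eq_zero_or_pos K with hK | hK
    · have he : e ≤ 0 + R 0 := by
        rcases hcases with h | ⟨m, h1, -, h3, -⟩
        · simpa [hK] using h.1
        · omega
      exact le_mul_min_add (by norm_num) (Nat.cast_nonneg d) hed he hR0n hR0' (by positivity)
        (by positivity) (by positivity)
    have hT2 := hKT hK.ne'
    have hT1 : (1 : ℝ) ≤ T := by exact_mod_cast hT
    have hL9 : L ≤ 9 * lam := testLevel_le hT2 hβ hβ1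
    have hK1 : (1 : ℝ) ≤ K := by exact_mod_cast hK
    have hℓ2 : 1 ≤ logOne K ^ 2 := one_le_pow₀ hℓ
    rcases hcases with ⟨h1, h2⟩ | ⟨m, hm1, hmT, hmK, hsum, -, herr⟩
    · have hs0 : 6 * P.scale 0 ≤ 1296 * (ε⁻¹ * lam) := by
        have := hscaleG 0
        rw [growth_zero, mul_one, div_eq_inv_mul] at this
        have h3 : ε⁻¹ * (24 * L) ≤ ε⁻¹ * (24 * (9 * lam)) := by gcongr
        linarith
      have hmin0 : 0 ≤ min (K : ℝ) (6 * P.scale 0) :=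
        le_min (by positivity) (by have := hpos 0; positivity)
      have he : e ≤ min (K : ℝ) (6 * P.scale 0) + R 0 := by
        rcases min_choice (K : ℝ) (6 * P.scale 0) with h | h <;> rw [h] <;> linarith
      refine le_mul_min_add (by norm_num) (Nat.cast_nonneg d) hed he hR0n hR0' ?_ (hthird _ ?_) ?_
      · linarith [min_le_left (K : ℝ) (6 * P.scale 0)]
      · calc min (K : ℝ) (6 * P.scale 0) ^ 2
            ≤ K * (1296 * (ε⁻¹ * lam)) := by
              rw [sq]
              exact mul_le_mul (min_le_left _ _) ((min_le_right _ _).trans hs0) hmin0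
                (by positivity)
          _ = 1296 * (1 * (ε⁻¹ * K * lam)) := by ring
          _ ≤ 10000 ^ 2 * (logOne K ^ 2 * (ε⁻¹ * K * lam)) := by gcongr; norm_num
      · calc _ ≤ 1296 * (ε⁻¹ * 1 * lam) := (min_le_right _ _).trans (by linarith)
          _ ≤ 10000 * (ε⁻¹ * T * lam) := by gcongr; norm_num
    · have herr' := herr (Set.notMem_empty m)
      have hm' : (1 : ℝ) ≤ m := by exact_mod_cast hm1
      have hhalf := mul_half_le_of_sum_le hmono (fun m => (hpos m).le) hsum
      have hs8 : P.scale m ≤ 8 * P.scale (m / 2) := by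
        have h1 := pureSlope_pos (T := T) hε m
        have h2 := pureSlope_pos (T := T) hε (m / 2)
        rw [hscale, hscale, ← mul_div_assoc, div_le_div_iff₀ h1 h2]
        nlinarith [pureSlope_le_half hε hmT]
      have hmK8 : m * P.scale m ≤ 8 * K := by nlinarith
      have hgrow := growth_le_logOne hm1 hmK
      have hsm := hpos m
      have hsG : P.scale m ≤ 24 * (9 * lam) * (18 * m * logOne K ^ 2) / ε := by
        refine (hscaleG m).trans ?_
        have := growth_pos m
        gcongr
      refine le_mul_min_add (by norm_num) (Nat.cast_nonneg d) hed
        (show e ≤ 6 * P.scale m + R 0 by linarith) hR0n hR0' ?_ (hthird _ ?_) ?_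
      · nlinarith
      · calc (6 * P.scale m) ^ 2 = 36 * P.scale m * P.scale m := by ring
          _ ≤ 36 * P.scale m * (24 * (9 * lam) * (18 * m * logOne K ^ 2) / ε) := by gcongr
          _ = 139968 * (m * P.scale m) * (lam * logOne K ^ 2 * ε⁻¹) := by
              rw [div_eq_mul_inv]; ring
          _ ≤ 139968 * (8 * K) * (lam * logOne K ^ 2 * ε⁻¹) := by gcongr
          _ = 1119744 * (logOne K ^ 2 * (ε⁻¹ * K * lam)) := by ring
          _ ≤ _ := by gcongr; norm_num
      · calc 6 * P.scale m ≤ 6 * (24 * (9 * lam) * T / ε) := by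
              have := hscaleT m hmT
              have h3 : 24 * L * T / ε ≤ 24 * (9 * lam) * T / ε := by gcongr
              linarith
          _ = 1296 * (ε⁻¹ * T * lam) := by rw [div_eq_mul_inv]; ring
          _ ≤ _ := by gcongr; norm_num

end Pure

/-! ### Approximate differential privacy -/

section Approx

/-- The growth of the error scale under approximate differential privacy. -/
noncomputable def cappedGrowth (l : ℝ) (m : ℕ) : ℝ := min (2 ^ m) (Real.sqrt (l * growth m))

variable {T : ℕ} {ε l : ℝ}

theorem cappedGrowth_pos (hl : 1 ≤ l) (m : ℕ) : 0 < cappedGrowth l m := by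
  have := growth_pos m
  exact lt_min (by positivity) (Real.sqrt_pos.2 (by positivity))

theorem cappedGrowth_mono (hl : 1 ≤ l) : Monotone (cappedGrowth l) := fun m n h =>
  min_le_min (pow_le_pow_right₀ one_le_two h)
    (Real.sqrt_le_sqrt (mul_le_mul_of_nonneg_left (growth_mono h) (by linarith)))

theorem cappedGrowth_sq_le (hl : 1 ≤ l) (m : ℕ) : cappedGrowth l m ^ 2 ≤ l * growth m := by
  have h1 := cappedGrowth_pos hl m
  have h2 := growth_pos m
  calc cappedGrowth l m ^ 2 ≤ Real.sqrt (l * growth m) ^ 2 := by gcongr; exact min_le_right _ _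
    _ = _ := Real.sq_sqrt (by positivity)

theorem sqrt_growth_le {m n : ℕ} (hl : 1 ≤ l) (h : growth m ≤ 8 * growth n) :
    Real.sqrt (l * growth m) ≤ 3 * Real.sqrt (l * growth n) := by
  have h2 := growth_pos n
  refine Real.sqrt_le_iff.2 ⟨by positivity, ?_⟩
  rw [mul_pow, Real.sq_sqrt (by positivity)]
  nlinarith

theorem cappedGrowth_succ_le (hl : 1 ≤ l) (m : ℕ) :
    cappedGrowth l (m + 1) ≤ 3 * cappedGrowth l m := by
  have h1 : growth (m + 1) ≤ 8 * growth m :=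
    (growth_le_half (m + 1)).trans
      (mul_le_mul_of_nonneg_left (growth_mono (by omega)) (by norm_num))
  have h2 := sqrt_growth_le hl h1
  have h3 : (0 : ℝ) < 2 ^ m := by positivity
  unfold cappedGrowth
  rcases min_choice ((2 : ℝ) ^ m) (Real.sqrt (l * growth m)) with h | h <;> rw [h]
  · refine (min_le_left _ _).trans ?_
    rw [pow_succ]
    linarith
  · exact (min_le_right _ _).trans h2

/-- The privacy cost of a round is summable: linearly where `2 ^ m` caps, else quadratically. -/
theorem min_div_cappedGrowth_le (hl : 1 ≤ l) {a : ℝ} (ha : 0 ≤ a) (m : ℕ) :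
    min ((a / cappedGrowth l m) ^ 2) (a / cappedGrowth l m)
      ≤ a * (1 / 2) ^ m + a ^ 2 / l * (growth m)⁻¹ := by
  have h2 := growth_pos m
  have h3 : 0 ≤ a * (1 / 2) ^ m := by positivity
  have h4 : 0 ≤ a ^ 2 / l * (growth m)⁻¹ := by positivity
  rcases min_choice ((2 : ℝ) ^ m) (Real.sqrt (l * growth m)) with h | h
  · refine (min_le_right _ _).trans ?_
    have : a / cappedGrowth l m = a * (1 / 2) ^ m := by
      rw [cappedGrowth, h, one_div, inv_pow, div_eq_mul_inv]
    linarith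
  · refine (min_le_left _ _).trans ?_
    have : (a / cappedGrowth l m) ^ 2 = a ^ 2 / l * (growth m)⁻¹ := by
      rw [cappedGrowth, h, div_pow, Real.sq_sqrt (by positivity)]
      field_simp
    linarith

theorem sum_cost_le (hl : 1 ≤ l) {a b : ℝ} (ha : 0 ≤ a) (hb : 0 ≤ b) (m : ℕ) :
    ∑ j ∈ Finset.range m, (a * (1 / 2) ^ j + b / l * (growth j)⁻¹) ≤ 2 * a + 2 * b / l := by
  rw [Finset.sum_add_distrib, ← Finset.mul_sum, ← Finset.mul_sum]
  have h1 := mul_le_mul_of_nonneg_left (sum_geometric_two_le m) ha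
  have h2 := mul_le_mul_of_nonneg_left (sum_inv_growth_le m) (show 0 ≤ b / l by positivity)
  have e : 2 * b / l = b / l * 2 := by ring
  linarith

/-- The slopes of the tests under approximate differential privacy. -/
noncomputable def approxSlope (ε l : ℝ) (m : ℕ) : ℝ := ε / 64 / cappedGrowth l m

theorem approxSlope_pos (hε : 0 < ε) (hl : 1 ≤ l) (m : ℕ) : 0 < approxSlope ε l m :=
  div_pos (by positivity) (cappedGrowth_pos hl m)

theorem approxSlope_anti (hε : 0 < ε) (hl : 1 ≤ l) : Antitone (approxSlope ε l) := fun m _ h =>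
  div_le_div_of_nonneg_left (by positivity) (cappedGrowth_pos hl m) (cappedGrowth_mono hl h)

open Classical in
/-- The mechanism with approximate differential privacy. -/
noncomputable def approxTracker (hε : 0 < ε) (hl : 1 ≤ l) {τ : ℝ} (hτ : 0 < τ) (L : ℝ)
    (D : Set ℕ) : Tracker where
  γ := approxSlope ε l
  L := L
  ν
    | 0 => discreteLaplace (ε / 2) (half_pos hε)
    | m + 1 =>
      if m + 1 ∈ D then discreteGaussian τ hτ
      else discreteLaplace (approxSlope ε l (m + 1)) (approxSlope_pos hε hl _)
  direct := D

theorem itemLevelDP_approxTracker {d : ℕ} {δ τ : ℝ} (hT : 0 < T) (hε : 0 < ε) (hε1 : ε < 1)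
    (hδ : 0 < δ) (hl : 1 ≤ l) (hδl : Real.log (1 / δ) ≤ l) (hτ : 0 < τ)
    (hτT : τ * (180 * l * T) ≤ ε ^ 2) (L : ℝ) {D : Set ℕ} (hD : 0 ∉ D)
    (dec : List (Option ℤ) → ℝ) :
    (onlineAlgorithm d T (approxTracker hε hl hτ L D).strategy dec).ItemLevelDP ε δ := by
  have hT' : (0 : ℝ) < T := by exact_mod_cast hT
  -- The order must be large enough for `k * ε` to dominate `log (1 / δ)`, and of order `l / ε` so
  -- that the quadratic costs `((k + 1) * ε) ^ 2 / l` stay of order `l`.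
  set k := ⌈8 * l / ε⌉₊ with hk
  have hk1 : 8 * l / ε ≤ k := Nat.le_ceil _
  have hk2 : (k : ℝ) < 8 * l / ε + 1 := Nat.ceil_lt_add_one (by positivity)
  have hk3 : 8 * l ≤ k * ε := (div_le_iff₀ hε).1 hk1
  have hk4 : k * ε ≤ 9 * l := by
    have : k * ε ≤ (8 * l / ε + 1) * ε := by gcongr
    rw [add_mul, div_mul_cancel₀ _ hε.ne'] at this
    linarith
  have hk5 : ((k : ℝ) + 1) * ε ≤ 10 * l := by nlinarith
  have hk6 : (1 : ℝ) ≤ k := by nlinarith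
  set n : ℝ := k + 1 with hn
  have hn0 : 0 < n := by positivity
  set B := τ * (k * (k + 1)) with hB
  have hB0 : 0 ≤ B := by positivity
  have hBT : B * T ≤ l / 2 := by
    have h1 : (k * ε) * (n * ε) ≤ 9 * l * (10 * l) := by gcongr
    have h2 : τ * (180 * l * T) * (k * n) ≤ ε ^ 2 * (k * n) := by gcongr
    have h3 : (B * T) * (180 * l) ≤ l / 2 * (180 * l) := by
      calc B * T * (180 * l) = τ * (180 * l * T) * (k * n) := by rw [hB, hn]; ring
        _ ≤ _ := h2
        _ = (k * ε) * (n * ε) := by ring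
        _ ≤ _ := h1
        _ = _ := by ring
    exact le_of_mul_le_mul_right h3 (by positivity)
  set P := approxTracker hε hl hτ L D with hP
  refine itemLevelDP_onlineAlgorithm hT _ dec hδ.le fun cs cs' hlink hlen S => ?_
  -- `zs` has the first count of `cs` and all later counts of `cs'`. Between `cs` and `zs` the first
  -- release is unaffected and the Rényi bound applies; between `zs` and `cs'` only the first
  -- release changes, at a pointwise cost of `ε / 2`.
  obtain ⟨zs, h1, h2⟩ := hlink.exists_between
  set a := n * (ε / 64) with ha
  have ha0 : 0 ≤ a := by positivity
  have hM := Tracker.tsum_renyiTerm_likelihood_le (P := P) (A := 8 * a + 20 * a ^ 2 / l) (B := B)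
    (fun m => (approxSlope_pos hε hl m).le) k T hB0
    (x := fun m => 3 * a * (1 / 2) ^ m + (3 * a) ^ 2 / l * (growth m)⁻¹)
    (y := fun m => a * (1 / 2) ^ m + a ^ 2 / l * (growth m)⁻¹) ?_ ?_ ?_ ?_ ?_ h1 hlen
  · have hmain := tsum_indicator_le_of_renyi k (fun i => likelihood_ne_top P.strategy cs i)
      (fun i => likelihood_ne_top P.strategy zs i)
      (Tracker.likelihood_le_of_linked_eq (P := P) (θ := ε / 2) ?_ h2)
      (e₂ := ENNReal.ofReal (Real.exp (ε / 2))) ENNReal.ofReal_ne_top hM S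
    · refine hmain.trans (add_le_add (le_of_eq ?_) ?_)
      · rw [← ENNReal.ofReal_mul (Real.exp_nonneg _), ← Real.exp_add, add_halves]
      · rw [← ENNReal.ofReal_pow (Real.exp_nonneg _), ← Real.exp_nat_mul,
          ← ENNReal.ofReal_div_of_pos (Real.exp_pos _), ← Real.exp_sub]
        refine ENNReal.ofReal_le_ofReal ?_
        rw [← Real.le_log_iff_exp_le hδ]
        rw [one_div, Real.log_inv] at hδl
        -- The exponent is at most `k * ε / 4 + l / 2 + l / 2 - k * ε / 2 ≤ -l`, because `k * ε ≥ 8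
        -- * l`.
        have h8 : 8 * a ≤ k * ε / 4 := by
          rw [ha, hn]
          nlinarith
        have h20 : 20 * a ^ 2 / l ≤ l / 2 := by
          have h64 : a * 64 ≤ 10 * l := by rw [ha]; linarith
          rw [div_le_iff₀ (by linarith)]
          nlinarith [pow_le_pow_left₀ (by positivity) h64 2]
        linarith
    · intro c c' v hc
      refine discreteLaplace_le_mul (half_pos hε) le_rfl ?_
      rw [sub_sub_sub_cancel_left]
      exact hc.symm
  · intro m
    have := min_div_cappedGrowth_le hl (a := 3 * a) (by positivity) m
    have e : (k + 1) * (3 * P.γ m) = 3 * a / cappedGrowth l m := by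
      change (k + 1) * (3 * (ε / 64 / cappedGrowth l m)) = _
      rw [ha, hn]; ring
    rwa [e]
  · intro m
    have := growth_pos m
    positivity
  · intro m hm c c' hc
    obtain _ | m := m
    · exact absurd hm hD
    · have : P.ν (m + 1) = discreteGaussian τ hτ := if_pos hm
      rw [this]
      exact tsum_renyiTerm_discreteGaussian_le k hτ hc
  · intro m c c' hc
    have hy : 0 ≤ a * (1 / 2) ^ m + a ^ 2 / l * (growth m)⁻¹ := by
      have := growth_pos m
      positivity
    by_cases hm : m + 1 ∈ D
    · have : P.ν (m + 1) = discreteGaussian τ hτ := if_pos hm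
      rw [this]
      refine (tsum_renyiTerm_discreteGaussian_le k hτ hc).trans
        (ENNReal.ofReal_le_ofReal (Real.exp_le_exp.2 ?_))
      linarith
    · have : P.ν (m + 1) = discreteLaplace (approxSlope ε l (m + 1)) (approxSlope_pos hε hl _) :=
        if_neg hm
      rw [this]
      refine tsum_renyiTerm_discreteLaplace_le k _ (approxSlope_anti hε hl (Nat.le_succ m)) hc ?_
      have h3 := min_div_cappedGrowth_le hl ha0 m
      have e : (k + 1) * approxSlope ε l m = a / cappedGrowth l m := by
        rw [approxSlope, ha, hn]; ring
      rw [e]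
      linarith
  · intro m
    have h3 := sum_cost_le hl (a := 3 * a) (b := (3 * a) ^ 2) (by positivity) (by positivity) m
    have h4 := sum_cost_le hl (a := a) (b := a ^ 2) (by positivity) (by positivity) m
    rw [Finset.sum_add_distrib]
    refine (add_le_add h3 h4).trans (le_of_eq ?_)
    ring

/-- If the test threshold is still governed by the cap, then there have been few rounds. -/
theorem growth_le_of_two_pow_le {m K : ℕ} (h : 2 * (2 : ℝ) ^ (m / 2) ≤ K) :
    growth m ≤ 36 * logOne K ^ 2 := by
  have h1 : ((m / 2 + 1 : ℕ) : ℝ) * Real.log 2 ≤ logOne K := by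
    rw [← Real.log_pow]
    refine (Real.log_le_log (by positivity) ?_).trans (log_le_logOne K)
    rwa [pow_succ, mul_comm]
  have h2 : (m : ℝ) + 1 ≤ 2 * ((m / 2 + 1 : ℕ) : ℝ) := by
    have : m + 1 ≤ 2 * (m / 2 + 1) := by omega
    exact_mod_cast this
  have h3 : (m : ℝ) + 1 ≤ 3 * logOne K := by
    nlinarith [Real.log_two_gt_d9]
  have h4 := growth_le_sq m
  have h5 := pow_le_pow_left₀ (by positivity) h3 2
  nlinarith

-- The cube-root bound comes from `s m ^ 2 ≲ (L / ε) ^ 2 * l * growth m` together with `s m * growth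
-- m ≲ K * logOne K ^ 2`. The cap `2 ^ m` keeps the threshold of round `0` free of `√l`: when `log
-- (T / β) > 4 * T`, the error of that round goes into the additive term, which does not contain
-- `l`.
set_option maxHeartbeats 1000000 in
theorem exists_approx {d : ℕ} {β δ : ℝ} (hT : 0 < T) (hβ : 0 < β) (hβ1 : β < 1) (hε : 0 < ε)
    (hε1 : ε < 1) (hδ : 0 < δ) :
    ∃ A : OnlineAlgorithm d T, A.ItemLevelDP ε δ ∧
      A.HasError β (fun K => 10000 * approxBound d T ε δ β K) := by
  have hT' : (0 : ℝ) < T := by exact_mod_cast hT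
  have hT1 : (1 : ℝ) ≤ T := by exact_mod_cast hT
  set l := logOne (1 / δ) with hl
  have hl1 : 1 ≤ l := one_le_logOne _
  set L := testLevel T β with hL
  have hL1 : 1 ≤ L := one_le_testLevel hT hβ hβ1
  set τ := ε ^ 2 / (180 * l * T) with hτ
  have hτ0 : 0 < τ := by positivity
  set ρ := Real.sqrt (L / τ) with hρ
  have hρ0 : 0 ≤ ρ := Real.sqrt_nonneg _
  have hρ2 : ρ ^ 2 = L / τ := Real.sq_sqrt (by positivity)
  set s : ℕ → ℝ := fun m => 64 * L * cappedGrowth l m / ε with hs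
  -- `τ` makes `T` Gaussian releases affordable and `ρ` bounds their error, so testing is abandoned
  -- once its scale reaches `ρ`. Round `0` is excluded, since it starts from the Laplace release
  -- with its special tail.
  set D : Set ℕ := {m | 1 ≤ m ∧ ρ ≤ s m} with hD
  have hD0 : 0 ∉ D := fun h => absurd h.1 (by norm_num)
  set P := approxTracker hε hl1 hτ0 L D with hP
  have hγ : ∀ m, 0 < P.γ m := approxSlope_pos hε hl1
  have hscale : P.scale = s := by
    funext m
    change L / (ε / 64 / cappedGrowth l m) = _
    have := cappedGrowth_pos hl1 m
    rw [hs]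
    field_simp
  have hpos : ∀ m, 0 < s m := fun m => by
    have := cappedGrowth_pos hl1 m
    positivity
  have hmono : Monotone s := fun m n h => by
    have := cappedGrowth_mono hl1 h
    simp only [hs]
    gcongr
  have hlog : 0 ≤ Real.log (1 / β) := Real.log_nonneg ((one_le_div hβ).2 hβ1.le)
  classical
  set R : ℕ → ℝ := fun m =>
    if m = 0 then 8 * Real.log (1 / β) / ε else if m ∈ D then ρ else 2 * s m with hR
  have hR0 : R 0 = 8 * Real.log (1 / β) / ε := by simp [hR]
  have hRD : ∀ m ∈ D, R m = ρ := fun m hm => by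
    have : m ≠ 0 := fun h => hD0 (h ▸ hm)
    simp [hR, hm, this]
  have hRn : ∀ m, m ∉ D → m ≠ 0 → R m = 2 * s m := fun m hm h0 => by simp [hR, hm, h0]
  have hF0 : cappedGrowth l 0 = 1 := by
    rw [cappedGrowth, growth_zero, pow_zero, mul_one]
    exact min_eq_left (Real.one_le_sqrt.2 hl1)
  have hs0 : s 0 = 64 * L / ε := by simp [hs, hF0]
  have hexp := exp_neg_testLevel_le hT hβ
  rw [← hL] at hexp
  have hexp' : Real.exp (-L) ≤ β / (8 * T) := by linarith [Real.exp_pos (-L)]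
  refine ⟨onlineAlgorithm d T P.strategy (P.publish d),
    itemLevelDP_approxTracker hT hε hε1 hδ hl1 (log_le_logOne _) hτ0
      (le_of_eq (div_mul_cancel₀ _ (by positivity))) L hD0 _, ?_⟩
  refine Tracker.hasError_onlineAlgorithm (R := R) (η := β / (8 * T)) (b := β ^ 2)
    (show 0 < L by linarith) hγ (by positivity) hexp' hD0 ?_ ?_ (by positivity) ?_
    (failure_le hT hβ hβ1).1 (failure_le hT hβ hβ1).2 ?_
  · intro m hm
    rw [hscale]
    by_cases h0 : m = 0
    · subst h0
      rw [hR0, hs0]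
      have h1 := log_inv_le_testLevel hT hβ
      rw [← hL] at h1
      rw [← mul_div_assoc]
      exact div_le_div_of_nonneg_right (by linarith) hε.le
    · exact (hRn m hm h0).le
  · intro m
    by_cases hm : m + 1 ∈ D
    · have : P.ν (m + 1) = discreteGaussian τ hτ0 := if_pos hm
      rw [this, hRD _ hm]
      refine (tailProb_discreteGaussian_le hτ0 hρ0).trans (ENNReal.ofReal_le_ofReal ?_)
      rwa [hρ2, neg_mul, mul_div_cancel₀ _ hτ0.ne']
    · have : P.ν (m + 1) = discreteLaplace (approxSlope ε l (m + 1)) (approxSlope_pos hε hl1 _) :=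
        if_neg hm
      rw [this, hRn _ hm (Nat.succ_ne_zero m)]
      have h1 := approxSlope_pos hε hl1 (m + 1)
      refine (tailProb_discreteLaplace_le _ (by have := hpos (m + 1); positivity)).trans
        (ENNReal.ofReal_le_ofReal (le_trans (le_of_eq ?_) hexp'))
      rw [← hscale]
      change Real.exp (-approxSlope ε l (m + 1) * (2 * (L / approxSlope ε l (m + 1))) / 2) = _
      congr 1
      field_simp
  · rw [hR0]
    refine (tailProb_discreteLaplace_le (half_pos hε) (by positivity)).trans
      (ENNReal.ofReal_le_ofReal (le_of_eq ?_))
    exact exp_tail_init hε hβ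
  · rw [hscale]
    intro K hKT e hed hcases
    have hadd := additiveTerm_ge (K := K) hε hβ hβ1
    have hlogT := log_div_nonneg hT hβ hβ1
    have hℓ := one_le_logOne K
    set lam := Real.log (T / β) with hlam
    have hX3 : 0 ≤ ε⁻¹ ^ 2 * K * logOne K ^ 2 * l * lam ^ 2 := by positivity
    have hX4 : 0 ≤ ε⁻¹ * Real.sqrt (T * l * lam) := by positivity
    have hd0 : (0 : ℝ) ≤ Real.log (1 / β) / ε := by positivity
    have hR0' : R 0 ≤ 8 * (Real.log (1 / β) / ε) := by rw [hR0, mul_div_assoc]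
    have hR0'' : R 0 ≤ 10000 * additiveTerm K ε β := by linarith
    have hR0n : 0 ≤ R 0 := by rw [hR0]; positivity
    rw [approxBound]
    have hthird : ∀ y : ℝ, 0 ≤ y →
        y ^ 3 ≤ 10000 ^ 3 * (ε⁻¹ ^ 2 * K * logOne K ^ 2 * l * lam ^ 2) →
        y ≤ 10000 * (ε⁻¹ ^ 2 * K * logOne K ^ 2 * l * lam ^ 2) ^ (1 / 3 : ℝ) := by
      intro y hy0 hy
      refine le_of_pow_le_pow_left₀ three_ne_zero (by positivity) (hy.trans (le_of_eq ?_))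
      rw [mul_pow, ← Real.rpow_natCast (_ ^ (1 / 3 : ℝ)), ← Real.rpow_mul hX3]
      norm_num
    have hfourth : ∀ y : ℝ, y ^ 2 ≤ 10000 ^ 2 * (ε⁻¹ ^ 2 * (T * l * lam)) →
        y ≤ 10000 * (ε⁻¹ * Real.sqrt (T * l * lam)) := by
      intro y hy
      refine le_of_sq_le_sq (hy.trans (le_of_eq ?_)) (by positivity)
      rw [mul_pow, mul_pow, Real.sq_sqrt (by positivity)]
    rcases Nat.eq_zero_or_pos K with hK | hK
    · have he : e ≤ 0 + R 0 := by
        rcases hcases with h | ⟨m, h1, -, h3, -⟩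
        · simpa [hK] using h.1
        · omega
      exact le_mul_min_add (by norm_num) (Nat.cast_nonneg d) hed he hR0n hR0'' (by positivity)
        (by positivity) (by positivity)
    have hT2 := hKT hK.ne'
    have hL9 : L ≤ 9 * lam := testLevel_le hT2 hβ hβ1
    have hK1 : (1 : ℝ) ≤ K := by exact_mod_cast hK
    have hℓ2 : 1 ≤ logOne K ^ 2 := one_le_pow₀ hℓ
    rcases hcases with ⟨h1, h2⟩ | ⟨m, hm1, hmT, hmK, hsum, hdir, hndir⟩
    · have hs0' : 6 * s 0 ≤ 3456 * (ε⁻¹ * lam) := by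
        rw [hs0, div_eq_inv_mul]
        have h3 : ε⁻¹ * (64 * L) ≤ ε⁻¹ * (64 * (9 * lam)) := by gcongr
        linarith
      have h6s : 0 ≤ 6 * s 0 := by have := hpos 0; positivity
      have hmin0 : 0 ≤ min (K : ℝ) (6 * s 0) := le_min (by positivity) h6s
      have he : e ≤ min (K : ℝ) (6 * s 0) + R 0 := by
        rcases min_choice (K : ℝ) (6 * s 0) with h | h <;> rw [h] <;> linarith
      have hmin : min (K : ℝ) (6 * s 0) ≤ 3456 * (ε⁻¹ * lam) := (min_le_right _ _).trans hs0'
      rcases le_or_gt lam (4 * T) with hlT | hlT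
      · refine le_mul_min_add (by norm_num) (Nat.cast_nonneg d) hed he hR0n hR0'' ?_
          (hthird _ hmin0 ?_) (hfourth _ ?_)
        · linarith [min_le_left (K : ℝ) (6 * s 0)]
        · calc min (K : ℝ) (6 * s 0) ^ 3
              = min (K : ℝ) (6 * s 0) * min (K : ℝ) (6 * s 0) ^ 2 := by ring
            _ ≤ K * (3456 * (ε⁻¹ * lam)) ^ 2 := by gcongr; exact min_le_left _ _
            _ = 3456 ^ 2 * (ε⁻¹ ^ 2 * K * 1 * 1 * lam ^ 2) := by ring
            _ ≤ 10000 ^ 3 * (ε⁻¹ ^ 2 * K * logOne K ^ 2 * l * lam ^ 2) := by gcongr; norm_num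
        · calc min (K : ℝ) (6 * s 0) ^ 2 ≤ (3456 * (ε⁻¹ * lam)) ^ 2 := by gcongr
            _ = 3456 ^ 2 * (ε⁻¹ ^ 2 * (lam * 1 * lam)) := by ring
            _ ≤ 3456 ^ 2 * (ε⁻¹ ^ 2 * (4 * T * l * lam)) := by gcongr
            _ = 3456 ^ 2 * 4 * (ε⁻¹ ^ 2 * (T * l * lam)) := by ring
            _ ≤ _ := by gcongr; norm_num
      -- Here `log T ≤ T - 1 < lam / 4`, so `lam` consists mostly of `log (1 / β)` and the additive
      -- term absorbs the whole error.
      · have hlamβ : lam ≤ 4 / 3 * Real.log (1 / β) := by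
          have e1 : lam = Real.log T + Real.log (1 / β) := by
            rw [hlam, ← Real.log_mul (by positivity) (by positivity), mul_one_div]
          have := Real.log_le_sub_one_of_pos hT'
          linarith
        have hr : 3456 * (ε⁻¹ * lam) ≤ 4608 * (Real.log (1 / β) / ε) := by
          have : ε⁻¹ * lam ≤ ε⁻¹ * (4 / 3 * Real.log (1 / β)) := by gcongr
          rw [div_eq_inv_mul]
          linarith
        exact le_mul_min_add (by norm_num) (Nat.cast_nonneg d) hed
          (show e ≤ 0 + (3456 * (ε⁻¹ * lam) + R 0) by linarith) (by positivity) (by linarith)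
          (by positivity) (by positivity) (by positivity)
    · have he : e ≤ 6 * s m ∧ e ≤ 6 * ρ := by
        have := hpos m
        by_cases hm : m ∈ D
        · have h1 := hdir hm
          rw [hRD m hm] at h1
          have := hm.2
          constructor <;> linarith
        · have h1 := hndir hm
          have h2 : s m < ρ := not_le.1 fun h => hm ⟨hm1, h⟩
          constructor <;> linarith
      have hsm := hpos m
      have hlin : ∀ j, j < m → 2 * s j ≤ K := fun j hj =>
        (Finset.single_le_sum (f := fun j => 2 * s j)
          (fun i _ => by have := hpos i; positivity) (Finset.mem_range.2 hj)).trans hsum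
      have hs3 : s m ≤ 3 * s (m - 1) := by
        obtain ⟨j, rfl⟩ : ∃ j, m = j + 1 := ⟨m - 1, by omega⟩
        have := cappedGrowth_succ_le hl1 j
        simp only [hs, Nat.add_sub_cancel]
        calc 64 * L * cappedGrowth l (j + 1) / ε ≤ 64 * L * (3 * cappedGrowth l j) / ε := by gcongr
          _ = _ := by ring
      have hsK : s m ≤ 3 / 2 * K := by linarith [hlin (m - 1) (by omega)]
      -- If the cap still rules at `m / 2`, then `2 ^ (m / 2) ≲ K`, so `m ≲ logOne K`, and `s m ≲ K`
      -- is enough. Otherwise `s m` and `s (m / 2)` are comparable, so that `m * s m ≲ K`.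
      have hgrow : s m * growth m ≤ 54 * K * logOne K ^ 2 := by
        have hg := growth_pos m
        rcases min_choice ((2 : ℝ) ^ (m / 2)) (Real.sqrt (l * growth (m / 2))) with h | h
        · have h1 : 2 * (2 : ℝ) ^ (m / 2) ≤ K := by
            refine le_trans ?_ (hlin (m / 2) (by omega))
            simp only [hs, cappedGrowth, h]
            rw [mul_le_mul_iff_right₀ two_pos, le_div_iff₀ hε]
            rw [mul_comm]
            gcongr
            linarith
          calc s m * growth m ≤ 3 / 2 * K * (36 * logOne K ^ 2) := by
                gcongr
                exact growth_le_of_two_pow_le h1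
            _ = _ := by ring
        · have h1 := mul_half_le_of_sum_le hmono (fun m => (hpos m).le) hsum
          have h2 : s m ≤ 3 * s (m / 2) := by
            have h3 : cappedGrowth l m ≤ 3 * cappedGrowth l (m / 2) := by
              rw [cappedGrowth, cappedGrowth, h]
              exact (min_le_right _ _).trans (sqrt_growth_le hl1 (growth_le_half m))
            simp only [hs]
            calc 64 * L * cappedGrowth l m / ε ≤ 64 * L * (3 * cappedGrowth l (m / 2)) / ε := by
                  gcongr
              _ = _ := by ring
          have h3 : m * s m ≤ 3 * K := by
            have : (m : ℝ) * s m ≤ m * (3 * s (m / 2)) := by gcongr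
            linarith
          calc s m * growth m ≤ s m * (18 * m * logOne K ^ 2) := by
                gcongr
                exact growth_le_logOne hm1 hmK
            _ = 18 * (m * s m) * logOne K ^ 2 := by ring
            _ ≤ 18 * (3 * K) * logOne K ^ 2 := by gcongr
            _ = _ := by ring
      refine le_mul_min_add (by norm_num) (Nat.cast_nonneg d) hed
        (show e ≤ e + R 0 by linarith) hR0n hR0'' (by linarith)
        (he.1.trans (hthird _ (by positivity) ?_)) (he.2.trans (hfourth _ ?_))
      · have hF := cappedGrowth_sq_le hl1 m
        have hs2 : s m ^ 2 ≤ (64 * (9 * lam) * ε⁻¹) ^ 2 * (l * growth m) := by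
          have hc := cappedGrowth_pos hl1 m
          calc s m ^ 2 = (64 * L * ε⁻¹) ^ 2 * cappedGrowth l m ^ 2 := by
                simp only [hs, div_eq_mul_inv]; ring
            _ ≤ _ := by gcongr
        calc (6 * s m) ^ 3 = 216 * s m * s m ^ 2 := by ring
          _ ≤ 216 * s m * ((64 * (9 * lam) * ε⁻¹) ^ 2 * (l * growth m)) := by gcongr
          _ = 216 * 576 ^ 2 * (s m * growth m) * (lam ^ 2 * ε⁻¹ ^ 2 * l) := by ring
          _ ≤ 216 * 576 ^ 2 * (54 * K * logOne K ^ 2) * (lam ^ 2 * ε⁻¹ ^ 2 * l) := by gcongr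
          _ = 216 * 576 ^ 2 * 54 * (ε⁻¹ ^ 2 * K * logOne K ^ 2 * l * lam ^ 2) := by ring
          _ ≤ _ := by gcongr; norm_num
      · calc (6 * ρ) ^ 2 = 36 * (L / τ) := by rw [mul_pow, hρ2]; norm_num
          _ ≤ 36 * (9 * lam / τ) := by gcongr
          _ = 58320 * (ε⁻¹ ^ 2 * (T * l * lam)) := by rw [hτ]; field_simp; ring
          _ ≤ _ := by gcongr; norm_num

end Approx

/-! ### The case `β ≥ 1`, where accuracy is void -/

section Trivial

theorem exists_of_one_le {d T : ℕ} {ε δ β : ℝ} (hε : 0 ≤ ε) (hδ : 0 ≤ δ) (hβ : 1 ≤ β)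
    (err : ℕ → ℝ) : ∃ A : OnlineAlgorithm d T, A.ItemLevelDP ε δ ∧ A.HasError β err := by
  refine ⟨⟨Unit, inferInstance, Measure.dirac (), inferInstance, fun _ _ _ => 0,
    fun _ => measurable_const, fun _ _ _ _ _ => rfl⟩, fun x y _ S _ => ?_, fun x => ?_⟩
  · have := Real.one_le_exp hε
    refine (le_mul_of_one_le_left measureReal_nonneg this).trans ?_
    linarith
  · exact (sub_nonpos.2 hβ).trans measureReal_nonneg

end Trivial

end CountDistinct

theorem theoremA3 :
    ∃ C : ℝ, 0 < C ∧
      ∀ d T : ℕ, 0 < d → 0 < T → ∀ β : ℝ, 0 < β →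
        (∀ ε : ℝ, 0 < ε →
          ∃ A : CountDistinct.OnlineAlgorithm d T,
            A.ItemLevelDP ε 0 ∧
            A.HasError β (fun K => C * CountDistinct.pureBound d T ε β K)) ∧
        (∀ ε δ : ℝ, 0 < ε → ε < 1 → 0 < δ → δ < 1 →
          ∃ A : CountDistinct.OnlineAlgorithm d T,
            A.ItemLevelDP ε δ ∧
            A.HasError β (fun K => C * CountDistinct.approxBound d T ε δ β K)) := by
  refine ⟨10000, by norm_num, fun d T _ hT β hβ => ⟨fun ε hε => ?_, fun ε δ hε hε1 hδ _ => ?_⟩⟩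
  · rcases lt_or_ge β 1 with h | h
    · exact CountDistinct.exists_pure hT hβ h hε
    · exact CountDistinct.exists_of_one_le hε.le le_rfl h _
  · rcases lt_or_ge β 1 with h | h
    · exact CountDistinct.exists_approx hT hβ h hε hε1 hδ
    · exact CountDistinct.exists_of_one_le hε.le hδ.le h _
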